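/- Let $(M,\Omega)$ be a closed connected symplectic manifold, and let $\mathrm{Ham}(M,\Omega)$ be its group of Hamiltonian diffeomorphisms, i.e. time-one maps of flows of smooth time-dependent Hamiltonians, where $\operatorname{sgrad}F$ is defined by $\Omega(\operatorname{sgrad}F,\cdot)=-dF$. Put $S^1=\mathbb R/\mathbb Z$. A smooth loop $h\colon S^1\to \mathrm{Ham}(M,\Omega)$ is a family of elements $h(t)\in\mathrm{Ham}(M,\Omega)$ such that $(t,x)\mapsto h(t)x$ is smooth; $\pi_1(\mathrm{Ham}(M,\Omega))$ is the (abelian) group of smooth loops based at the identity up to smooth based homotopy in $\mathrm{Ham}(M,\Omega)$. A free smooth loop represents $\gamma\in\pi_1(\mathrm{Ham}(M,\Omega))$ if it is freely smoothly homotopic to a based loop of class $\gamma$. For $\gamma\in\pi_1(\mathrm{Ham}(M,\Omega))$ let $$\nu(\gamma)=\inf\int_0^1\bigl(\max_M F_t-\min_M F_t\bigr)\,dt,$$ where the infimum is over all smooth loops $\{f_t\}$ based at the identity that represent $\gamma$, and $F_t$ is the Hamiltonian generating $\{f_t\}$, $\frac{d}{dt}f_t x=\operatorname{sgrad}F_t(f_t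 x)$. A self-map $T$ of a compact space is called strictly ergodic if it has exactly one invariant Borel probability measure, and this measure is positive on nonempty open sets. A smooth free loop $h\colon S^1\to\mathrm{Ham}(M,\Omega)$ is called strictly ergodic if for some irrational $\alpha$ the skew product $$T_{h,\alpha}\colon M\times S^1\to M\times S^1,\qquad T_{h,\alpha}(y,t)=(h(t)y,\,t+\alpha),$$ is strictly ergodic. **Theorem.** If $\gamma\in\pi_1(\mathrm{Ham}(M,\Omega))$ is represented by a smooth strictly ergodic loop, then its asymptotic Hofer norm vanishes: the limit $\lim_{k\to+\infty}\nu(k\gamma)/k$ exists and equals $0$. -/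

import Mathlib

open Set Filter Topology MeasureTheory
open scoped Manifold ContDiff

noncomputable section

/-! ### Symplectic forms on a manifold modelled on a vector space -/

section Symplectic

variable (E : Type*) [NormedAddCommGroup E] [NormedSpace ℝ E]
  (M : Type*) [TopologicalSpace M] [ChartedSpace E M]

/-- The expression of a field of alternating bilinear forms in the chart at `x₀`: its pullback under
the inverse of the chart. It is meaningful on the (open) target of the chart. -/
def chartForm {E : Type*} [NormedAddCommGroup E] [NormedSpace ℝ E]
    {M : Type*} [TopologicalSpace M] [ChartedSpace E M]
    (η : ∀ x : M, TangentSpace 𝓘(ℝ, E) x [⋀^Fin 2]→L[ℝ] ℝ) (x₀ : M) (y : E) :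
    E [⋀^Fin 2]→L[ℝ] ℝ :=
  (η ((extChartAt 𝓘(ℝ, E) x₀).symm y)).compContinuousLinearMap
    (mfderiv 𝓘(ℝ, E) 𝓘(ℝ, E) (extChartAt 𝓘(ℝ, E) x₀).symm y)

/-- A symplectic form: a smooth closed nondegenerate differential 2-form. -/
structure SymplecticForm where
  /-- the alternating bilinear form on each tangent space -/
  form : ∀ x : M, TangentSpace 𝓘(ℝ, E) x [⋀^Fin 2]→L[ℝ] ℝ
  smooth : ∀ x₀ : M, ContDiffOn ℝ ∞ (chartForm form x₀) (extChartAt 𝓘(ℝ, E) x₀).target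
  closed : ∀ x₀ : M, ∀ y ∈ (extChartAt 𝓘(ℝ, E) x₀).target, extDeriv (chartForm form x₀) y = 0
  nondegenerate : ∀ (x : M) (v : TangentSpace 𝓘(ℝ, E) x),
    (∀ w : TangentSpace 𝓘(ℝ, E) x, form x ![v, w] = 0) → v = 0

end Symplectic

variable {E : Type*} [NormedAddCommGroup E] [NormedSpace ℝ E]
  {M : Type*} [TopologicalSpace M] [ChartedSpace E M]

/-! ### Diffeomorphisms and smooth families of bijections

The bijections of `M` form the group `Equiv.Perm M`, whose product is composition. -/

/-- A diffeomorphism: a smooth bijection with smooth inverse. -/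
def IsDiffeo (E : Type*) [NormedAddCommGroup E] [NormedSpace ℝ E]
    {M : Type*} [TopologicalSpace M] [ChartedSpace E M] (φ : Equiv.Perm M) : Prop :=
  ContMDiff 𝓘(ℝ, E) 𝓘(ℝ, E) ∞ (fun x => φ x) ∧ ContMDiff 𝓘(ℝ, E) 𝓘(ℝ, E) ∞ (fun x => φ.symm x)

/-- A family `f p` of bijections of `M` with parameter `p` in a normed space is smooth if
`(p, x) ↦ f p x` is smooth. -/
def SmoothFamily (E : Type*) [NormedAddCommGroup E] [NormedSpace ℝ E]
    {M : Type*} [TopologicalSpace M] [ChartedSpace E M]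
    {P : Type*} [NormedAddCommGroup P] [NormedSpace ℝ P] (f : P → Equiv.Perm M) : Prop :=
  ContMDiff (𝓘(ℝ, P).prod 𝓘(ℝ, E)) 𝓘(ℝ, E) ∞ (fun q : P × M => f q.1 q.2)

/-! ### Hamiltonian diffeomorphisms -/

/-- `IsSgradAt Ω F x ξ`: the tangent vector `ξ` is the symplectic gradient of the function `F`
at `x`, that is `Ω (ξ, ·) = - dF` at `x`. -/
def IsSgradAt (Ω : SymplecticForm E M) (F : M → ℝ) (x : M) (ξ : TangentSpace 𝓘(ℝ, E) x) : Prop :=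
  ∀ v : TangentSpace 𝓘(ℝ, E) x, Ω.form x ![ξ, v] = - mfderiv 𝓘(ℝ, E) 𝓘(ℝ, ℝ) F x v

/-- The velocity at time `t` of the trajectory `s ↦ f s x`. -/
def velocity (E : Type*) [NormedAddCommGroup E] [NormedSpace ℝ E]
    {M : Type*} [TopologicalSpace M] [ChartedSpace E M]
    (f : ℝ → Equiv.Perm M) (t : ℝ) (x : M) : TangentSpace 𝓘(ℝ, E) (f t x) :=
  mfderiv 𝓘(ℝ, ℝ) 𝓘(ℝ, E) (fun s => f s x) t (1 : ℝ)

/-- The smooth time-dependent Hamiltonian `F` generates the path `f`: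
`d/dt (f t x) = sgrad F_t (f t x)`. On a closed connected manifold `F t` is determined by `f` up to
an additive constant depending on `t`. Requiring `F t` to have mean zero would single out one
representative; as adding constants affects neither `sgrad F_t` nor `max F_t - min F_t`, the group
`Ham` and the length below are the same with and without that requirement. -/
def GeneratesPath (Ω : SymplecticForm E M) (F : ℝ → M → ℝ) (f : ℝ → Equiv.Perm M) : Prop :=
  ContMDiff (𝓘(ℝ, ℝ).prod 𝓘(ℝ, E)) 𝓘(ℝ, ℝ) ∞ (fun q : ℝ × M => F q.1 q.2) ∧
    ∀ (t : ℝ) (x : M), IsSgradAt Ω (F t) (f t x) (velocity E f t x)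

/-- `φ` is a Hamiltonian diffeomorphism: the time-one map of the flow of some smooth time-dependent
Hamiltonian. -/
def IsHamDiffeo (Ω : SymplecticForm E M) (φ : Equiv.Perm M) : Prop :=
  ∃ (f : ℝ → Equiv.Perm M) (F : ℝ → M → ℝ), SmoothFamily E f ∧ (∀ t, IsDiffeo E (f t)) ∧
    f 0 = 1 ∧ f 1 = φ ∧ GeneratesPath Ω F f

/-! ### The Hamiltonian diffeomorphisms form a group -/

theorem IsHamDiffeo.isDiffeo {Ω : SymplecticForm E M} {φ : Equiv.Perm M} (h : IsHamDiffeo Ω φ) :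
    IsDiffeo E φ := by
  obtain ⟨f, F, -, hd, -, rfl, -⟩ := h
  exact hd 1

theorem IsDiffeo.one : IsDiffeo E (1 : Equiv.Perm M) := ⟨contMDiff_id, contMDiff_id⟩

theorem IsDiffeo.mul {φ ψ : Equiv.Perm M} (hφ : IsDiffeo E φ) (hψ : IsDiffeo E ψ) :
    IsDiffeo E (φ * ψ) :=
  ⟨hφ.1.comp hψ.1, hψ.2.comp hφ.2⟩

theorem IsDiffeo.inv {φ : Equiv.Perm M} (hφ : IsDiffeo E φ) : IsDiffeo E φ⁻¹ := ⟨hφ.2, hφ.1⟩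

section Families

variable {P : Type*} [NormedAddCommGroup P] [NormedSpace ℝ P]
  {Q : Type*} [NormedAddCommGroup Q] [NormedSpace ℝ Q]

theorem SmoothFamily.const {φ : Equiv.Perm M} (hφ : IsDiffeo E φ) :
    SmoothFamily E (fun _ : P => φ) :=
  hφ.1.comp contMDiff_snd

theorem SmoothFamily.mul {f g : P → Equiv.Perm M} (hf : SmoothFamily E f) (hg : SmoothFamily E g) :
    SmoothFamily E (f * g) :=
  ContMDiff.comp (I' := 𝓘(ℝ, P).prod 𝓘(ℝ, E)) hf (contMDiff_fst.prodMk hg)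

theorem SmoothFamily.reparam {f : P → Equiv.Perm M} (hf : SmoothFamily E f) {b : Q → P}
    (hb : ContDiff ℝ ∞ b) : SmoothFamily E (fun q => f (b q)) :=
  ContMDiff.comp (I' := 𝓘(ℝ, P).prod 𝓘(ℝ, E)) hf
    ((hb.contMDiff.comp contMDiff_fst).prodMk contMDiff_snd)

end Families

theorem GeneratesPath.mul_right {Ω : SymplecticForm E M} {F : ℝ → M → ℝ} {f : ℝ → Equiv.Perm M}
    (h : GeneratesPath Ω F f) (φ : Equiv.Perm M) : GeneratesPath Ω F (fun t => f t * φ) :=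
  ⟨h.1, fun t x => h.2 t (φ x)⟩

theorem GeneratesPath.reparam {Ω : SymplecticForm E M} {F : ℝ → M → ℝ} {f : ℝ → Equiv.Perm M}
    (h : GeneratesPath Ω F f) (hf : SmoothFamily E f) {b : ℝ → ℝ} (hb : ContDiff ℝ ∞ b) :
    GeneratesPath Ω (fun t x => deriv b t * F (b t) x) (fun t => f (b t)) := by
  refine ⟨?_, fun t x v => ?_⟩
  · have hb' : ContDiff ℝ ∞ (deriv b) := ((contDiff_infty_iff_deriv (𝕜 := ℝ)).1 hb).2
    have h1 : ContMDiff (𝓘(ℝ, ℝ).prod 𝓘(ℝ, E)) 𝓘(ℝ, ℝ) ∞ (fun q : ℝ × M => deriv b q.1) :=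
      hb'.contMDiff.comp contMDiff_fst
    have h2 : ContMDiff (𝓘(ℝ, ℝ).prod 𝓘(ℝ, E)) 𝓘(ℝ, ℝ) ∞ (fun q : ℝ × M => F (b q.1) q.2) :=
      ContMDiff.comp (I' := 𝓘(ℝ, ℝ).prod 𝓘(ℝ, E)) h.1
        ((hb.contMDiff.comp contMDiff_fst).prodMk contMDiff_snd)
    exact h1.mul h2
  · have hvel : velocity E (fun t => f (b t)) t x = deriv b t • velocity E f (b t) x := by
      have hfx : MDifferentiableAt 𝓘(ℝ, ℝ) 𝓘(ℝ, E) (fun s => f s x) (b t) :=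
        (ContMDiff.comp (I' := 𝓘(ℝ, ℝ).prod 𝓘(ℝ, E)) hf
          (contMDiff_id.prodMk contMDiff_const)).mdifferentiableAt (by simp)
      have hbt : DifferentiableAt ℝ b t := hb.differentiable (by simp) t
      have hc := mfderiv_comp (I := 𝓘(ℝ, ℝ)) (I' := 𝓘(ℝ, ℝ)) (I'' := 𝓘(ℝ, E)) t hfx
        hbt.mdifferentiableAt
      have h1 : velocity E (fun t => f (b t)) t x =
          (mfderiv 𝓘(ℝ, ℝ) 𝓘(ℝ, E) (fun s => f s x) (b t))
            (mfderiv 𝓘(ℝ, ℝ) 𝓘(ℝ, ℝ) b t (1 : ℝ)) := congrArg (fun L => L (1 : ℝ)) hc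
      rw [h1, mfderiv_eq_fderiv]
      have h2 : fderiv ℝ b t (1 : ℝ) = deriv b t • (1 : ℝ) := by simp
      exact (congrArg _ h2).trans (map_smul (mfderiv 𝓘(ℝ, ℝ) 𝓘(ℝ, E) (fun s => f s x) (b t)) _ _)
    have hF : mfderiv 𝓘(ℝ, E) 𝓘(ℝ, ℝ) (fun x => deriv b t * F (b t) x) (f (b t) x) =
        deriv b t • mfderiv 𝓘(ℝ, E) 𝓘(ℝ, ℝ) (F (b t)) (f (b t) x) := by
      have hFd : MDifferentiableAt 𝓘(ℝ, E) 𝓘(ℝ, ℝ) (F (b t)) (f (b t) x) :=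
        (ContMDiff.comp (I' := 𝓘(ℝ, ℝ).prod 𝓘(ℝ, E)) h.1
          (contMDiff_const.prodMk contMDiff_id)).mdifferentiableAt (by simp)
      exact const_smul_mfderiv hFd (deriv b t)
    have key := h.2 (b t) x v
    rw [hvel]
    have hlin : Ω.form (f (b t) x) ![deriv b t • velocity E f (b t) x, v] =
        deriv b t * Ω.form (f (b t) x) ![velocity E f (b t) x, v] := by
      have hu : ∀ w : TangentSpace 𝓘(ℝ, E) (f (b t) x),
          Function.update ![velocity E f (b t) x, v] 0 w = ![w, v] := by
        intro w
        funext i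
        fin_cases i <;> simp
      have := (Ω.form (f (b t) x)).toMultilinearMap.map_update_smul ![velocity E f (b t) x, v] 0
        (deriv b t) (velocity E f (b t) x)
      rw [hu, hu] at this
      exact this
    refine hlin.trans ?_
    rw [key, hF]
    exact mul_neg _ _

theorem IsSgradAt.congr {Ω : SymplecticForm E M} {F : M → ℝ} {x y : M} {ξ : TangentSpace 𝓘(ℝ, E) x}
    {ζ : TangentSpace 𝓘(ℝ, E) y} (h : IsSgradAt Ω F x ξ) (hxy : x = y)
    (hv : (show E from ξ) = (show E from ζ)) : IsSgradAt Ω F y ζ := by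
  subst hxy
  have : ξ = ζ := hv
  rwa [← this]

theorem velocity_congr {f g : ℝ → Equiv.Perm M} {t : ℝ} (hfg : f =ᶠ[𝓝 t] g) (x : M) :
    (show E from velocity E f t x) = (show E from velocity E g t x) := by
  have hev : (fun s => f s x) =ᶠ[𝓝 t] fun s => g s x := hfg.fun_comp (fun φ => φ x)
  exact congrArg (fun L : ℝ →L[ℝ] E => L (1 : ℝ)) hev.mfderiv_eq

theorem IsHamDiffeo.one (Ω : SymplecticForm E M) : IsHamDiffeo Ω 1 := by
  refine ⟨fun _ => 1, fun _ _ => 0, SmoothFamily.const IsDiffeo.one, fun _ => IsDiffeo.one, rfl, rfl,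
    contMDiff_const, fun t x v => ?_⟩
  have h1 : velocity E (fun _ : ℝ => (1 : Equiv.Perm M)) t x = 0 := by
    have : mfderiv 𝓘(ℝ, ℝ) 𝓘(ℝ, E) (fun _ : ℝ => x) t = 0 := mfderiv_const
    exact congrArg (fun L : ℝ →L[ℝ] E => L (1 : ℝ)) this
  have h2 : mfderiv 𝓘(ℝ, E) 𝓘(ℝ, ℝ) (fun _ : M => (0 : ℝ)) x = 0 := mfderiv_const
  rw [h1]
  refine ((Ω.form x).toMultilinearMap.map_coord_zero (m := ![0, v]) 0 rfl).trans ?_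
  have h3 : mfderiv 𝓘(ℝ, E) 𝓘(ℝ, ℝ) (fun _ : M => (0 : ℝ)) x v = 0 :=
    congrArg (fun L : E →L[ℝ] ℝ => L v) h2
  exact (neg_eq_zero.2 h3).symm

theorem IsHamDiffeo.inv {Ω : SymplecticForm E M} {φ : Equiv.Perm M} (h : IsHamDiffeo Ω φ) :
    IsHamDiffeo Ω φ⁻¹ := by
  obtain ⟨f, F, hf, hd, h0, rfl, hF⟩ := h
  have hb : ContDiff ℝ ∞ (fun t : ℝ => 1 - t) := contDiff_const.sub contDiff_id
  refine ⟨fun t => f (1 - t) * (f 1)⁻¹, _, (hf.reparam hb).mul (.const (hd 1).inv),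
    fun t => (hd _).mul (hd 1).inv, by simp, by simp [h0], (hF.reparam hf hb).mul_right _⟩

theorem IsHamDiffeo.mul {Ω : SymplecticForm E M} {φ ψ : Equiv.Perm M} (hφ : IsHamDiffeo Ω φ)
    (hψ : IsHamDiffeo Ω ψ) : IsHamDiffeo Ω (φ * ψ) := by
  obtain ⟨f, F, hf, hfd, hf0, rfl, hF⟩ := hφ
  obtain ⟨g, G, hg, hgd, hg0, rfl, hG⟩ := hψ
  -- first run `g` during `[0, 1/3]`, then `f` during `[2/3, 1]`
  set b : ℝ → ℝ := fun t => Real.smoothTransition (3 * t) with hb_def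
  set c : ℝ → ℝ := fun t => Real.smoothTransition (3 * t - 2) with hc_def
  have hb : ContDiff ℝ ∞ b := Real.smoothTransition.contDiff.comp (contDiff_const.mul contDiff_id)
  have hc : ContDiff ℝ ∞ c := Real.smoothTransition.contDiff.comp
    ((contDiff_const.mul contDiff_id).sub contDiff_const)
  have hb1 : ∀ t : ℝ, 1 / 3 < t → b =ᶠ[𝓝 t] fun _ => 1 := fun t ht => by
    filter_upwards [lt_mem_nhds ht] with s hs
    exact Real.smoothTransition.one_of_one_le (by linarith)
  have hc0 : ∀ t : ℝ, t < 2 / 3 → c =ᶠ[𝓝 t] fun _ => 0 := fun t ht => by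
    filter_upwards [gt_mem_nhds ht] with s hs
    exact Real.smoothTransition.zero_of_nonpos (by linarith)
  have hG' := hG.reparam hg hb
  have hF' := (hF.reparam hf hc).mul_right (g 1)
  refine ⟨fun t => f (c t) * g (b t), fun t x => deriv c t * F (c t) x + deriv b t * G (b t) x,
    (hf.reparam hc).mul (hg.reparam hb), fun t => (hfd _).mul (hgd _), ?_, ?_,
    hF'.1.add hG'.1, fun t x => ?_⟩
  · simp [hb_def, hc_def, hf0, hg0, Real.smoothTransition.zero_of_nonpos]
  · have h1 : b 1 = 1 := (hb1 1 (by norm_num)).self_of_nhds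
    have h2 : c 1 = 1 := by
      simp only [hc_def]
      exact Real.smoothTransition.one_of_one_le (by norm_num)
    simp [h1, h2]
  · rcases lt_or_ge t (2 / 3) with ht | ht
    · have hev : (fun t => g (b t)) =ᶠ[𝓝 t] fun t => f (c t) * g (b t) := by
        filter_upwards [hc0 t ht] with s hs
        simp [hs, hf0]
      have hd : deriv c t = 0 := by rw [(hc0 t ht).deriv_eq]; simp
      have := (hG'.2 t x).congr (congrArg (fun φ : Equiv.Perm M => φ x) hev.self_of_nhds)
        (velocity_congr hev x)
      simpa [hd] using this
    · have ht' : 1 / 3 < t := by linarith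
      have hev : (fun t => f (c t) * g 1) =ᶠ[𝓝 t] fun t => f (c t) * g (b t) := by
        filter_upwards [hb1 t ht'] with s hs
        simp [hs]
      have hd : deriv b t = 0 := by rw [(hb1 t ht').deriv_eq]; simp
      have := (hF'.2 t x).congr (congrArg (fun φ : Equiv.Perm M => φ x) hev.self_of_nhds)
        (velocity_congr hev x)
      simpa [hd] using this

/-- The group `Ham (M, Ω)` of Hamiltonian diffeomorphisms. -/
def Ham (Ω : SymplecticForm E M) : Subgroup (Equiv.Perm M) where
  carrier := {φ | IsHamDiffeo Ω φ}
  mul_mem' := IsHamDiffeo.mul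
  one_mem' := IsHamDiffeo.one Ω
  inv_mem' := IsHamDiffeo.inv

/-! ### The inverse of a smooth family is smooth -/

/-- A smooth family of diffeomorphisms has a smooth family of inverses
(inverse function theorem). -/
theorem SmoothFamily.inv [CompleteSpace E] [IsManifold 𝓘(ℝ, E) ∞ M]
    {P : Type*} [NormedAddCommGroup P] [NormedSpace ℝ P] [CompleteSpace P]
    {f : P → Equiv.Perm M} (hf : SmoothFamily E f) (hd : ∀ p, IsDiffeo E (f p)) :
    SmoothFamily E f⁻¹ := by
  rintro ⟨p₀, y₀⟩
  -- normalise the family to be the identity at `p₀`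
  set g : P → Equiv.Perm M := fun p => (f p₀)⁻¹ * f p with hg_def
  have hg : SmoothFamily E g := (SmoothFamily.const (hd p₀).inv).mul hf
  have hg0 : g p₀ = 1 := by simp [hg_def]
  set x₀ : M := (f p₀)⁻¹ y₀ with hx₀
  suffices hs : ContMDiffAt (𝓘(ℝ, P).prod 𝓘(ℝ, E)) 𝓘(ℝ, E) ∞
      (fun q : P × M => (g q.1)⁻¹ q.2) (p₀, x₀) by
    have h1 : ContMDiff (𝓘(ℝ, P).prod 𝓘(ℝ, E)) (𝓘(ℝ, P).prod 𝓘(ℝ, E)) ∞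
        (fun q : P × M => (q.1, (f p₀)⁻¹ q.2)) :=
      contMDiff_fst.prodMk ((hd p₀).inv.1.comp contMDiff_snd)
    have h2 := ContMDiffAt.comp (I' := 𝓘(ℝ, P).prod 𝓘(ℝ, E)) (p₀, y₀) hs h1.contMDiffAt
    convert h2 using 1
    funext q
    simp [hg_def]
  set c := extChartAt 𝓘(ℝ, E) x₀ with hc
  have hx₀s : x₀ ∈ c.source := mem_extChartAt_source x₀
  have htn : c.target ∈ 𝓝 (c x₀) := extChartAt_target_mem_nhds x₀
  have hc1 : ContMDiffAt 𝓘(ℝ, E) 𝓘(ℝ, E) ∞ c x₀ := contMDiffAt_extChartAt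
  have hc2 : ContMDiffAt 𝓘(ℝ, E) 𝓘(ℝ, E) ∞ c.symm (c x₀) :=
    (contMDiffOn_extChartAt_symm x₀).contMDiffAt htn
  have hcx : c.symm (c x₀) = x₀ := c.left_inv hx₀s
  set u : P × E → M := fun q => g q.1 (c.symm q.2) with hu_def
  have hux : u (p₀, c x₀) = x₀ := by simp [hu_def, hg0, hcx]
  have hu : ContMDiffAt 𝓘(ℝ, P × E) 𝓘(ℝ, E) ∞ u (p₀, c x₀) := by
    have h1 : ContMDiffAt 𝓘(ℝ, P × E) 𝓘(ℝ, P) ∞ (Prod.fst : P × E → P) (p₀, c x₀) :=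
      contDiff_fst.contMDiff.contMDiffAt
    have h2 : ContMDiffAt 𝓘(ℝ, P × E) 𝓘(ℝ, E) ∞ (Prod.snd : P × E → E) (p₀, c x₀) :=
      contDiff_snd.contMDiff.contMDiffAt
    have h3 : ContMDiffAt 𝓘(ℝ, P × E) 𝓘(ℝ, E) ∞ (fun q : P × E => c.symm q.2) (p₀, c x₀) :=
      ContMDiffAt.comp (I' := 𝓘(ℝ, E)) (p₀, c x₀) hc2 h2
    exact ContMDiffAt.comp (I' := 𝓘(ℝ, P).prod 𝓘(ℝ, E)) (g := fun q : P × M => g q.1 q.2)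
      (f := fun q : P × E => (q.1, c.symm q.2)) (p₀, c x₀) hg.contMDiffAt (h1.prodMk h3)
  set G₂ : P × E → E := fun q => c (u q) with hG₂
  have hG₂s : ContDiffAt ℝ ∞ G₂ (p₀, c x₀) := by
    apply ContMDiffAt.contDiffAt
    refine ContMDiffAt.comp (I' := 𝓘(ℝ, E)) (p₀, c x₀) ?_ hu
    rw [hux]
    exact hc1
  set G : P × E → P × E := fun q => (q.1, G₂ q) with hG
  have hGs : ContDiffAt ℝ ∞ G (p₀, c x₀) := contDiffAt_fst.prodMk hG₂s
  have hGx : G (p₀, c x₀) = (p₀, c x₀) := by simp [hG, hG₂, hux]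
  set A : P × E →L[ℝ] E := fderiv ℝ G₂ (p₀, c x₀) with hA
  have hG₂d : HasFDerivAt G₂ A (p₀, c x₀) := (hG₂s.differentiableAt (by simp)).hasFDerivAt
  have hAr : ∀ w : E, A (0, w) = w := by
    have h1 : HasFDerivAt (fun v : E => G₂ (p₀, v)) (A.comp (ContinuousLinearMap.inr ℝ P E))
        (c x₀) := hG₂d.comp (c x₀) (hasFDerivAt_prodMk_right p₀ (c x₀))
    have h2 : (fun v : E => G₂ (p₀, v)) =ᶠ[𝓝 (c x₀)] id := by
      filter_upwards [htn] with v hv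
      simp [hG₂, hu_def, hg0, c.right_inv hv]
    have h3 := (h1.congr_of_eventuallyEq h2.symm).unique (hasFDerivAt_id (c x₀))
    intro w
    have := congrArg (fun L : E →L[ℝ] E => L w) h3
    simpa using this
  have hAdd : ∀ (a : P) (w : E), A (a, w) = A (a, 0) + w := fun a w => by
    conv_rhs => rw [← hAr w]
    rw [← map_add]
    simp
  let e : (P × E) ≃L[ℝ] (P × E) := ContinuousLinearEquiv.equivOfInverse
    ((ContinuousLinearMap.fst ℝ P E).prod A)
    ((ContinuousLinearMap.fst ℝ P E).prod (ContinuousLinearMap.snd ℝ P E -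
      A.comp ((ContinuousLinearMap.inl ℝ P E).comp (ContinuousLinearMap.fst ℝ P E))))
    (fun q => by
      rcases q with ⟨a, w⟩
      simp [hAdd a w])
    (fun q => by
      rcases q with ⟨a, w⟩
      simp [hAdd a (w - A (a, 0))])
  have hGd : HasFDerivAt G (e : P × E →L[ℝ] P × E) (p₀, c x₀) := hasFDerivAt_fst.prodMk hG₂d
  set L := hGs.localInverse hGd (by simp) with hL
  have hLs : ContDiffAt ℝ ∞ L (p₀, c x₀) := by
    have := hGs.to_localInverse hGd (by simp)
    rwa [hGx] at this
  have hLx : L (p₀, c x₀) = (p₀, c x₀) := by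
    have := hGs.localInverse_apply_image hGd (by simp)
    rwa [hGx] at this
  have hLr : ∀ᶠ q in 𝓝 (p₀, c x₀), G (L q) = q := by
    have := (hGs.hasStrictFDerivAt' hGd (by simp)).eventually_right_inverse
    rwa [hGx] at this
  -- the candidate for the inverse family
  have hV : ContMDiffAt (𝓘(ℝ, P).prod 𝓘(ℝ, E)) 𝓘(ℝ, P × E) ∞
      (fun q : P × M => (q.1, c q.2)) (p₀, x₀) := by
    have h2 : ContMDiffAt (𝓘(ℝ, P).prod 𝓘(ℝ, E)) 𝓘(ℝ, E) ∞ (fun q : P × M => c q.2) (p₀, x₀) :=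
      ContMDiffAt.comp (I' := 𝓘(ℝ, E)) (p₀, x₀) hc1 contMDiffAt_snd
    exact contMDiffAt_fst.prodMk_space h2
  have hLV : ContMDiffAt (𝓘(ℝ, P).prod 𝓘(ℝ, E)) 𝓘(ℝ, P × E) ∞
      (fun q : P × M => L (q.1, c q.2)) (p₀, x₀) :=
    ContMDiffAt.comp (I' := 𝓘(ℝ, P × E)) (p₀, x₀) hLs.contMDiffAt hV
  have hcand : ContMDiffAt (𝓘(ℝ, P).prod 𝓘(ℝ, E)) 𝓘(ℝ, E) ∞
      (fun q : P × M => c.symm (L (q.1, c q.2)).2) (p₀, x₀) := by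
    have h1 : ContMDiffAt (𝓘(ℝ, P).prod 𝓘(ℝ, E)) 𝓘(ℝ, E) ∞
        (fun q : P × M => (L (q.1, c q.2)).2) (p₀, x₀) :=
      ContMDiffAt.comp (I' := 𝓘(ℝ, P × E)) (p₀, x₀) contDiff_snd.contMDiff.contMDiffAt hLV
    refine ContMDiffAt.comp (I' := 𝓘(ℝ, E)) (p₀, x₀) ?_ h1
    simpa [hLx] using hc2
  refine hcand.congr_of_eventuallyEq ?_
  have hsrc : ∀ᶠ q : P × M in 𝓝 (p₀, x₀), q.2 ∈ c.source :=
    continuousAt_snd.eventually (extChartAt_source_mem_nhds x₀)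
  have hLr' : ∀ᶠ q : P × M in 𝓝 (p₀, x₀), G (L (q.1, c q.2)) = (q.1, c q.2) :=
    hV.continuousAt.eventually hLr
  have husrc : ∀ᶠ q : P × M in 𝓝 (p₀, x₀), u (L (q.1, c q.2)) ∈ c.source := by
    have h1 : ∀ᶠ r in 𝓝 (L (p₀, c x₀)), u r ∈ c.source := by
      rw [hLx]
      apply hu.continuousAt.eventually
      rw [hux]
      exact extChartAt_source_mem_nhds x₀
    exact hLV.continuousAt.eventually h1
  filter_upwards [hsrc, hLr', husrc] with q h1 h2 h3
  have h4 : (L (q.1, c q.2)).1 = q.1 := congrArg Prod.fst h2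
  have h5 : c (u (L (q.1, c q.2))) = c q.2 := congrArg Prod.snd h2
  have h6 : u (L (q.1, c q.2)) = q.2 := c.injOn h3 h1 h5
  rw [Equiv.Perm.inv_eq_iff_eq]
  refine h6.symm.trans ?_
  simp only [hu_def, h4]

/-! ### Smooth loops of Hamiltonian diffeomorphisms

Here `S¹ = ℝ / ℤ`, and a loop is given by a `1`-periodic map on `ℝ`. -/

section Loops

variable [CompleteSpace E] [IsManifold 𝓘(ℝ, E) ∞ M]

/-- The group (under pointwise composition) of smooth free loops in `Ham (M, Ω)`: smooth
`1`-periodic paths of diffeomorphisms with values in `Ham (M, Ω)`. -/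
def HamLoop (Ω : SymplecticForm E M) : Subgroup (ℝ → Equiv.Perm M) where
  carrier := {h | SmoothFamily E h ∧ Function.Periodic h 1 ∧ ∀ t, h t ∈ Ham Ω}
  mul_mem' := fun ha hb => ⟨ha.1.mul hb.1, ha.2.1.mul hb.2.1,
    fun t => (Ham Ω).mul_mem (ha.2.2 t) (hb.2.2 t)⟩
  one_mem' := ⟨SmoothFamily.const IsDiffeo.one, fun _ => rfl, fun _ => (Ham Ω).one_mem⟩
  inv_mem' := fun ha => ⟨ha.1.inv fun t => (ha.2.2 t).isDiffeo,
    fun t => congrArg (·⁻¹) (ha.2.1 t), fun t => (Ham Ω).inv_mem (ha.2.2 t)⟩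

/-- The group of smooth loops in `Ham (M, Ω)` based at the identity. -/
def BasedHamLoop (Ω : SymplecticForm E M) : Subgroup (ℝ → Equiv.Perm M) where
  carrier := {h | h ∈ HamLoop Ω ∧ h 0 = 1}
  mul_mem' := fun ha hb => ⟨mul_mem ha.1 hb.1, by simp [ha.2, hb.2]⟩
  one_mem' := ⟨one_mem _, rfl⟩
  inv_mem' := fun ha => ⟨inv_mem ha.1, by simp [ha.2]⟩

/-- `K` is a smooth homotopy `K (s, ·)`, from `s = 0` to `s = 1`, through free loops in
`Ham (M, Ω)`. (A smooth homotopy with parameter `s ∈ [0, 1]` can be made defined for all `s ∈ ℝ`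
by reparametrizing `s` with a smooth step function.) -/
structure IsLoopHomotopy (Ω : SymplecticForm E M) (K : ℝ × ℝ → Equiv.Perm M)
    (g₀ g₁ : ℝ → Equiv.Perm M) : Prop where
  smooth : SmoothFamily E K
  mem_ham : ∀ p, K p ∈ Ham Ω
  periodic : ∀ s t, K (s, t + 1) = K (s, t)
  left : ∀ t, K (0, t) = g₀ t
  right : ∀ t, K (1, t) = g₁ t

/-- Smooth homotopy of free loops in `Ham (M, Ω)`. -/
def FreelyHomotopic (Ω : SymplecticForm E M) (g₀ g₁ : ℝ → Equiv.Perm M) : Prop :=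
  ∃ K, IsLoopHomotopy Ω K g₀ g₁

/-- Smooth homotopy of based loops in `Ham (M, Ω)`, through loops based at the identity. -/
def BasedHomotopic (Ω : SymplecticForm E M) (g₀ g₁ : ℝ → Equiv.Perm M) : Prop :=
  ∃ K, IsLoopHomotopy Ω K g₀ g₁ ∧ ∀ s, K (s, 0) = 1

/-- Smooth based homotopy is a congruence on the group of based loops. -/
def basedHomotopyCon (Ω : SymplecticForm E M) : Con (BasedHamLoop Ω) where
  r g₀ g₁ := BasedHomotopic Ω g₀ g₁
  iseqv := by
    refine ⟨fun g => ?_, fun {g₀ g₁} h => ?_, fun {g₀ g₁ g₂} h h' => ?_⟩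
    · exact ⟨fun p => g.1 p.2, ⟨g.2.1.1.reparam contDiff_snd, fun p => g.2.1.2.2 p.2,
        fun s t => g.2.1.2.1 t, fun _ => rfl, fun _ => rfl⟩, fun _ => g.2.2⟩
    · obtain ⟨K, hK, hb⟩ := h
      refine ⟨fun p => K (1 - p.1, p.2), ⟨hK.smooth.reparam
        ((contDiff_const.sub contDiff_fst).prodMk contDiff_snd), fun p => hK.mem_ham _,
        fun s t => hK.periodic _ t, fun t => ?_, fun t => ?_⟩, fun s => hb _⟩
      · simpa using hK.right t
      · simpa using hK.left t
    · obtain ⟨K, hK, hb⟩ := h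
      obtain ⟨K', hK', hb'⟩ := h'
      have hi : SmoothFamily E (fun p : ℝ × ℝ => (g₁.1 p.2)⁻¹) :=
        (g₁⁻¹).2.1.1.reparam contDiff_snd
      refine ⟨K * (fun p => (g₁.1 p.2)⁻¹) * K', ⟨(hK.smooth.mul hi).mul hK'.smooth,
        fun p => mul_mem (mul_mem (hK.mem_ham p) (inv_mem (g₁.2.1.2.2 p.2))) (hK'.mem_ham p),
        fun s t => ?_, fun t => ?_, fun t => ?_⟩, fun s => ?_⟩
      · simp [hK.periodic, hK'.periodic, g₁.2.1.2.1 t]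
      · simp [hK.left, hK'.left]
      · simp [hK.right, hK'.right]
      · simp [hb, hb', g₁.2.2]
  mul' := by
    rintro a b c d ⟨K, hK, hb⟩ ⟨K', hK', hb'⟩
    refine ⟨K * K', ⟨hK.smooth.mul hK'.smooth, fun p => mul_mem (hK.mem_ham p) (hK'.mem_ham p),
      fun s t => ?_, fun t => ?_, fun t => ?_⟩, fun s => ?_⟩
    · simp [hK.periodic, hK'.periodic]
    · simp [hK.left, hK'.left]
    · simp [hK.right, hK'.right]
    · simp [hb, hb']

/-- The fundamental group `π₁ (Ham (M, Ω))`: smooth loops based at the identity up to smooth based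
homotopy. The group operation is induced by the pointwise composition of loops, which in the
fundamental group of a group coincides with concatenation. The group is abelian; it is written
multiplicatively here, so `γ ^ k` is the class `k γ`. -/
abbrev PiOneHam (Ω : SymplecticForm E M) : Type _ := (basedHomotopyCon Ω).Quotient

/-- The class in `π₁ (Ham (M, Ω))` of a based loop. -/
def PiOneHam.mk {Ω : SymplecticForm E M} (g : BasedHamLoop Ω) : PiOneHam Ω :=
  (g : (basedHomotopyCon Ω).Quotient)

/-- The free loop `h` represents the class `γ`: it is freely homotopic to a based loop
of class `γ`. -/
def Represents {Ω : SymplecticForm E M} (h : HamLoop Ω) (γ : PiOneHam Ω) : Prop :=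
  ∃ g : BasedHamLoop Ω, PiOneHam.mk g = γ ∧ FreelyHomotopic Ω h g

/-! ### Hofer length and Hofer norm -/

/-- The Hofer length `∫₀¹ (max F_t - min F_t) dt` of the path generated by the Hamiltonian `F`
on a closed manifold. -/
def hoferLength (F : ℝ → M → ℝ) : ℝ :=
  ∫ t in (0 : ℝ)..1, ((⨆ x, F t x) - ⨅ x, F t x)

/-- The Hofer norm `ν (γ)`: the infimum of the lengths of the loops representing `γ`. -/
def hoferNorm {Ω : SymplecticForm E M} (γ : PiOneHam Ω) : ℝ :=
  sInf {l : ℝ | ∃ (g : BasedHamLoop Ω) (F : ℝ → M → ℝ),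
    PiOneHam.mk g = γ ∧ GeneratesPath Ω F g ∧ l = hoferLength F}

/-! ### Strict ergodicity -/

/-- A self-map `T` of a topological space is strictly ergodic if it has exactly one invariant Borel
probability measure, and this measure is positive on nonempty open sets. -/
def StrictlyErgodic {X : Type*} [TopologicalSpace X] (T : X → X) : Prop :=
  letI : MeasurableSpace X := borel X
  ∃ m : Measure X, (IsProbabilityMeasure m ∧ MeasurePreserving T m m) ∧
    (∀ U : Set X, IsOpen U → U.Nonempty → 0 < m U) ∧
    ∀ m' : Measure X, IsProbabilityMeasure m' → MeasurePreserving T m' m' → m' = m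

/-- The skew product `T (y, t) = (h(t) y, t + α)` on `M × S¹`. -/
def skewProduct {Ω : SymplecticForm E M} (h : HamLoop Ω) (α : ℝ) :
    M × UnitAddCircle → M × UnitAddCircle :=
  fun q => (h.2.2.1.lift q.2 q.1, q.2 + (α : UnitAddCircle))

/-- A loop is strictly ergodic if its skew product with some irrational rotation of the circle is
strictly ergodic. -/
def IsStrictlyErgodicLoop {Ω : SymplecticForm E M} (h : HamLoop Ω) : Prop :=
  ∃ α : ℝ, Irrational α ∧ StrictlyErgodic (skewProduct h α)

end Loops

end

/-! Let `h` be a strictly ergodic loop with rotation number `α`, and put `f_k(t) = h(t + (k-1)α) ⋯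
h(t + α) h(t)` (`rotatedProd`). Shrinking the rotations to zero while deforming `h` to a based loop
`g` of class `γ` turns `f_k` into `g ^ k`; hence `f_k`, right-multiplied by the constant `f_k(0)⁻¹`,
represents `γ ^ k` (`mk_basedRotatedProd`).

The length of this loop is controlled by a Birkhoff sum. For a path `f`, consider the 1-form `Ω(d/dt
f_t, Df_t ·)` at the source point, here called the flux form. If `F` generates `f`, this form is
`d(-F_t ∘ f_t)`, so its potentials encode Hamiltonians. When the `f_t` are symplectic, the flux form
of `f * g` is `g*` of the flux form of `f`, plus that of `g`. Consequently, if `B` is a potential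
for `h`, then the sum of `B(t + jα, f_j(t) x)` over `j < k` is one for `f_k`
(`isFluxPotential_rotatedProd`). This is the Birkhoff sum of `B`, seen as a function on `M × S¹`,
along the skew product. Unique ergodicity makes the Birkhoff averages uniformly close to a constant
(`StrictlyErgodic.exists_eventually_birkhoffAverage`), so the Hamiltonian of `f_k` has oscillation
`o(k)`. As the Hofer norm is nonnegative, dividing by `k` gives the limit zero.

The remaining point is that `h` has a Hamiltonian at all: a loop is only assumed smooth in `(t, x)`
with each `h t` in `Ham`, so the exactness of its flux forms has to be proved
(`exists_isPotential_fluxModel`). For every `t` choose a Hamiltonian path `f^t` from the identity to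
`h t`. These are uncountably many points of a second countable mapping space, so in any time
interval there are `a ≠ b` with `f^a` and `f^b` uniformly close. The loop `(f^a_s)⁻¹ f^b_s h(b)⁻¹
h(b + s(a - b))` is then `C⁰`-close to the identity. The total flux of such a loop is exact, because
integrating local primitives of `Ω` along the short closed trajectories gives a potential up to sign
(`exists_nhds_diagonal_flux_exact`). The Hamiltonian factors contribute exact terms, which leaves
the average of the flux form of `h` between `b` and `a` exact (`exists_isPotential_average`).
Shrinking the interval to a point finishes the argument, since limits of exact forms, locally
uniform in charts, are exact (`IsPotential.exists_of_tendsto`). Normalising the potentials at a base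
point makes them smooth and periodic in time (`exists_isFluxPotential`). -/

noncomputable section

/-! ### Pullback of the symplectic form to a vector space -/

/-- An alternating form of degree two as a bilinear map. -/
def altToBilin (P : Type*) [NormedAddCommGroup P] [NormedSpace ℝ P] :
    (P [⋀^Fin 2]→L[ℝ] ℝ) →L[ℝ] P →L[ℝ] P →L[ℝ] ℝ :=
  (ContinuousLinearMap.compL ℝ P (P [⋀^Fin 1]→L[ℝ] ℝ) (P →L[ℝ] ℝ)
    ((ContinuousLinearMap.compL ℝ P (P [⋀^Fin 0]→L[ℝ] ℝ) ℝ
      (ContinuousAlternatingMap.apply ℝ P ℝ ![])).comp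
        (ContinuousAlternatingMap.curryLeftLI (n := 0)).toContinuousLinearMap)).comp
    (ContinuousAlternatingMap.curryLeftLI (n := 1)).toContinuousLinearMap

theorem altToBilin_apply {P : Type*} [NormedAddCommGroup P] [NormedSpace ℝ P]
    (η : P [⋀^Fin 2]→L[ℝ] ℝ) (v w : P) : altToBilin P η v w = η ![v, w] := by
  simp [altToBilin]

theorem hasFDerivAt_altToBilin {P : Type*} [NormedAddCommGroup P] [NormedSpace ℝ P]
    (η : P [⋀^Fin 2]→L[ℝ] ℝ) : HasFDerivAt (fun η => altToBilin P η) (altToBilin P) η := by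
  fun_prop

theorem contDiff_altToBilin {P : Type*} [NormedAddCommGroup P] [NormedSpace ℝ P] :
    ContDiff ℝ ∞ (fun η => altToBilin P η) := by
  fun_prop

theorem contDiff_flip {P Q : Type*} [NormedAddCommGroup P] [NormedSpace ℝ P]
    [NormedAddCommGroup Q] [NormedSpace ℝ Q] :
    ContDiff ℝ ∞ (fun A : P →L[ℝ] Q →L[ℝ] ℝ => A.flip) := by
  have h : IsBoundedLinearMap ℝ (fun A : P →L[ℝ] Q →L[ℝ] ℝ => A.flip) :=
    { map_add := fun A B => rfl
      map_smul := fun c A => rfl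
      bound := ⟨1, one_pos, fun A => by simp⟩ }
  exact h.contDiff

section Pullback

variable {E : Type*} [NormedAddCommGroup E] [NormedSpace ℝ E]
  {M : Type*} [TopologicalSpace M] [ChartedSpace E M]
  {P : Type*} [NormedAddCommGroup P] [NormedSpace ℝ P]
  {Q : Type*} [NormedAddCommGroup Q] [NormedSpace ℝ Q]

namespace SymplecticForm

/-- The pullback of a symplectic form by a map from a vector space, as an alternating form. -/
def pullForm (Ω : SymplecticForm E M) (u : P → M) (p : P) : P [⋀^Fin 2]→L[ℝ] ℝ :=
  (Ω.form (u p)).compContinuousLinearMap (mfderiv 𝓘(ℝ, P) 𝓘(ℝ, E) u p)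

/-- The pullback of a symplectic form by a map from a vector space, as a bilinear map. -/
def pull (Ω : SymplecticForm E M) (u : P → M) (p : P) : P →L[ℝ] P →L[ℝ] ℝ :=
  altToBilin P (Ω.pullForm u p)

/-- The symplectic form as a bilinear map. -/
def bilin (Ω : SymplecticForm E M) (x : M) :
    TangentSpace 𝓘(ℝ, E) x →L[ℝ] TangentSpace 𝓘(ℝ, E) x →L[ℝ] ℝ :=
  altToBilin E (Ω.form x)

variable (Ω : SymplecticForm E M)

theorem bilin_apply (x : M) (v w : TangentSpace 𝓘(ℝ, E) x) :
    Ω.bilin x v w = Ω.form x ![v, w] :=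
  altToBilin_apply (P := E) _ _ _

theorem pull_apply (u : P → M) (p v w : P) :
    Ω.pull u p v w = Ω.bilin (u p) (mfderiv 𝓘(ℝ, P) 𝓘(ℝ, E) u p v)
      (mfderiv 𝓘(ℝ, P) 𝓘(ℝ, E) u p w) := by
  rw [bilin_apply]
  refine (altToBilin_apply _ _ _).trans ?_
  refine congrArg (Ω.form (u p)) ?_
  funext i
  fin_cases i <;> rfl

theorem altToBilin_neg (η : P [⋀^Fin 2]→L[ℝ] ℝ) (v w : P) :
    altToBilin P η v w = - altToBilin P η w v := by
  rw [altToBilin_apply, altToBilin_apply]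
  have := η.toAlternatingMap.map_swap ![v, w] (i := 0) (j := 1) (by decide)
  have h2 : (![v, w] ∘ Equiv.swap (0 : Fin 2) 1) = ![w, v] := by
    funext i
    fin_cases i <;> simp
  rw [h2] at this
  have h3 : η ![w, v] = - η ![v, w] := this
  rw [h3, neg_neg]

theorem pull_neg (u : P → M) (p v w : P) : Ω.pull u p v w = - Ω.pull u p w v :=
  altToBilin_neg _ _ _

/-- Functoriality of the pullback, which is the chain rule. -/
theorem pullForm_comp {u : P → M} {g : Q → P} {q : Q}
    (hu : MDifferentiableAt 𝓘(ℝ, P) 𝓘(ℝ, E) u (g q)) (hg : DifferentiableAt ℝ g q) :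
    Ω.pullForm (fun r => u (g r)) q = (Ω.pullForm u (g q)).compContinuousLinearMap (fderiv ℝ g q) := by
  have h := mfderiv_comp (I := 𝓘(ℝ, Q)) (I' := 𝓘(ℝ, P)) (I'' := 𝓘(ℝ, E)) q hu hg.mdifferentiableAt
  rw [mfderiv_eq_fderiv] at h
  ext v
  refine congrArg (Ω.form (u (g q))) ?_
  funext i
  exact congrArg (fun L : Q →L[ℝ] E => L (v i)) h

theorem pullForm_congr {u u' : P → M} {p : P} (h : u =ᶠ[𝓝 p] u') :
    Ω.pullForm u p = Ω.pullForm u' p := by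
  have h1 : u p = u' p := h.self_of_nhds
  have h2 : (mfderiv 𝓘(ℝ, P) 𝓘(ℝ, E) u p : P →L[ℝ] E) = mfderiv 𝓘(ℝ, P) 𝓘(ℝ, E) u' p :=
    h.mfderiv_eq
  -- The fibres over `u p` and `u' p` are different types; with free points and free maps into the
  -- model space the equalities can be substituted.
  have key : ∀ (x y : M) (A B : P →L[ℝ] E), x = y → A = B →
      (show E [⋀^Fin 2]→L[ℝ] ℝ from Ω.form x).compContinuousLinearMap A =
        (show E [⋀^Fin 2]→L[ℝ] ℝ from Ω.form y).compContinuousLinearMap B := by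
    rintro x y A B rfl rfl
    rfl
  exact key _ _ _ _ h1 h2

variable [IsManifold 𝓘(ℝ, E) ∞ M]

/-- Near `p` the map `u` factors through the chart at `x₀` and its inverse. This reduces smoothness
and closedness of a pullback to the two corresponding fields of `SymplecticForm`. -/
theorem pullForm_eq_chart {u : P → M} {O : Set P} (hO : IsOpen O)
    (hu : ContMDiffOn 𝓘(ℝ, P) 𝓘(ℝ, E) ∞ u O) (x₀ : M) {p : P} (hp : p ∈ O)
    (hx : u p ∈ (extChartAt 𝓘(ℝ, E) x₀).source) :
    Ω.pullForm u p = (chartForm Ω.form x₀ (extChartAt 𝓘(ℝ, E) x₀ (u p))).compContinuousLinearMap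
      (fderiv ℝ (fun q => extChartAt 𝓘(ℝ, E) x₀ (u q)) p) := by
  set c := extChartAt 𝓘(ℝ, E) x₀
  have hc : ContMDiffAt 𝓘(ℝ, E) 𝓘(ℝ, E) ∞ c (u p) := by
    have h1 := contMDiffOn_extChartAt (I := 𝓘(ℝ, E)) (x := x₀) (n := ∞)
    refine (h1 (u p) (by simpa [c] using hx)).contMDiffAt ?_
    exact (chartAt E x₀).open_source.mem_nhds (by simpa [c] using hx)
  have hup : ContMDiffAt 𝓘(ℝ, P) 𝓘(ℝ, E) ∞ u p := (hu p hp).contMDiffAt (hO.mem_nhds hp)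
  have hcu : ContMDiffAt 𝓘(ℝ, P) 𝓘(ℝ, E) ∞ (fun q => c (u q)) p :=
    ContMDiffAt.comp (I' := 𝓘(ℝ, E)) p hc hup
  have hev : (fun q => c.symm (c (u q))) =ᶠ[𝓝 p] u := by
    have : c.source ∈ 𝓝 (u p) := extChartAt_source_mem_nhds' hx
    filter_upwards [hup.continuousAt.eventually this] with q hq
    exact c.left_inv hq
  have hs : MDifferentiableAt 𝓘(ℝ, E) 𝓘(ℝ, E) c.symm (c (u p)) :=
    ((contMDiffOn_extChartAt_symm x₀).contMDiffAt
      ((isOpen_extChartAt_target x₀).mem_nhds (c.map_source hx))).mdifferentiableAt (n := ∞) (by simp)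
  exact (pullForm_congr Ω hev).symm.trans
    (pullForm_comp Ω hs (hcu.contDiffAt.differentiableAt (by simp)))

theorem contDiffAt_coord {u : P → M} {O : Set P} (hO : IsOpen O)
    (hu : ContMDiffOn 𝓘(ℝ, P) 𝓘(ℝ, E) ∞ u O) (x₀ : M) {p : P} (hp : p ∈ O)
    (hx : u p ∈ (extChartAt 𝓘(ℝ, E) x₀).source) :
    ContDiffAt ℝ ∞ (fun q => extChartAt 𝓘(ℝ, E) x₀ (u q)) p := by
  have hc : ContMDiffAt 𝓘(ℝ, E) 𝓘(ℝ, E) ∞ (extChartAt 𝓘(ℝ, E) x₀) (u p) :=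
    ((contMDiffOn_extChartAt (I := 𝓘(ℝ, E)) (x := x₀) (n := ∞)) (u p)
      (by simpa using hx)).contMDiffAt ((chartAt E x₀).open_source.mem_nhds (by simpa using hx))
  exact (ContMDiffAt.comp (I' := 𝓘(ℝ, E)) p hc ((hu p hp).contMDiffAt (hO.mem_nhds hp))).contDiffAt

theorem pullForm_eventuallyEq_chart {u : P → M} {O : Set P} (hO : IsOpen O)
    (hu : ContMDiffOn 𝓘(ℝ, P) 𝓘(ℝ, E) ∞ u O) {p : P} (hp : p ∈ O) :
    Ω.pullForm u =ᶠ[𝓝 p] fun q =>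
      (chartForm Ω.form (u p) (extChartAt 𝓘(ℝ, E) (u p) (u q))).compContinuousLinearMap
      (fderiv ℝ (fun q => extChartAt 𝓘(ℝ, E) (u p) (u q)) q) := by
  filter_upwards [hO.mem_nhds hp, ((hu p hp).contMDiffAt (hO.mem_nhds hp)).continuousAt.eventually
    (extChartAt_source_mem_nhds (I := 𝓘(ℝ, E)) (u p))] with q h1 h2
  exact pullForm_eq_chart Ω hO hu (u p) h1 h2

omit [IsManifold 𝓘(ℝ, E) ∞ M] in
theorem contDiffAt_chartForm (x₀ : M) {y : E} (hy : y ∈ (extChartAt 𝓘(ℝ, E) x₀).target) :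
    ContDiffAt ℝ ∞ (chartForm Ω.form x₀) y :=
  (Ω.smooth x₀ y hy).contDiffAt ((isOpen_extChartAt_target x₀).mem_nhds hy)

theorem contDiffAt_pull {u : P → M} {O : Set P} (hO : IsOpen O)
    (hu : ContMDiffOn 𝓘(ℝ, P) 𝓘(ℝ, E) ∞ u O) {p : P} (hp : p ∈ O) :
    ContDiffAt ℝ ∞ (Ω.pull u) p := by
  set c := extChartAt 𝓘(ℝ, E) (u p)
  set g : P → E := fun q => c (u q) with hg
  have hs : u p ∈ c.source := mem_extChartAt_source (u p)
  have h1 : ContDiffAt ℝ ∞ g p := contDiffAt_coord hO hu (u p) hp hs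
  have h2 : ContDiffAt ℝ ∞ (fun q => fderiv ℝ g q) p := h1.fderiv_right (by simp)
  have h3 : ContDiffAt ℝ ∞ (fun q => altToBilin E (chartForm Ω.form (u p) (g q))) p :=
    ContDiffAt.comp (g := fun η => altToBilin E η) p
      contDiff_altToBilin.contDiffAt
      (ContDiffAt.comp (g := chartForm Ω.form (u p)) p
        (Ω.contDiffAt_chartForm (u p) (c.map_source hs)) h1)
  -- Each composition inserts the derivative of `g` in one argument; the flips bring the other
  -- argument into position and back.
  have h4 : ContDiffAt ℝ ∞ (fun q => ((((altToBilin E (chartForm Ω.form (u p) (g q))).comp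
      (fderiv ℝ g q)).flip).comp (fderiv ℝ g q)).flip) p :=
    contDiff_flip.contDiffAt.comp p
      ((contDiff_flip.contDiffAt.comp p (h3.clm_comp h2)).clm_comp h2)
  refine h4.congr_of_eventuallyEq ?_
  filter_upwards [Ω.pullForm_eventuallyEq_chart hO hu hp] with q hq
  ext v w
  simp only [pull, hq]
  simp only [ContinuousLinearMap.flip_apply, ContinuousLinearMap.comp_apply]
  rw [altToBilin_apply, altToBilin_apply]
  refine congrArg (chartForm Ω.form (u p) (g q)) ?_
  funext i
  fin_cases i <;> rfl

theorem contDiffOn_pull {u : P → M} {O : Set P} (hO : IsOpen O)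
    (hu : ContMDiffOn 𝓘(ℝ, P) 𝓘(ℝ, E) ∞ u O) : ContDiffOn ℝ ∞ (Ω.pull u) O :=
  fun _ hp => (Ω.contDiffAt_pull hO hu hp).contDiffWithinAt

/-- The pullback of a symplectic form is closed. -/
theorem pull_closed {u : P → M} {O : Set P} (hO : IsOpen O)
    (hu : ContMDiffOn 𝓘(ℝ, P) 𝓘(ℝ, E) ∞ u O) {p : P} (hp : p ∈ O) (a v w : P) :
    fderiv ℝ (Ω.pull u) p a v w - fderiv ℝ (Ω.pull u) p v a w + fderiv ℝ (Ω.pull u) p w a v = 0 := by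
  set c := extChartAt 𝓘(ℝ, E) (u p)
  set g : P → E := fun q => c (u q) with hg
  have hs : u p ∈ c.source := mem_extChartAt_source (u p)
  have h1 : ContDiffAt ℝ ∞ g p := contDiffAt_coord hO hu (u p) hp hs
  have h2 : ContDiffAt ℝ ∞ (fun q => fderiv ℝ g q) p := h1.fderiv_right (by simp)
  have h3 := Ω.contDiffAt_chartForm (u p) (c.map_source hs)
  have hev := Ω.pullForm_eventuallyEq_chart hO hu hp
  have hd : DifferentiableAt ℝ (Ω.pullForm u) p := by
    refine DifferentiableAt.congr_of_eventuallyEq ?_ hev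
    exact DifferentiableAt.continuousAlternatingMapCompContinuousLinearMap
      (DifferentiableAt.comp (g := chartForm Ω.form (u p)) p (h3.differentiableAt (by simp))
        (h1.differentiableAt (by simp)))
      (h2.differentiableAt (by simp))
  -- The exterior derivative commutes with pullback, and the chart expression of `Ω` is closed.
  -- Evaluated on three constant vectors this is the required cyclic identity.
  have hz : extDeriv (Ω.pullForm u) p = 0 := by
    rw [hev.extDeriv_eq]
    have := extDeriv_pullback (f := g) (r := ∞) (h3.differentiableAt (by simp)) h1
      (by rw [minSmoothness_of_isRCLikeNormedField]; exact ENat.LEInfty.out)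
    refine this.trans ?_
    rw [show extDeriv (chartForm Ω.form (u p)) (g p) = 0 from
      Ω.closed (u p) _ (c.map_source hs)]
    rfl
  have h := extDeriv_apply hd ![a, v, w]
  rw [hz, Fin.sum_univ_three] at h
  have key : ∀ b v w : P, fderiv ℝ (Ω.pull u) p b v w =
      fderiv ℝ (fun q => Ω.pullForm u q ![v, w]) p b := by
    intro b v w
    have e1 : fderiv ℝ (Ω.pull u) p = (altToBilin P).comp (fderiv ℝ (Ω.pullForm u) p) :=
      (HasFDerivAt.comp (g := fun η => altToBilin P η) p (hasFDerivAt_altToBilin _)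
        hd.hasFDerivAt).fderiv
    rw [e1, ContinuousLinearMap.comp_apply, altToBilin_apply,
      fderiv_continuousAlternatingMap_apply_const_apply hd]
  rw [key, key, key]
  have r0 : (0 : Fin 3).removeNth ![a, v, w] = ![v, w] := by
    funext i; fin_cases i <;> rfl
  have r1 : (1 : Fin 3).removeNth ![a, v, w] = ![a, w] := by
    funext i; fin_cases i <;> rfl
  have r2 : (2 : Fin 3).removeNth ![a, v, w] = ![a, v] := by
    funext i; fin_cases i <;> rfl
  rw [r0, r1, r2] at h
  simp at h
  linarith

end SymplecticForm

end Pullback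

/-! ### The flux form of a smooth family of diffeomorphisms -/

section Flux

variable {E : Type*} [NormedAddCommGroup E] [NormedSpace ℝ E]
  {M : Type*} [TopologicalSpace M] [ChartedSpace E M]

/-- A bijection preserving the symplectic form. -/
def IsSymplectic (Ω : SymplecticForm E M) (φ : Equiv.Perm M) : Prop :=
  ∀ (x : M) (v w : TangentSpace 𝓘(ℝ, E) x),
    Ω.bilin (φ x) (mfderiv 𝓘(ℝ, E) 𝓘(ℝ, E) φ x v) (mfderiv 𝓘(ℝ, E) 𝓘(ℝ, E) φ x w) = Ω.bilin x v w

/-- The flux form `v ↦ Ω (d/dt (f t x), D (f t) v)` of a family of bijections. -/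
def fluxForm (Ω : SymplecticForm E M) (f : ℝ → Equiv.Perm M) (t : ℝ) (x : M) :
    TangentSpace 𝓘(ℝ, E) x →L[ℝ] ℝ :=
  (Ω.bilin (f t x) (velocity E f t x)).comp (mfderiv 𝓘(ℝ, E) 𝓘(ℝ, E) (f t) x)

/-- The smooth function `B` is a potential of the flux form of `f`. -/
def IsFluxPotential (Ω : SymplecticForm E M) (f : ℝ → Equiv.Perm M) (B : ℝ → M → ℝ) : Prop :=
  ContMDiff (𝓘(ℝ, ℝ).prod 𝓘(ℝ, E)) 𝓘(ℝ, ℝ) ∞ (fun q : ℝ × M => B q.1 q.2) ∧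
    ∀ t x, HasMFDerivAt 𝓘(ℝ, E) 𝓘(ℝ, ℝ) (B t) x (fluxForm Ω f t x)

variable {Ω : SymplecticForm E M} {f g : ℝ → Equiv.Perm M}

theorem fluxForm_apply (t : ℝ) (x : M) (v : TangentSpace 𝓘(ℝ, E) x) :
    fluxForm Ω f t x v =
      Ω.bilin (f t x) (velocity E f t x) (mfderiv 𝓘(ℝ, E) 𝓘(ℝ, E) (f t) x v) := rfl

theorem IsDiffeo.mdifferentiableAt {φ : Equiv.Perm M} (h : IsDiffeo E φ) (x : M) :
    MDifferentiableAt 𝓘(ℝ, E) 𝓘(ℝ, E) φ x :=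
  h.1.contMDiffAt.mdifferentiableAt (by simp)

theorem IsDiffeo.mfderiv_symm_apply {φ : Equiv.Perm M} (h : IsDiffeo E φ) (x : M)
    (v : TangentSpace 𝓘(ℝ, E) (φ x)) :
    mfderiv 𝓘(ℝ, E) 𝓘(ℝ, E) φ x (show E from mfderiv 𝓘(ℝ, E) 𝓘(ℝ, E) φ.symm (φ x) v) = v := by
  have h1 := mfderiv_comp (I := 𝓘(ℝ, E)) (I' := 𝓘(ℝ, E)) (I'' := 𝓘(ℝ, E)) (φ x)
    (g := φ) (f := φ.symm) (h.mdifferentiableAt _) (h.inv.mdifferentiableAt (φ x))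
  have h2 : (φ : M → M) ∘ φ.symm = id := by
    funext y
    simp
  have h3 : (mfderiv 𝓘(ℝ, E) 𝓘(ℝ, E) ((φ : M → M) ∘ φ.symm) (φ x) : E →L[ℝ] E) =
      ContinuousLinearMap.id ℝ E := by
    rw [h2]
    exact mfderiv_id
  have h4 : ∀ y, y = x → (mfderiv 𝓘(ℝ, E) 𝓘(ℝ, E) φ y : E →L[ℝ] E) =
    mfderiv 𝓘(ℝ, E) 𝓘(ℝ, E) φ x := by
    rintro y rfl
    rfl
  have h5 := congrArg (fun L : E →L[ℝ] E => L v) (h1.symm.trans h3)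
  have h6 := h4 (φ.symm (φ x)) (φ.symm_apply_apply x)
  refine Eq.trans ?_ h5
  exact congrArg (fun L : E →L[ℝ] E => L (mfderiv 𝓘(ℝ, E) 𝓘(ℝ, E) φ.symm (φ x) v)) h6.symm

theorem mfderiv_perm_mul {φ ψ : Equiv.Perm M} (hφ : IsDiffeo E φ) (hψ : IsDiffeo E ψ) (x : M)
    (v : TangentSpace 𝓘(ℝ, E) x) :
    mfderiv 𝓘(ℝ, E) 𝓘(ℝ, E) (φ * ψ) x v =
      mfderiv 𝓘(ℝ, E) 𝓘(ℝ, E) φ (ψ x) (mfderiv 𝓘(ℝ, E) 𝓘(ℝ, E) ψ x v) :=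
  congrArg (fun L : E →L[ℝ] E => L v)
    (mfderiv_comp (I := 𝓘(ℝ, E)) (I' := 𝓘(ℝ, E)) (I'' := 𝓘(ℝ, E)) x
      (g := φ) (f := ψ) (hφ.mdifferentiableAt _) (hψ.mdifferentiableAt x))

theorem mfderiv_perm_one (x : M) (v : TangentSpace 𝓘(ℝ, E) x) :
    mfderiv 𝓘(ℝ, E) 𝓘(ℝ, E) (1 : Equiv.Perm M) x v = v :=
  congrArg (fun L : E →L[ℝ] E => L v) (mfderiv_id (I := 𝓘(ℝ, E)) (x := x))

theorem IsSymplectic.mul {φ ψ : Equiv.Perm M} (hφ : IsSymplectic Ω φ) (hψ : IsSymplectic Ω ψ)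
    (hφd : IsDiffeo E φ) (hψd : IsDiffeo E ψ) : IsSymplectic Ω (φ * ψ) := by
  intro x v w
  rw [mfderiv_perm_mul hφd hψd, mfderiv_perm_mul hφd hψd]
  exact (hφ _ _ _).trans (hψ _ _ _)

theorem IsSymplectic.one : IsSymplectic Ω 1 := by
  intro x v w
  rw [mfderiv_perm_one, mfderiv_perm_one]
  rfl

theorem SmoothFamily.mdifferentiableAt_path (hf : SmoothFamily E f) (t : ℝ) (x : M) :
    MDifferentiableAt 𝓘(ℝ, ℝ) 𝓘(ℝ, E) (fun s => f s x) t :=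
  (ContMDiff.comp (I' := 𝓘(ℝ, ℝ).prod 𝓘(ℝ, E)) hf
    (contMDiff_id.prodMk contMDiff_const)).mdifferentiableAt (by simp)

/-- Chain rule for `(s, y) ↦ f s y` along the curve `s ↦ (s, g s x)`, whose two components give the
two summands. -/
theorem velocity_mul (hf : SmoothFamily E f) (hg : SmoothFamily E g) (t : ℝ) (x : M) :
    velocity E (f * g) t x =
      velocity E f t (g t x) + mfderiv 𝓘(ℝ, E) 𝓘(ℝ, E) (f t) (g t x) (velocity E g t x) := by
  have h1 : MDifferentiableAt (𝓘(ℝ, ℝ).prod 𝓘(ℝ, E)) 𝓘(ℝ, E) (fun q : ℝ × M => f q.1 q.2)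
      (t, g t x) := hf.mdifferentiableAt (by simp)
  have h2 : MDifferentiableAt 𝓘(ℝ, ℝ) 𝓘(ℝ, E) (fun s => g s x) t := hg.mdifferentiableAt_path t x
  have h3 := (mdifferentiableAt_id (I := 𝓘(ℝ, ℝ)) (x := t)).hasMFDerivAt.prodMk h2.hasMFDerivAt
  have h4 := (HasMFDerivAt.comp t h1.hasMFDerivAt h3).mfderiv
  refine (congrArg (fun L : ℝ →L[ℝ] E => L (1 : ℝ)) h4).trans ?_
  refine (mfderiv_prod_eq_add_apply (I := 𝓘(ℝ, ℝ)) (I' := 𝓘(ℝ, E)) (I'' := 𝓘(ℝ, E)) h1).trans ?_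
  have h5 : mfderiv 𝓘(ℝ, ℝ) 𝓘(ℝ, ℝ) (id : ℝ → ℝ) t (1 : ℝ) = (1 : ℝ) :=
    congrArg (fun L : ℝ →L[ℝ] ℝ => L 1) (mfderiv_id (I := 𝓘(ℝ, ℝ)) (x := t))
  have h6 : ((ContinuousLinearMap.prod (mfderiv 𝓘(ℝ, ℝ) 𝓘(ℝ, ℝ) (id : ℝ → ℝ) t)
    (mfderiv 𝓘(ℝ, ℝ) 𝓘(ℝ, E) (fun s => g s x) t) : ℝ →L[ℝ] ℝ × E) (1 : ℝ)) =
      ((1 : ℝ), (velocity E g t x : E)) := Prod.ext h5 rfl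
  exact congrArg (fun p : ℝ × E =>
    (mfderiv 𝓘(ℝ, ℝ) 𝓘(ℝ, E) (fun s => f s (g t x)) t : ℝ →L[ℝ] E) p.1 +
      (mfderiv 𝓘(ℝ, E) 𝓘(ℝ, E) (f t) (g t x) : E →L[ℝ] E) p.2) h6

/-- The cocycle rule behind the whole argument: of the two terms of the velocity, the second is
pushed forward by `f t`, which drops out because `f t` preserves `Ω`. -/
theorem fluxForm_mul (hf : SmoothFamily E f) (hg : SmoothFamily E g) {t : ℝ}
    (hfd : IsDiffeo E (f t)) (hgd : IsDiffeo E (g t)) (hs : IsSymplectic Ω (f t)) (x : M) :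
    fluxForm Ω (f * g) t x =
      (fluxForm Ω f t (g t x)).comp (mfderiv 𝓘(ℝ, E) 𝓘(ℝ, E) (g t) x) + fluxForm Ω g t x := by
  ext v
  have h1 : fluxForm Ω (f * g) t x v = Ω.bilin (f t (g t x)) (velocity E (f * g) t x)
    (mfderiv 𝓘(ℝ, E) 𝓘(ℝ, E) (f t * g t) x v) := rfl
  rw [h1, velocity_mul hf hg, mfderiv_perm_mul hfd hgd]
  have h2 := hs (g t x) (velocity E g t x) (mfderiv 𝓘(ℝ, E) 𝓘(ℝ, E) (g t) x v)
  refine (congrArg (fun L : E →L[ℝ] ℝ => L (mfderiv 𝓘(ℝ, E) 𝓘(ℝ, E) (f t) (g t x)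
    (mfderiv 𝓘(ℝ, E) 𝓘(ℝ, E) (g t) x v))) (map_add (Ω.bilin (f t (g t x)))
      (velocity E f t (g t x)) _)).trans ?_
  exact congrArg (fun r : ℝ => Ω.bilin (f t (g t x)) (velocity E f t (g t x))
    (mfderiv 𝓘(ℝ, E) 𝓘(ℝ, E) (f t) (g t x) (mfderiv 𝓘(ℝ, E) 𝓘(ℝ, E) (g t) x v)) + r) h2

theorem fluxForm_const (φ : Equiv.Perm M) (t : ℝ) (x : M) : fluxForm Ω (fun _ => φ) t x = 0 := by
  have h1 : velocity E (fun _ : ℝ => φ) t x = 0 :=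
    congrArg (fun L : ℝ →L[ℝ] E => L (1 : ℝ)) (mfderiv_const (I := 𝓘(ℝ, ℝ)) (c := φ x) (x := t))
  ext v
  rw [fluxForm_apply, h1]
  exact congrArg (fun L : E →L[ℝ] ℝ => L _) (map_zero (Ω.bilin (φ x)))

theorem fluxForm_reparam (hf : SmoothFamily E f) {b : ℝ → ℝ} {t : ℝ} (hb : DifferentiableAt ℝ b t)
    (x : M) : fluxForm Ω (fun s => f (b s)) t x = deriv b t • fluxForm Ω f (b t) x := by
  have hc := mfderiv_comp (I := 𝓘(ℝ, ℝ)) (I' := 𝓘(ℝ, ℝ)) (I'' := 𝓘(ℝ, E)) t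
    (hf.mdifferentiableAt_path (b t) x) hb.mdifferentiableAt
  have h1 : velocity E (fun t => f (b t)) t x =
      (mfderiv 𝓘(ℝ, ℝ) 𝓘(ℝ, E) (fun s => f s x) (b t))
        (mfderiv 𝓘(ℝ, ℝ) 𝓘(ℝ, ℝ) b t (1 : ℝ)) := congrArg (fun L => L (1 : ℝ)) hc
  rw [mfderiv_eq_fderiv] at h1
  have h2 : fderiv ℝ b t (1 : ℝ) = deriv b t • (1 : ℝ) := by simp
  have h3 : velocity E (fun t => f (b t)) t x = deriv b t • velocity E f (b t) x :=
    h1.trans ((congrArg _ h2).trans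
      (map_smul (mfderiv 𝓘(ℝ, ℝ) 𝓘(ℝ, E) (fun s => f s x) (b t)) _ _))
  ext v
  rw [fluxForm_apply, h3]
  exact congrArg (fun L : E →L[ℝ] ℝ => L _) (map_smul (Ω.bilin (f (b t) x)) (deriv b t) _)

theorem contMDiff_slice {B : ℝ → M → ℝ}
    (hB : ContMDiff (𝓘(ℝ, ℝ).prod 𝓘(ℝ, E)) 𝓘(ℝ, ℝ) ∞ (fun q : ℝ × M => B q.1 q.2)) (t : ℝ) :
    ContMDiff 𝓘(ℝ, E) 𝓘(ℝ, ℝ) ∞ (B t) :=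
  ContMDiff.comp (I' := 𝓘(ℝ, ℝ).prod 𝓘(ℝ, E)) (g := fun q : ℝ × M => B q.1 q.2) hB
    (contMDiff_const.prodMk contMDiff_id)

theorem contMDiff_comp_family {B : ℝ → M → ℝ}
    (hB : ContMDiff (𝓘(ℝ, ℝ).prod 𝓘(ℝ, E)) 𝓘(ℝ, ℝ) ∞ (fun q : ℝ × M => B q.1 q.2))
    (hg : SmoothFamily E g) :
    ContMDiff (𝓘(ℝ, ℝ).prod 𝓘(ℝ, E)) 𝓘(ℝ, ℝ) ∞ (fun q : ℝ × M => B q.1 (g q.1 q.2)) :=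
  ContMDiff.comp (I' := 𝓘(ℝ, ℝ).prod 𝓘(ℝ, E)) hB (contMDiff_fst.prodMk hg)

theorem IsFluxPotential.const (φ : Equiv.Perm M) :
    IsFluxPotential Ω (fun _ => φ) (fun _ _ => 0) :=
  ⟨contMDiff_const, fun t x => by
    rw [fluxForm_const]
    exact hasMFDerivAt_const 0 x⟩

theorem IsFluxPotential.mul {B C : ℝ → M → ℝ} (hB : IsFluxPotential Ω f B)
    (hC : IsFluxPotential Ω g C) (hf : SmoothFamily E f) (hg : SmoothFamily E g)
    (hfd : ∀ t, IsDiffeo E (f t)) (hgd : ∀ t, IsDiffeo E (g t)) (hs : ∀ t, IsSymplectic Ω (f t)) :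
    IsFluxPotential Ω (f * g) (fun t x => B t (g t x) + C t x) := by
  refine ⟨(contMDiff_comp_family hB.1 hg).add hC.1, fun t x => ?_⟩
  rw [fluxForm_mul hf hg (hfd t) (hgd t) (hs t)]
  exact (HasMFDerivAt.comp x (hB.2 t (g t x)) ((hgd t).mdifferentiableAt x).hasMFDerivAt).add
    (hC.2 t x)

/-- The cocycle rule applied to `f * f⁻¹ = 1`, whose flux form vanishes. -/
theorem IsFluxPotential.inv [CompleteSpace E] [IsManifold 𝓘(ℝ, E) ∞ M] {B : ℝ → M → ℝ}
    (hB : IsFluxPotential Ω f B) (hf : SmoothFamily E f)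
    (hfd : ∀ t, IsDiffeo E (f t)) (hs : ∀ t, IsSymplectic Ω (f t)) :
    IsFluxPotential Ω f⁻¹ (fun t x => - B t ((f t)⁻¹ x)) := by
  have hi := hf.inv hfd
  refine ⟨(contMDiff_comp_family hB.1 hi).neg, fun t x => ?_⟩
  have h1 := fluxForm_mul (Ω := Ω) hf hi (hfd t) (hfd t).inv (hs t) x
  have h2 : fluxForm Ω (f * f⁻¹) t x = 0 := by
    rw [mul_inv_cancel]
    exact fluxForm_const 1 t x
  have h3 : fluxForm Ω f⁻¹ t x =
      - (fluxForm Ω f t ((f t)⁻¹ x)).comp (mfderiv 𝓘(ℝ, E) 𝓘(ℝ, E) (f⁻¹ t) x) := by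
    rw [h2] at h1
    exact (neg_eq_of_add_eq_zero_right h1.symm).symm
  rw [h3]
  exact (HasMFDerivAt.comp x (hB.2 t ((f t)⁻¹ x))
    ((hfd t).inv.mdifferentiableAt x).hasMFDerivAt).neg

/-- With `IsFluxPotential.generatesPath`, this translates between Hamiltonians and flux potentials:
one passes from target to source points and changes the sign. -/
theorem GeneratesPath.isFluxPotential {F : ℝ → M → ℝ} (h : GeneratesPath Ω F f)
    (hf : SmoothFamily E f) (hfd : ∀ t, IsDiffeo E (f t)) :
    IsFluxPotential Ω f (fun t x => - F t (f t x)) := by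
  refine ⟨(contMDiff_comp_family h.1 hf).neg, fun t x => ?_⟩
  have h1 : MDifferentiableAt 𝓘(ℝ, E) 𝓘(ℝ, ℝ) (F t) (f t x) :=
    (contMDiff_slice h.1 t).mdifferentiableAt (by simp)
  have h2 := (HasMFDerivAt.comp x h1.hasMFDerivAt ((hfd t).mdifferentiableAt x).hasMFDerivAt).neg
  have h3 : fluxForm Ω f t x = - (mfderiv 𝓘(ℝ, E) 𝓘(ℝ, ℝ) (F t) (f t x)).comp
      (mfderiv 𝓘(ℝ, E) 𝓘(ℝ, E) (f t) x) := by
    ext v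
    rw [fluxForm_apply, Ω.bilin_apply]
    exact h.2 t x (mfderiv 𝓘(ℝ, E) 𝓘(ℝ, E) (f t) x v)
  rw [h3]
  exact h2

theorem IsFluxPotential.generatesPath [CompleteSpace E] [IsManifold 𝓘(ℝ, E) ∞ M] {B : ℝ → M → ℝ}
    (hB : IsFluxPotential Ω f B) (hf : SmoothFamily E f) (hfd : ∀ t, IsDiffeo E (f t)) :
    GeneratesPath Ω (fun t x => - B t ((f t)⁻¹ x)) f := by
  have hi := hf.inv hfd
  refine ⟨(contMDiff_comp_family hB.1 hi).neg, fun t x v => ?_⟩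
  have h1 := (HasMFDerivAt.comp (f t x) (hB.2 t ((f t)⁻¹ (f t x)))
    ((hfd t).inv.mdifferentiableAt (f t x)).hasMFDerivAt).neg
  have h2 : (mfderiv 𝓘(ℝ, E) 𝓘(ℝ, ℝ) (fun x => - B t ((f t)⁻¹ x)) (f t x) : E →L[ℝ] ℝ) =
    - (fluxForm Ω f t ((f t)⁻¹ (f t x)) : E →L[ℝ] ℝ).comp
      (mfderiv 𝓘(ℝ, E) 𝓘(ℝ, E) (f t).symm (f t x) : E →L[ℝ] E) := h1.mfderiv
  have h3 : ∀ y, y = x → (fluxForm Ω f t y : E →L[ℝ] ℝ) = fluxForm Ω f t x := by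
    rintro y rfl
    rfl
  have h3' := h3 _ ((f t).symm_apply_apply x)
  have h4 : mfderiv 𝓘(ℝ, E) 𝓘(ℝ, ℝ) (fun x => - B t ((f t)⁻¹ x)) (f t x) v =
      - Ω.bilin (f t x) (velocity E f t x) v := by
    refine (congrArg (fun L : E →L[ℝ] ℝ => L v) h2).trans ?_
    refine congrArg Neg.neg ?_
    refine (congrArg (fun L : E →L[ℝ] ℝ =>
      L (mfderiv 𝓘(ℝ, E) 𝓘(ℝ, E) (f t).symm (f t x) v)) h3').trans ?_
    refine (fluxForm_apply (Ω := Ω) t x _).trans ?_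
    exact congrArg (fun z : E => Ω.bilin (f t x) (velocity E f t x) z)
      ((hfd t).mfderiv_symm_apply x v)
  refine Eq.trans ?_ (congrArg Neg.neg h4.symm)
  rw [Ω.bilin_apply]
  exact (neg_neg _).symm

end Flux

/-! ### Integrals depending on a parameter -/

section Parametric

universe u

variable {Y F : Type u} [NormedAddCommGroup Y] [NormedSpace ℝ Y] [NormedAddCommGroup F]
  [NormedSpace ℝ F]

theorem hasFDerivAt_parametric_integral [CompleteSpace F] {g : ℝ × Y → F} {U : Set (ℝ × Y)}
    {O : Set Y} (hO : IsOpen O) (hU : IsOpen U) (hOU : Icc 0 1 ×ˢ O ⊆ U)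
    (hg : ContDiffOn ℝ 1 g U) {y₀ : Y} (hy : y₀ ∈ O) :
    HasFDerivAt (fun y => ∫ s in (0 : ℝ)..1, g (s, y))
      (∫ s in (0 : ℝ)..1, (fderiv ℝ g (s, y₀)).comp (ContinuousLinearMap.inr ℝ ℝ Y)) y₀ := by
  have hd : ∀ s ∈ Icc (0 : ℝ) 1, ∀ y ∈ O, DifferentiableAt ℝ g (s, y) := fun s hs y h =>
    (hg.differentiableOn (by simp)).differentiableAt (hU.mem_nhds (hOU ⟨hs, h⟩))
  have hc : ∀ s ∈ Icc (0 : ℝ) 1, ∀ y ∈ O, ContinuousAt (fun q => (fderiv ℝ g q).comp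
      (ContinuousLinearMap.inr ℝ ℝ Y)) (s, y) := fun s hs y h => by
    have h1 : ContinuousAt (fderiv ℝ g) (s, y) :=
      (hg.continuousOn_fderiv_of_isOpen hU (by simp)).continuousAt (hU.mem_nhds (hOU ⟨hs, h⟩))
    exact h1.clm_comp continuousAt_const
  have hcs : ∀ y ∈ O, ContinuousOn (fun s => (fderiv ℝ g (s, y)).comp
      (ContinuousLinearMap.inr ℝ ℝ Y)) (Icc 0 1) := fun y h s hs =>
    (ContinuousAt.comp (f := fun s => (s, y)) (x := s) (hc s hs y h)
      (by fun_prop)).continuousWithinAt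
  have hgs : ∀ y ∈ O, ContinuousOn (fun s => g (s, y)) (Icc 0 1) := fun y h s hs =>
    (ContinuousAt.comp (f := fun s => (s, y)) (x := s) (hd s hs y h).continuousAt
      (by fun_prop)).continuousWithinAt
  obtain ⟨C, hC⟩ := (isCompact_Icc (a := (0 : ℝ)) (b := 1)).exists_bound_of_continuousOn
    (hcs y₀ hy)
  -- Compactness of `[0, 1]` extends the bound `C` at `y₀` to the bound `C + 1` on one neighbourhood
  -- valid for all `s`, which gives the constant dominating function.
  have hev : ∀ᶠ y in 𝓝 y₀, ∀ s ∈ Icc (0 : ℝ) 1,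
      ‖(fderiv ℝ g (s, y)).comp (ContinuousLinearMap.inr ℝ ℝ Y)‖ < C + 1 := by
    refine (isCompact_Icc (a := (0 : ℝ)) (b := 1)).eventually_forall_of_forall_eventually ?_
    intro s hs
    have h1 : ContinuousAt (fun z : Y × ℝ => ‖(fderiv ℝ g (z.2, z.1)).comp
        (ContinuousLinearMap.inr ℝ ℝ Y)‖) (y₀, s) :=
      (ContinuousAt.comp (f := fun z : Y × ℝ => (z.2, z.1)) (x := (y₀, s)) (hc s hs y₀ hy)
        (by fun_prop)).norm
    exact h1.eventually (gt_mem_nhds (lt_of_le_of_lt (hC s hs) (lt_add_one C)))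
  have hW : {y | y ∈ O ∧ ∀ s ∈ Icc (0 : ℝ) 1,
      ‖(fderiv ℝ g (s, y)).comp (ContinuousLinearMap.inr ℝ ℝ Y)‖ < C + 1} ∈ 𝓝 y₀ :=
    inter_mem (hO.mem_nhds hy) hev
  have hI : uIoc (0 : ℝ) 1 ⊆ Icc 0 1 := by
    rw [uIoc_of_le zero_le_one]
    exact Ioc_subset_Icc_self
  refine (intervalIntegral.hasFDerivAt_integral_of_dominated_of_fderiv_le (𝕜 := ℝ)
    (F := fun y s => g (s, y))
    (F' := fun y s => (fderiv ℝ g (s, y)).comp (ContinuousLinearMap.inr ℝ ℝ Y))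
    (bound := fun _ => C + 1) hW ?_ ?_ ?_ ?_ ?_ ?_)
  · filter_upwards [hO.mem_nhds hy] with y h
    exact ((hgs y h).mono hI).aestronglyMeasurable measurableSet_uIoc
  · exact ContinuousOn.intervalIntegrable_of_Icc zero_le_one (hgs y₀ hy)
  · exact ((hcs y₀ hy).mono hI).aestronglyMeasurable measurableSet_uIoc
  · refine Eventually.of_forall fun s hs y h => ?_
    exact (h.2 s (hI hs)).le
  · exact intervalIntegrable_const
  · refine Eventually.of_forall fun s hs y h => ?_
    exact (hd s (hI hs) y h.1).hasFDerivAt.comp y (hasFDerivAt_prodMk_right s y)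

theorem fderiv_parametric_integral_apply [CompleteSpace F] {g : ℝ × Y → F} {U : Set (ℝ × Y)}
    {O : Set Y} (hO : IsOpen O) (hU : IsOpen U) (hOU : Icc 0 1 ×ˢ O ⊆ U)
    (hg : ContDiffOn ℝ 1 g U) {y₀ : Y} (hy : y₀ ∈ O) (v : Y) :
    fderiv ℝ (fun y => ∫ s in (0 : ℝ)..1, g (s, y)) y₀ v =
      ∫ s in (0 : ℝ)..1, fderiv ℝ g (s, y₀) (0, v) := by
  rw [(hasFDerivAt_parametric_integral hO hU hOU hg hy).fderiv]
  refine ContinuousLinearMap.intervalIntegral_apply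
    (ContinuousOn.intervalIntegrable_of_Icc zero_le_one ?_) v
  have h1 := (hg.continuousOn_fderiv_of_isOpen hU (by simp)).comp
    (f := fun s : ℝ => (s, y₀)) (s := Icc 0 1) (by fun_prop) (fun s h => hOU ⟨h, hy⟩)
  exact h1.clm_comp continuousOn_const

/-- Induction on `n`: the derivative of the integral is an integral of the same kind with values in
`Y →L[ℝ] F`. Hence the target space varies in the induction. -/
theorem contDiffOn_parametric_integral_nat {U : Set (ℝ × Y)} {O : Set Y} (hO : IsOpen O)
    (hU : IsOpen U) (hOU : Icc 0 1 ×ˢ O ⊆ U) (n : ℕ) :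
    ∀ {F : Type u} [NormedAddCommGroup F] [NormedSpace ℝ F] [CompleteSpace F] {g : ℝ × Y → F},
      ContDiffOn ℝ ∞ g U → ContDiffOn ℝ n (fun y => ∫ s in (0 : ℝ)..1, g (s, y)) O := by
  induction n with
  | zero =>
    intro F _ _ _ g hg
    refine contDiffOn_zero.2 fun y hy => ?_
    exact (hasFDerivAt_parametric_integral hO hU hOU (hg.of_le ENat.LEInfty.out)
      hy).continuousAt.continuousWithinAt
  | succ n ih =>
    intro F _ _ _ g hg
    have hd := fun y hy => hasFDerivAt_parametric_integral hO hU hOU (hg.of_le ENat.LEInfty.out)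
      (y₀ := y) hy
    push_cast
    rw [contDiffOn_succ_iff_fderiv_of_isOpen hO]
    refine ⟨fun y hy => (hd y hy).differentiableAt.differentiableWithinAt, by simp, ?_⟩
    have h1 : ContDiffOn ℝ ∞ (fun q => (fderiv ℝ g q).comp (ContinuousLinearMap.inr ℝ ℝ Y)) U :=
      (hg.fderiv_of_isOpen hU (by simp)).clm_comp contDiffOn_const
    exact (ih h1).congr fun y hy => (hd y hy).fderiv

theorem contDiffOn_parametric_integral [CompleteSpace F] {U : Set (ℝ × Y)} {O : Set Y}
    (hO : IsOpen O) (hU : IsOpen U) (hOU : Icc 0 1 ×ˢ O ⊆ U)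
    {g : ℝ × Y → F} (hg : ContDiffOn ℝ ∞ g U) :
    ContDiffOn ℝ ∞ (fun y => ∫ s in (0 : ℝ)..1, g (s, y)) O :=
  contDiffOn_infty.2 fun n => contDiffOn_parametric_integral_nat hO hU hOU n hg

end Parametric

/-! ### Families of diffeomorphisms in coordinates -/

section Coordinates

variable {E : Type*} [NormedAddCommGroup E] [NormedSpace ℝ E]
  {M : Type*} [TopologicalSpace M] [ChartedSpace E M] [IsManifold 𝓘(ℝ, E) ∞ M]

/-- The derivative of the inverse of the chart at `x₀`. -/
def chartInvDeriv (E : Type*) [NormedAddCommGroup E] [NormedSpace ℝ E]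
    {M : Type*} [TopologicalSpace M] [ChartedSpace E M] (x₀ : M) (y : E) : E →L[ℝ] E :=
  mfderiv 𝓘(ℝ, E) 𝓘(ℝ, E) (extChartAt 𝓘(ℝ, E) x₀).symm y

/-- The derivative of the chart at `x₀`. -/
def chartDeriv (E : Type*) [NormedAddCommGroup E] [NormedSpace ℝ E]
    {M : Type*} [TopologicalSpace M] [ChartedSpace E M] (x₀ : M) (x : M) : E →L[ℝ] E :=
  mfderiv 𝓘(ℝ, E) 𝓘(ℝ, E) (extChartAt 𝓘(ℝ, E) x₀) x

/-- A family of bijections, as a map from the product of the parameter space and the target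
of the chart at `x₀`. -/
def chartFamily (E : Type*) [NormedAddCommGroup E] [NormedSpace ℝ E]
    {M : Type*} [TopologicalSpace M] [ChartedSpace E M] (f : ℝ → Equiv.Perm M) (x₀ : M)
    (q : ℝ × E) : M :=
  f q.1 ((extChartAt 𝓘(ℝ, E) x₀).symm q.2)

theorem mdifferentiableAt_chart_symm (x₀ : M) {y : E}
    (hy : y ∈ (extChartAt 𝓘(ℝ, E) x₀).target) :
    MDifferentiableAt 𝓘(ℝ, E) 𝓘(ℝ, E) (extChartAt 𝓘(ℝ, E) x₀).symm y :=
  ((contMDiffOn_extChartAt_symm (n := ∞) x₀).contMDiffAt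
    ((isOpen_extChartAt_target x₀).mem_nhds hy)).mdifferentiableAt (by simp)

theorem mdifferentiableAt_chart (x₀ : M) {x : M}
    (hx : x ∈ (extChartAt 𝓘(ℝ, E) x₀).source) :
    MDifferentiableAt 𝓘(ℝ, E) 𝓘(ℝ, E) (extChartAt 𝓘(ℝ, E) x₀) x :=
  (((contMDiffOn_extChartAt (I := 𝓘(ℝ, E)) (x := x₀) (n := ∞)) x
    (by simpa using hx)).contMDiffAt ((chartAt E x₀).open_source.mem_nhds
      (by simpa using hx))).mdifferentiableAt (by simp)

theorem chartInvDeriv_comp_chartDeriv (x₀ : M) {x : M}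
    (hx : x ∈ (extChartAt 𝓘(ℝ, E) x₀).source) :
    (chartInvDeriv E x₀ (extChartAt 𝓘(ℝ, E) x₀ x)).comp (chartDeriv E x₀ x) =
      ContinuousLinearMap.id ℝ E := by
  have h1 := mfderiv_comp (I := 𝓘(ℝ, E)) (I' := 𝓘(ℝ, E)) (I'' := 𝓘(ℝ, E)) x
    (mdifferentiableAt_chart_symm x₀ ((extChartAt 𝓘(ℝ, E) x₀).map_source hx))
    (mdifferentiableAt_chart x₀ hx)
  have h2 : (extChartAt 𝓘(ℝ, E) x₀).symm ∘ extChartAt 𝓘(ℝ, E) x₀ =ᶠ[𝓝 x] id := by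
    filter_upwards [extChartAt_source_mem_nhds' hx] with z hz
    exact (extChartAt 𝓘(ℝ, E) x₀).left_inv hz
  exact (h1.symm.trans h2.mfderiv_eq).trans mfderiv_id

omit [IsManifold 𝓘(ℝ, E) ∞ M] in
theorem isOpen_univ_prod_chart_target (x₀ : M) :
    IsOpen ((univ : Set ℝ) ×ˢ (extChartAt 𝓘(ℝ, E) x₀).target) :=
  isOpen_univ.prod (isOpen_extChartAt_target x₀)

theorem contMDiffOn_prod_chart_symm (x₀ : M) :
    ContMDiffOn 𝓘(ℝ, ℝ × E) (𝓘(ℝ, ℝ).prod 𝓘(ℝ, E)) ∞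
      (fun q : ℝ × E => (q.1, (extChartAt 𝓘(ℝ, E) x₀).symm q.2))
      (univ ×ˢ (extChartAt 𝓘(ℝ, E) x₀).target) := by
  have h1 : ContMDiffOn 𝓘(ℝ, ℝ × E) 𝓘(ℝ, ℝ) ∞ (Prod.fst : ℝ × E → ℝ)
      (univ ×ˢ (extChartAt 𝓘(ℝ, E) x₀).target) := contDiff_fst.contMDiff.contMDiffOn
  have h2 : ContMDiffOn 𝓘(ℝ, ℝ × E) 𝓘(ℝ, E) ∞ (Prod.snd : ℝ × E → E)
      (univ ×ˢ (extChartAt 𝓘(ℝ, E) x₀).target) := contDiff_snd.contMDiff.contMDiffOn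
  exact h1.prodMk (ContMDiffOn.comp (I' := 𝓘(ℝ, E)) (contMDiffOn_extChartAt_symm x₀) h2
    fun q hq => hq.2)

theorem SmoothFamily.contMDiffOn_chartFamily {f : ℝ → Equiv.Perm M} (hf : SmoothFamily E f)
    (x₀ : M) : ContMDiffOn 𝓘(ℝ, ℝ × E) 𝓘(ℝ, E) ∞ (chartFamily E f x₀)
      (univ ×ˢ (extChartAt 𝓘(ℝ, E) x₀).target) :=
  ContMDiff.comp_contMDiffOn (I' := 𝓘(ℝ, ℝ).prod 𝓘(ℝ, E)) (g := fun q : ℝ × M => f q.1 q.2) hf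
    (contMDiffOn_prod_chart_symm x₀)

theorem contDiffOn_chart_of_contMDiff {B : ℝ → M → ℝ}
    (hB : ContMDiff (𝓘(ℝ, ℝ).prod 𝓘(ℝ, E)) 𝓘(ℝ, ℝ) ∞ (fun q : ℝ × M => B q.1 q.2)) (x₀ : M) :
    ContDiffOn ℝ ∞ (fun q : ℝ × E => B q.1 ((extChartAt 𝓘(ℝ, E) x₀).symm q.2))
      (univ ×ˢ (extChartAt 𝓘(ℝ, E) x₀).target) :=
  (ContMDiff.comp_contMDiffOn (I' := 𝓘(ℝ, ℝ).prod 𝓘(ℝ, E)) (g := fun q : ℝ × M => B q.1 q.2) hB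
    (contMDiffOn_prod_chart_symm x₀)).contDiffOn

theorem SmoothFamily.mdifferentiableAt_chartFamily {f : ℝ → Equiv.Perm M}
    (hf : SmoothFamily E f) (x₀ : M) (s : ℝ) {y : E} (hy : y ∈ (extChartAt 𝓘(ℝ, E) x₀).target) :
    MDifferentiableAt 𝓘(ℝ, ℝ × E) 𝓘(ℝ, E) (chartFamily E f x₀) (s, y) :=
  ((hf.contMDiffOn_chartFamily x₀).contMDiffAt
    ((isOpen_univ_prod_chart_target x₀).mem_nhds ⟨mem_univ s, hy⟩)).mdifferentiableAt (by simp)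

theorem mfderiv_chartFamily_time {f : ℝ → Equiv.Perm M} (hf : SmoothFamily E f) (x₀ : M) (s : ℝ)
    {y : E} (hy : y ∈ (extChartAt 𝓘(ℝ, E) x₀).target) :
    (mfderiv 𝓘(ℝ, ℝ × E) 𝓘(ℝ, E) (chartFamily E f x₀) (s, y) : ℝ × E →L[ℝ] E) ((1 : ℝ), (0 : E)) =
      velocity E f s ((extChartAt 𝓘(ℝ, E) x₀).symm y) := by
  have h1 : HasFDerivAt (fun r : ℝ => (r, y)) (ContinuousLinearMap.inl ℝ ℝ E) s :=
    hasFDerivAt_prodMk_left s y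
  have h2 := (HasMFDerivAt.comp s (hf.mdifferentiableAt_chartFamily x₀ s hy).hasMFDerivAt
    h1.hasMFDerivAt).mfderiv
  exact (congrArg (fun L : ℝ →L[ℝ] E => L 1) h2).symm

theorem mfderiv_chartFamily_space {f : ℝ → Equiv.Perm M} (hf : SmoothFamily E f) (x₀ : M) (s : ℝ)
    (hd : IsDiffeo E (f s)) {y : E} (hy : y ∈ (extChartAt 𝓘(ℝ, E) x₀).target) (w : E) :
    (mfderiv 𝓘(ℝ, ℝ × E) 𝓘(ℝ, E) (chartFamily E f x₀) (s, y) : ℝ × E →L[ℝ] E) ((0 : ℝ), w) =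
      mfderiv 𝓘(ℝ, E) 𝓘(ℝ, E) (f s) ((extChartAt 𝓘(ℝ, E) x₀).symm y) (chartInvDeriv E x₀ y w) := by
  have h1 : HasFDerivAt (fun z : E => (s, z)) (ContinuousLinearMap.inr ℝ ℝ E) y :=
    hasFDerivAt_prodMk_right s y
  have h2 := (HasMFDerivAt.comp y (hf.mdifferentiableAt_chartFamily x₀ s hy).hasMFDerivAt
    h1.hasMFDerivAt).mfderiv
  have h3 := (HasMFDerivAt.comp y (hd.mdifferentiableAt _).hasMFDerivAt
    (mdifferentiableAt_chart_symm x₀ hy).hasMFDerivAt).mfderiv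
  exact congrArg (fun L : E →L[ℝ] E => L w) (h2.symm.trans h3)

/-- The flux form is the mixed time-space part of the pullback of `Ω` under `(s, x) ↦ f s x`;
closedness of this pullback then gives information on the flux. -/
theorem pull_chartFamily_time_space (Ω : SymplecticForm E M) {f : ℝ → Equiv.Perm M}
    (hf : SmoothFamily E f) (x₀ : M) (s : ℝ)
    (hd : IsDiffeo E (f s)) {y : E} (hy : y ∈ (extChartAt 𝓘(ℝ, E) x₀).target) (w : E) :
    Ω.pull (chartFamily E f x₀) (s, y) (1, 0) (0, w) =
      fluxForm Ω f s ((extChartAt 𝓘(ℝ, E) x₀).symm y) (chartInvDeriv E x₀ y w) := by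
  refine (Ω.pull_apply _ _ _ _).trans ?_
  exact congrArg₂ (fun a b : E => Ω.bilin (chartFamily E f x₀ (s, y)) a b)
    (mfderiv_chartFamily_time hf x₀ s hy) (mfderiv_chartFamily_space hf x₀ s hd hy w)

theorem pull_chartFamily_space_space (Ω : SymplecticForm E M) {f : ℝ → Equiv.Perm M}
    (hf : SmoothFamily E f) (x₀ : M) (s : ℝ)
    (hd : IsDiffeo E (f s)) {y : E} (hy : y ∈ (extChartAt 𝓘(ℝ, E) x₀).target) (v w : E) :
    Ω.pull (chartFamily E f x₀) (s, y) (0, v) (0, w) =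
      Ω.bilin (f s ((extChartAt 𝓘(ℝ, E) x₀).symm y))
        (mfderiv 𝓘(ℝ, E) 𝓘(ℝ, E) (f s) ((extChartAt 𝓘(ℝ, E) x₀).symm y) (chartInvDeriv E x₀ y v))
        (mfderiv 𝓘(ℝ, E) 𝓘(ℝ, E) (f s) ((extChartAt 𝓘(ℝ, E) x₀).symm y)
          (chartInvDeriv E x₀ y w)) := by
  refine (Ω.pull_apply _ _ _ _).trans ?_
  exact congrArg₂ (fun a b : E => Ω.bilin (chartFamily E f x₀ (s, y)) a b)
    (mfderiv_chartFamily_space hf x₀ s hd hy v) (mfderiv_chartFamily_space hf x₀ s hd hy w)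

/-- The flux form in the chart at `x₀`. -/
def chartFlux (Ω : SymplecticForm E M) (f : ℝ → Equiv.Perm M) (x₀ : M) (q : ℝ × E) : E →L[ℝ] ℝ :=
  (Ω.pull (chartFamily E f x₀) q (1, 0)).comp (ContinuousLinearMap.inr ℝ ℝ E)

theorem contDiffOn_chartFlux (Ω : SymplecticForm E M) {f : ℝ → Equiv.Perm M}
    (hf : SmoothFamily E f) (x₀ : M) :
    ContDiffOn ℝ ∞ (chartFlux Ω f x₀) (univ ×ˢ (extChartAt 𝓘(ℝ, E) x₀).target) :=
  ((Ω.contDiffOn_pull (isOpen_univ_prod_chart_target x₀)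
    (hf.contMDiffOn_chartFamily x₀)).clm_apply contDiffOn_const).clm_comp contDiffOn_const

theorem chartFlux_eq (Ω : SymplecticForm E M) {f : ℝ → Equiv.Perm M}
    (hf : SmoothFamily E f) (x₀ : M) (s : ℝ)
    (hd : IsDiffeo E (f s)) {y : E} (hy : y ∈ (extChartAt 𝓘(ℝ, E) x₀).target) :
    chartFlux Ω f x₀ (s, y) =
      (fluxForm Ω f s ((extChartAt 𝓘(ℝ, E) x₀).symm y) : E →L[ℝ] ℝ).comp (chartInvDeriv E x₀ y) := by
  ext w
  exact pull_chartFamily_time_space Ω hf x₀ s hd hy w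

theorem HasMFDerivAt.hasFDerivAt_chart {G : M → ℝ} (x₀ : M) {y : E}
    (hy : y ∈ (extChartAt 𝓘(ℝ, E) x₀).target) {L : E →L[ℝ] ℝ}
    (h : HasMFDerivAt 𝓘(ℝ, E) 𝓘(ℝ, ℝ) G ((extChartAt 𝓘(ℝ, E) x₀).symm y) L) :
    HasFDerivAt (fun z => G ((extChartAt 𝓘(ℝ, E) x₀).symm z)) (L.comp (chartInvDeriv E x₀ y)) y :=
  hasMFDerivAt_iff_hasFDerivAt.1
    (HasMFDerivAt.comp y h (mdifferentiableAt_chart_symm x₀ hy).hasMFDerivAt)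

theorem hasMFDerivAt_of_hasFDerivAt_chart {G : M → ℝ} (x₀ : M) {x : M}
    (hx : x ∈ (extChartAt 𝓘(ℝ, E) x₀).source) {L : E →L[ℝ] ℝ}
    (h : HasFDerivAt (fun z => G ((extChartAt 𝓘(ℝ, E) x₀).symm z))
      (L.comp (chartInvDeriv E x₀ (extChartAt 𝓘(ℝ, E) x₀ x))) (extChartAt 𝓘(ℝ, E) x₀ x)) :
    HasMFDerivAt 𝓘(ℝ, E) 𝓘(ℝ, ℝ) G x L := by
  have h1 := HasMFDerivAt.comp x h.hasMFDerivAt (mdifferentiableAt_chart x₀ hx).hasMFDerivAt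
  have h2 : G =ᶠ[𝓝 x] (fun z => G ((extChartAt 𝓘(ℝ, E) x₀).symm z)) ∘ extChartAt 𝓘(ℝ, E) x₀ := by
    filter_upwards [extChartAt_source_mem_nhds' hx] with z hz
    simp only [Function.comp_apply, (extChartAt 𝓘(ℝ, E) x₀).left_inv hz]
  have h3 := h1.congr_of_eventuallyEq h2
  have h4 : (L.comp (chartInvDeriv E x₀ (extChartAt 𝓘(ℝ, E) x₀ x))).comp
      (chartDeriv E x₀ x) = L := by
    rw [ContinuousLinearMap.comp_assoc, chartInvDeriv_comp_chartDeriv x₀ hx]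
    rfl
  exact HasMFDerivAt.congr_mfderiv h3 h4

/-- A path of diffeomorphisms starting at the identity whose flux forms have potentials consists of
symplectic diffeomorphisms. -/
theorem IsFluxPotential.isSymplectic {Ω : SymplecticForm E M} {f : ℝ → Equiv.Perm M}
    {B : ℝ → M → ℝ} (hB : IsFluxPotential Ω f B) (hf : SmoothFamily E f)
    (hd : ∀ t, IsDiffeo E (f t)) (h0 : f 0 = 1) (t : ℝ) : IsSymplectic Ω (f t) := by
  intro x v w
  set c := extChartAt 𝓘(ℝ, E) x with hc
  set y := c x with hy_def
  have hxs : x ∈ c.source := mem_extChartAt_source x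
  have hy : y ∈ c.target := c.map_source hxs
  set U := (univ : Set ℝ) ×ˢ c.target with hU_def
  have hU : IsOpen U := isOpen_univ_prod_chart_target x
  have hu := hf.contMDiffOn_chartFamily x
  set om := Ω.pull (chartFamily E f x) with hom
  have homd : ∀ s, DifferentiableAt ℝ om (s, y) := fun s =>
    (Ω.contDiffAt_pull hU hu (p := (s, y)) ⟨mem_univ s, hy⟩).differentiableAt (by simp)
  set G : ℝ × E → ℝ := fun q => B q.1 (c.symm q.2) with hG
  have hGs : ContDiffOn ℝ ∞ G U := contDiffOn_chart_of_contMDiff hB.1 x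
  -- In coordinates the existence of a potential says that the mixed part of the pulled-back form is
  -- the space derivative of `G`.
  have hGo : ∀ q ∈ U, ∀ w : E, om q (1, 0) (0, w) = fderiv ℝ G q (0, w) := by
    rintro ⟨s, z⟩ hq w
    have h1 := (HasMFDerivAt.hasFDerivAt_chart x hq.2 (hB.2 s (c.symm z)))
    have h2 : HasFDerivAt G (fderiv ℝ G (s, z)) (s, z) :=
      ((hGs.contDiffAt (hU.mem_nhds hq)).differentiableAt (by simp)).hasFDerivAt
    have h3 := (h2.comp z (hasFDerivAt_prodMk_right s z)).unique h1
    have h4 := congrArg (fun L : E →L[ℝ] ℝ => L w) h3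
    exact (pull_chartFamily_time_space Ω hf x s (hd s) hq.2 w).trans h4.symm
  have key : ∀ s (v w : E), fderiv ℝ om (s, y) (0, v) (1, 0) (0, w) =
      fderiv ℝ (fderiv ℝ G) (s, y) (0, v) (0, w) := by
    intro s v w
    have hq : (s, y) ∈ U := ⟨mem_univ s, hy⟩
    have h1 : (fun q => om q (1, 0) (0, w)) =ᶠ[𝓝 (s, y)] fun q => fderiv ℝ G q (0, w) := by
      filter_upwards [hU.mem_nhds hq] with q hq
      exact hGo q hq w
    have h2 : HasFDerivAt (fun q => om q (1, 0) (0, w)) _ (s, y) :=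
      ((homd s).hasFDerivAt.clm_apply (hasFDerivAt_const ((1 : ℝ), (0 : E)) _)).clm_apply
        (hasFDerivAt_const ((0 : ℝ), w) _)
    have h3d : DifferentiableAt ℝ (fderiv ℝ G) (s, y) :=
      ((hGs.fderiv_of_isOpen hU (m := ∞) (by simp)).contDiffAt
        (hU.mem_nhds hq)).differentiableAt (by simp)
    have h3 : HasFDerivAt (fun q => fderiv ℝ G q (0, w)) _ (s, y) :=
      h3d.hasFDerivAt.clm_apply (hasFDerivAt_const ((0 : ℝ), w) _)
    have h4 := h2.unique (h3.congr_of_eventuallyEq h1)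
    have h5 := congrArg (fun L : ℝ × E →L[ℝ] ℝ => L (0, v)) h4
    simpa using h5
  have hder : ∀ s (v w : E), HasDerivAt (fun r => om (r, y) (0, v) (0, w)) 0 s := by
    intro s v w
    have hq : (s, y) ∈ U := ⟨mem_univ s, hy⟩
    have h1 := Ω.pull_closed hU hu hq (1, 0) (0, v) (0, w)
    have hsym : fderiv ℝ (fderiv ℝ G) (s, y) (0, v) (0, w) =
        fderiv ℝ (fderiv ℝ G) (s, y) (0, w) (0, v) :=
      ((hGs.contDiffAt (hU.mem_nhds hq)).isSymmSndFDerivAt (by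
        rw [minSmoothness_of_isRCLikeNormedField]; exact ENat.LEInfty.out)) _ _
    -- Cartan's formula in coordinates: closedness on `∂_s, v, w` equates the time derivative of the
    -- space-space part with a difference of two second derivatives of `G`, which cancel by
    -- symmetry.
    have h2 : fderiv ℝ om (s, y) (1, 0) (0, v) (0, w) = 0 := by
      have e1 := key s v w
      have e2 := key s w v
      rw [← hom] at h1
      linarith
    have h3 : HasFDerivAt (fun q => om q (0, v) (0, w)) _ (s, y) :=
      ((homd s).hasFDerivAt.clm_apply (hasFDerivAt_const ((0 : ℝ), v) _)).clm_apply
        (hasFDerivAt_const ((0 : ℝ), w) _)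
    have h4 := (h3.comp s (hasFDerivAt_prodMk_left s y)).hasDerivAt
    have h5 : ∀ z, z = (0 : ℝ) → HasDerivAt (fun r => om (r, y) (0, v) (0, w)) z s →
      HasDerivAt (fun r => om (r, y) (0, v) (0, w)) 0 s := by
      rintro z rfl h
      exact h
    refine h5 _ ?_ h4
    simpa using h2
  have hconst : ∀ v w : E, om (t, y) (0, v) (0, w) = om (0, y) (0, v) (0, w) := fun v w =>
    is_const_of_deriv_eq_zero (fun s => (hder s v w).differentiableAt)
      (fun s => (hder s v w).deriv) t 0
  -- Transfers the constancy in time from coordinate vectors to the given tangent vectors at `x`.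
  have hA : ∀ v : E, chartInvDeriv E x y (chartDeriv E x x v) = v := fun v =>
    congrArg (fun L : E →L[ℝ] E => L v) (chartInvDeriv_comp_chartDeriv x hxs)
  have h1 := hconst (chartDeriv E x x v) (chartDeriv E x x w)
  have hD : ∀ s, om (s, y) (0, chartDeriv E x x v) (0, chartDeriv E x x w) =
      Ω.bilin (f s (c.symm y)) (mfderiv 𝓘(ℝ, E) 𝓘(ℝ, E) (f s) (c.symm y) v)
        (mfderiv 𝓘(ℝ, E) 𝓘(ℝ, E) (f s) (c.symm y) w) := fun s =>
    (pull_chartFamily_space_space Ω hf x s (hd s) hy _ _).trans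
      (congrArg₂ (fun a b : E => (Ω.bilin (f s (c.symm y))
        (mfderiv 𝓘(ℝ, E) 𝓘(ℝ, E) (f s) (c.symm y) a)
        (mfderiv 𝓘(ℝ, E) 𝓘(ℝ, E) (f s) (c.symm y) b) : ℝ)) (hA v) (hA w))
  replace h1 := (hD t).symm.trans (h1.trans (hD 0))
  have hcx : c.symm y = x := c.left_inv hxs
  have h2 : ∀ z : M, z = x → ∀ s, (Ω.bilin (f s z) (mfderiv 𝓘(ℝ, E) 𝓘(ℝ, E) (f s) z v)
      (mfderiv 𝓘(ℝ, E) 𝓘(ℝ, E) (f s) z w) : ℝ) =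
      Ω.bilin (f s x) (mfderiv 𝓘(ℝ, E) 𝓘(ℝ, E) (f s) x v)
      (mfderiv 𝓘(ℝ, E) 𝓘(ℝ, E) (f s) x w) := by
    rintro z rfl s
    rfl
  refine ((h2 _ hcx t).symm.trans (h1.trans (h2 _ hcx 0))).trans ?_
  rw [h0]
  exact IsSymplectic.one x v w

end Coordinates

/-! ### Local primitives of the symplectic form -/

section RadialPrimitive

universe u

variable {E : Type u} [NormedAddCommGroup E] [NormedSpace ℝ E]

/-- The Poincaré lemma for closed 2-forms on a convex open subset of a vector space. -/
theorem exists_primitive_of_closed {om : E → E →L[ℝ] E →L[ℝ] ℝ} {O : Set E} (hO : IsOpen O)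
    (hconv : Convex ℝ O) (hs : ContDiffOn ℝ ∞ om O)
    (hclosed : ∀ y ∈ O, ∀ a v w,
      fderiv ℝ om y a v w - fderiv ℝ om y v a w + fderiv ℝ om y w a v = 0)
    (hanti : ∀ y v w, om y v w = - om y w v) :
    ∃ lam : E → E →L[ℝ] ℝ, ContDiffOn ℝ ∞ lam O ∧
      ∀ y ∈ O, ∀ v w, fderiv ℝ lam y v w - fderiv ℝ lam y w v = om y v w := by
  rcases O.eq_empty_or_nonempty with rfl | ⟨c, hc⟩
  · exact ⟨0, contDiffOn_empty, by simp⟩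
  set m : ℝ × E → E := fun q => c + q.1 • (q.2 - c) with hm
  have hms : ContDiff ℝ ∞ m := by fun_prop
  set U : Set (ℝ × E) := m ⁻¹' O with hU_def
  have hU : IsOpen U := hO.preimage hms.continuous
  have hOU : Icc 0 1 ×ˢ O ⊆ U := by
    rintro ⟨s, y⟩ ⟨hs, hy⟩
    have h := hconv.add_smul_sub_mem hc hy hs
    simpa [hU_def, hm] using h
  -- Integrand of the radial homotopy operator centred at `c`: the form at `c + s (y - c)` is
  -- contracted with `y - c` and weighted by `s`.
  set g : ℝ × E → E →L[ℝ] ℝ := fun q => q.1 • om (m q) (q.2 - c) with hg_def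
  have hg : ContDiffOn ℝ ∞ g U := by
    have h1 : ContDiffOn ℝ ∞ (fun q => om (m q)) U := hs.comp hms.contDiffOn (fun q hq => hq)
    have h2 : ContDiffOn ℝ ∞ (fun q : ℝ × E => q.2 - c) U := by fun_prop
    exact contDiffOn_fst.smul (h1.clm_apply h2)
  refine ⟨fun y => ∫ s in (0 : ℝ)..1, g (s, y), contDiffOn_parametric_integral hO hU hOU hg, ?_⟩
  intro y hy v w
  have homd : ∀ s ∈ Icc (0 : ℝ) 1, HasFDerivAt om (fderiv ℝ om (m (s, y))) (m (s, y)) :=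
    fun s h => ((hs.contDiffAt (hO.mem_nhds (hOU ⟨h, hy⟩))).differentiableAt
      (by simp)).hasFDerivAt
  have hgd : ∀ s ∈ Icc (0 : ℝ) 1, ∀ v w, fderiv ℝ g (s, y) (0, v) w =
      s ^ 2 * fderiv ℝ om (m (s, y)) v (y - c) w + s * om (m (s, y)) v w := by
    intro s h v w
    have h1 : HasFDerivAt (fun z => m (s, z)) (s • ContinuousLinearMap.id ℝ E) y :=
      (((hasFDerivAt_id y).sub_const c).const_smul s).const_add c
    have h2 : HasFDerivAt (fun z => z - c) (ContinuousLinearMap.id ℝ E) y :=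
      (hasFDerivAt_id y).sub_const c
    have h3 := ((HasFDerivAt.comp (g := om) y (homd s h) h1).clm_apply h2).const_smul s
    have h4 := ((((hg.contDiffAt (hU.mem_nhds (hOU ⟨h, hy⟩))).differentiableAt
      (by simp)).hasFDerivAt).comp y (hasFDerivAt_prodMk_right s y)).unique h3
    have h5 := congrArg (fun L : E →L[ℝ] E →L[ℝ] ℝ => L v w) h4
    simp at h5
    rw [h5, map_sub, sub_apply]
    ring
  have hcont : ∀ v, ContinuousOn (fun s => fderiv ℝ g (s, y) (0, v)) (Icc 0 1) := fun v =>
    ((hg.continuousOn_fderiv_of_isOpen hU (by simp)).comp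
      (f := fun s : ℝ => (s, y)) (s := Icc 0 1) (by fun_prop)
        (fun s h => hOU ⟨h, hy⟩)).clm_apply continuousOn_const
  have hap : ∀ v w, fderiv ℝ (fun y => ∫ s in (0 : ℝ)..1, g (s, y)) y v w =
      ∫ s in (0 : ℝ)..1, fderiv ℝ g (s, y) (0, v) w := by
    intro v w
    rw [fderiv_parametric_integral_apply hO hU hOU (hg.of_le ENat.LEInfty.out) hy,
      ContinuousLinearMap.intervalIntegral_apply
        (ContinuousOn.intervalIntegrable_of_Icc zero_le_one (hcont v))]
  have hint2 : ∀ v w, IntervalIntegrable (fun s => fderiv ℝ g (s, y) (0, v) w) volume 0 1 :=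
    fun v w => ContinuousOn.intervalIntegrable_of_Icc zero_le_one
      ((hcont v).clm_apply (g := fun _ => w) continuousOn_const)
  rw [hap, hap, ← intervalIntegral.integral_sub (hint2 v w) (hint2 w v)]
  -- Closedness on `y - c, v, w` makes the antisymmetrised derivative of the integrand a total
  -- derivative in `s`; its primitive takes the values `0` at `0` and `om y v w` at `1`.
  have hF : ∀ s ∈ Icc (0 : ℝ) 1, HasDerivAt (fun s => s ^ 2 * om (m (s, y)) v w)
      (fderiv ℝ g (s, y) (0, v) w - fderiv ℝ g (s, y) (0, w) v) s := by
    intro s h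
    have h1 : HasDerivAt (fun s => m (s, y)) (y - c) s := by
      simpa [hm] using ((hasDerivAt_id s).smul_const (y - c)).const_add c
    have h2 := HasFDerivAt.comp_hasDerivAt (l := om) s (homd s h) h1
    have h3 := ((h2.clm_apply (hasDerivAt_const s v)).clm_apply (hasDerivAt_const s w))
    have h4 := (hasDerivAt_pow 2 s).mul h3
    refine h4.congr_deriv ?_
    rw [hgd s h, hgd s h]
    have h5 := hclosed (m (s, y)) (hOU ⟨h, hy⟩) (y - c) v w
    have h6 := hanti (m (s, y)) w v
    simp only [map_sub, sub_apply] at h5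
    simp
    rw [h6]
    linear_combination (s ^ 2) * h5
  have hFTC := intervalIntegral.integral_eq_sub_of_hasDerivAt (a := (0 : ℝ)) (b := 1)
    (fun s h => hF s (by rwa [uIcc_of_le zero_le_one] at h)) ((hint2 v w).sub (hint2 w v))
  rw [hFTC]
  simp [hm]

end RadialPrimitive

/-! ### Primitives of the symplectic form in charts, integrated along closed trajectories -/

section ChartPrimitive

variable {E : Type} [NormedAddCommGroup E] [NormedSpace ℝ E]
  {M : Type*} [TopologicalSpace M] [ChartedSpace E M]
  {P : Type} [NormedAddCommGroup P] [NormedSpace ℝ P]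
  {Q : Type} [NormedAddCommGroup Q] [NormedSpace ℝ Q]

/-- The preimage of a ball under the chart at `x₀`. -/
def chartBall (E : Type*) [NormedAddCommGroup E] [NormedSpace ℝ E]
    {M : Type*} [TopologicalSpace M] [ChartedSpace E M] (x₀ : M) (r : ℝ) : Set M :=
  (extChartAt 𝓘(ℝ, E) x₀).source ∩
    extChartAt 𝓘(ℝ, E) x₀ ⁻¹' Metric.ball (extChartAt 𝓘(ℝ, E) x₀ x₀) r

theorem isOpen_chartBall (x₀ : M) (r : ℝ) : IsOpen (chartBall E x₀ r) :=
  isOpen_extChartAt_preimage' x₀ Metric.isOpen_ball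

theorem mem_chartBall_self (x₀ : M) {r : ℝ} (hr : 0 < r) : x₀ ∈ chartBall E x₀ r :=
  ⟨mem_extChartAt_source x₀, Metric.mem_ball_self hr⟩

theorem exists_chartBall_subset (x₀ : M) {O : Set M} (hO : O ∈ 𝓝 x₀) :
    ∃ r > 0, Metric.ball (extChartAt 𝓘(ℝ, E) x₀ x₀) r ⊆ (extChartAt 𝓘(ℝ, E) x₀).target ∧
      chartBall E x₀ r ⊆ O := by
  have h1 : (extChartAt 𝓘(ℝ, E) x₀).symm ⁻¹' O ∈ 𝓝 (extChartAt 𝓘(ℝ, E) x₀ x₀) := by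
    refine (continuousAt_extChartAt_symm x₀).preimage_mem_nhds ?_
    rwa [extChartAt_to_inv x₀]
  obtain ⟨r, hr, h⟩ := Metric.mem_nhds_iff.1 (inter_mem (extChartAt_target_mem_nhds x₀) h1)
  refine ⟨r, hr, fun y hy => (h hy).1, fun x hx => ?_⟩
  have h2 := (h hx.2).2
  rwa [mem_preimage, (extChartAt 𝓘(ℝ, E) x₀).left_inv hx.1] at h2

/-- A 1-form on a ball in the chart at `x₀` whose exterior derivative is the symplectic form. -/
structure IsChartPrimitive (Ω : SymplecticForm E M) (x₀ : M) (r : ℝ) (lam : E → E →L[ℝ] ℝ) :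
    Prop where
  subset : Metric.ball (extChartAt 𝓘(ℝ, E) x₀ x₀) r ⊆ (extChartAt 𝓘(ℝ, E) x₀).target
  smooth : ContDiffOn ℝ ∞ lam (Metric.ball (extChartAt 𝓘(ℝ, E) x₀ x₀) r)
  deriv : ∀ y ∈ Metric.ball (extChartAt 𝓘(ℝ, E) x₀ x₀) r, ∀ v w,
    fderiv ℝ lam y v w - fderiv ℝ lam y w v = Ω.pull (extChartAt 𝓘(ℝ, E) x₀).symm y v w

/-- The pullback of a 1-form given in the chart at `x₀`. -/
def pullOne (lam : E → E →L[ℝ] ℝ) (x₀ : M) (u : P → M) (p : P) : P →L[ℝ] ℝ :=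
  (lam (extChartAt 𝓘(ℝ, E) x₀ (u p))).comp
    (fderiv ℝ (fun q => extChartAt 𝓘(ℝ, E) x₀ (u q)) p)

variable [IsManifold 𝓘(ℝ, E) ∞ M] {Ω : SymplecticForm E M}

theorem exists_isChartPrimitive (Ω : SymplecticForm E M) (x₀ : M) {r : ℝ}
    (h : Metric.ball (extChartAt 𝓘(ℝ, E) x₀ x₀) r ⊆ (extChartAt 𝓘(ℝ, E) x₀).target) :
    ∃ lam, IsChartPrimitive Ω x₀ r lam := by
  have h1 : ContMDiffOn 𝓘(ℝ, E) 𝓘(ℝ, E) ∞ (extChartAt 𝓘(ℝ, E) x₀).symm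
    (Metric.ball (extChartAt 𝓘(ℝ, E) x₀ x₀) r) := (contMDiffOn_extChartAt_symm x₀).mono h
  obtain ⟨lam, hl, hd⟩ := exists_primitive_of_closed Metric.isOpen_ball (convex_ball _ r)
    (Ω.contDiffOn_pull Metric.isOpen_ball h1)
    (fun y hy a v w => Ω.pull_closed Metric.isOpen_ball h1 hy a v w)
    (fun y v w => Ω.pull_neg _ y v w)
  exact ⟨lam, h, hl, hd⟩

omit [IsManifold 𝓘(ℝ, E) ∞ M] in
theorem pullOne_congr {lam : E → E →L[ℝ] ℝ} {x₀ : M} {u u' : P → M} {p : P} (h : u =ᶠ[𝓝 p] u') :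
    pullOne lam x₀ u p = pullOne lam x₀ u' p := by
  have h1 : (fun q => extChartAt 𝓘(ℝ, E) x₀ (u q)) =ᶠ[𝓝 p]
    fun q => extChartAt 𝓘(ℝ, E) x₀ (u' q) := h.fun_comp _
  unfold pullOne
  rw [h1.fderiv_eq, h.self_of_nhds]

theorem pullOne_comp {lam : E → E →L[ℝ] ℝ} {x₀ : M} {u : P → M} {O : Set P} (hO : IsOpen O)
    (hu : ContMDiffOn 𝓘(ℝ, P) 𝓘(ℝ, E) ∞ u O) {g : Q → P} {q : Q} (hg : DifferentiableAt ℝ g q)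
    (hq : g q ∈ O) (hx : u (g q) ∈ (extChartAt 𝓘(ℝ, E) x₀).source) :
    pullOne lam x₀ (fun r => u (g r)) q = (pullOne lam x₀ u (g q)).comp (fderiv ℝ g q) := by
  have h1 := (SymplecticForm.contDiffAt_coord hO hu x₀ hq hx).differentiableAt (by simp)
  have h2 := (h1.hasFDerivAt.comp q hg.hasFDerivAt).fderiv
  unfold pullOne
  rw [ContinuousLinearMap.comp_assoc]
  exact congrArg _ h2

theorem IsChartPrimitive.contDiffOn_pullOne {x₀ : M} {r : ℝ} {lam : E → E →L[ℝ] ℝ}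
    (h : IsChartPrimitive Ω x₀ r lam) {u : P → M} {O : Set P} (hO : IsOpen O)
    (hu : ContMDiffOn 𝓘(ℝ, P) 𝓘(ℝ, E) ∞ u O) (hm : MapsTo u O (chartBall E x₀ r)) :
    ContDiffOn ℝ ∞ (pullOne lam x₀ u) O := by
  have h1 : ContDiffOn ℝ ∞ (fun q => extChartAt 𝓘(ℝ, E) x₀ (u q)) O := fun p hp =>
    (SymplecticForm.contDiffAt_coord hO hu x₀ hp (hm hp).1).contDiffWithinAt
  exact (ContDiffOn.comp (g := lam) h.smooth h1 fun p hp => (hm hp).2).clm_comp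
    (h1.fderiv_of_isOpen hO (by simp))

/-- The exterior derivative commutes with pullback: the terms with the second derivative of the
coordinate map cancel by symmetry. -/
theorem IsChartPrimitive.fderiv_pullOne {x₀ : M} {r : ℝ} {lam : E → E →L[ℝ] ℝ}
    (h : IsChartPrimitive Ω x₀ r lam) {u : P → M} {O : Set P} (hO : IsOpen O)
    (hu : ContMDiffOn 𝓘(ℝ, P) 𝓘(ℝ, E) ∞ u O) (hm : MapsTo u O (chartBall E x₀ r)) {p : P}
    (hp : p ∈ O) (v w : P) :
    fderiv ℝ (pullOne lam x₀ u) p v w - fderiv ℝ (pullOne lam x₀ u) p w v = Ω.pull u p v w := by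
  set g : P → E := fun q => extChartAt 𝓘(ℝ, E) x₀ (u q) with hg
  have h1 : ContDiffAt ℝ ∞ g p := SymplecticForm.contDiffAt_coord hO hu x₀ hp (hm hp).1
  have h2 : HasFDerivAt g (fderiv ℝ g p) p := (h1.differentiableAt (by simp)).hasFDerivAt
  have h3 : HasFDerivAt (fderiv ℝ g) (fderiv ℝ (fderiv ℝ g) p) p :=
    ((h1.fderiv_right (m := ∞) (by simp)).differentiableAt (by simp)).hasFDerivAt
  have h4 : HasFDerivAt lam (fderiv ℝ lam (g p)) (g p) :=
    ((h.smooth.contDiffAt (Metric.isOpen_ball.mem_nhds (hm hp).2)).differentiableAt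
      (by simp)).hasFDerivAt
  have h5 : ∀ v w, fderiv ℝ (pullOne lam x₀ u) p v w =
      lam (g p) (fderiv ℝ (fderiv ℝ g) p v w) + fderiv ℝ lam (g p) (fderiv ℝ g p v)
        (fderiv ℝ g p w) := by
    intro v w
    have e1 : HasFDerivAt (pullOne lam x₀ u) _ p :=
      (HasFDerivAt.comp (g := lam) p h4 h2).clm_comp h3
    rw [e1.fderiv]
    simp [g]
  have h6 : fderiv ℝ (fderiv ℝ g) p v w = fderiv ℝ (fderiv ℝ g) p w v :=
    (h1.isSymmSndFDerivAt (by
      rw [minSmoothness_of_isRCLikeNormedField]; exact ENat.LEInfty.out)) _ _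
  have h7 := h.deriv (g p) (hm hp).2 (fderiv ℝ g p v) (fderiv ℝ g p w)
  have h8 : Ω.pull u p v w = Ω.pull (extChartAt 𝓘(ℝ, E) x₀).symm (g p) (fderiv ℝ g p v)
      (fderiv ℝ g p w) := by
    have e1 := Ω.pullForm_eq_chart hO hu x₀ hp (hm hp).1
    have e2 : Ω.pull u p v w = Ω.pullForm u p ![v, w] := altToBilin_apply _ _ _
    have e3 : Ω.pull (extChartAt 𝓘(ℝ, E) x₀).symm (g p) (fderiv ℝ g p v) (fderiv ℝ g p w) =
      Ω.pullForm (extChartAt 𝓘(ℝ, E) x₀).symm (g p) ![fderiv ℝ g p v, fderiv ℝ g p w] :=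
      altToBilin_apply _ _ _
    rw [e2, e3, e1]
    refine congrArg (chartForm Ω.form x₀ (g p)) ?_
    funext i
    fin_cases i <;> rfl
  rw [h5, h5, h6, h8]
  linarith

/-- The integral over `[0, 1]` of a 1-form given in the chart at `x₀` along a path. -/
def chartPathIntegral (lam : E → E →L[ℝ] ℝ) (x₀ : M) (l : ℝ → M) : ℝ :=
  ∫ s in (0 : ℝ)..1, pullOne lam x₀ l s 1

/-- The integrals of two primitives of the symplectic form along a closed path contained in a
small chart ball are equal. -/
theorem chartPathIntegral_eq {a a' b : M} {r r' δ : ℝ} {lam lam' : E → E →L[ℝ] ℝ}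
    (h : IsChartPrimitive Ω a r lam) (h' : IsChartPrimitive Ω a' r' lam')
    (hb : Metric.ball (extChartAt 𝓘(ℝ, E) b b) δ ⊆ (extChartAt 𝓘(ℝ, E) b).target)
    (hs : chartBall E b δ ⊆ chartBall E a r) (hs' : chartBall E b δ ⊆ chartBall E a' r')
    {l : ℝ → M} (hl : ContMDiff 𝓘(ℝ, ℝ) 𝓘(ℝ, E) ∞ l) (h01 : l 0 = l 1)
    (hlb : ∀ s ∈ Icc (0 : ℝ) 1, l s ∈ chartBall E b δ) :
    chartPathIntegral lam a l = chartPathIntegral lam' a' l := by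
  set c := extChartAt 𝓘(ℝ, E) b with hc
  set O := Metric.ball (c b) δ with hO_def
  have hO : IsOpen O := Metric.isOpen_ball
  have hu : ContMDiffOn 𝓘(ℝ, E) 𝓘(ℝ, E) ∞ c.symm O := (contMDiffOn_extChartAt_symm b).mono hb
  have hmb : MapsTo c.symm O (chartBall E b δ) := fun y hy =>
    ⟨c.map_target (hb hy), by
      change c (c.symm y) ∈ Metric.ball (c b) δ
      rw [c.right_inv (hb hy)]
      exact hy⟩
  have hma : MapsTo c.symm O (chartBall E a r) := fun y hy => hs (hmb hy)
  have hma' : MapsTo c.symm O (chartBall E a' r') := fun y hy => hs' (hmb hy)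
  have hd : ContDiffOn ℝ ∞ (pullOne lam a c.symm) O := h.contDiffOn_pullOne hO hu hma
  have hd' : ContDiffOn ℝ ∞ (pullOne lam' a' c.symm) O := h'.contDiffOn_pullOne hO hu hma'
  have hdd : ∀ y ∈ O, DifferentiableAt ℝ (pullOne lam a c.symm) y := fun y hy =>
    (hd.contDiffAt (hO.mem_nhds hy)).differentiableAt (by simp)
  have hdd' : ∀ y ∈ O, DifferentiableAt ℝ (pullOne lam' a' c.symm) y := fun y hy =>
    (hd'.contDiffAt (hO.mem_nhds hy)).differentiableAt (by simp)
  have hsub : DifferentiableOn ℝ (fun y => pullOne lam a c.symm y - pullOne lam' a' c.symm y) O :=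
    fun y hy => ((hdd y hy).sub (hdd' y hy)).differentiableWithinAt
  -- Both primitives have exterior derivative `Ω`, so their difference is closed and, on a ball of
  -- the chart at `b`, equal to some `dφ`. Its integral over a closed path is zero.
  obtain ⟨φ, hφ⟩ := (convex_ball (c b) δ).exists_forall_hasFDerivAt_of_fderiv_symmetric hO
    hsub (by
      intro y hy v w
      have e1 := h.fderiv_pullOne hO hu hma hy v w
      have e2 := h'.fderiv_pullOne hO hu hma' hy v w
      have e3 : fderiv ℝ (fun y => pullOne lam a c.symm y - pullOne lam' a' c.symm y) y =
        fderiv ℝ (pullOne lam a c.symm) y - fderiv ℝ (pullOne lam' a' c.symm) y :=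
        fderiv_sub (hdd y hy) (hdd' y hy)
      rw [e3]
      simp only [sub_apply]
      linarith)
  set m : ℝ → E := fun s => c (l s) with hm
  have hmO : ∀ s ∈ Icc (0 : ℝ) 1, m s ∈ O := fun s hs => (hlb s hs).2
  have hmd : ∀ s ∈ Icc (0 : ℝ) 1, ContDiffAt ℝ ∞ m s := fun s hs =>
    SymplecticForm.contDiffAt_coord isOpen_univ hl.contMDiffOn b (mem_univ s) (hlb s hs).1
  have hev : ∀ s ∈ Icc (0 : ℝ) 1, l =ᶠ[𝓝 s] fun r => c.symm (m r) := fun s hs => by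
    filter_upwards [hl.continuous.continuousAt.eventually (extChartAt_source_mem_nhds'
      (I := 𝓘(ℝ, E)) (hlb s hs).1)] with z hz
    exact (c.left_inv hz).symm
  have hcs : ∀ s ∈ Icc (0 : ℝ) 1, c.symm (m s) = l s := fun s hs => c.left_inv (hlb s hs).1
  have e1 : ∀ s ∈ Icc (0 : ℝ) 1, pullOne lam a l s 1 =
      pullOne lam a c.symm (m s) (fderiv ℝ m s 1) := fun s hs1 => by
    rw [pullOne_congr (hev s hs1), pullOne_comp hO hu ((hmd s hs1).differentiableAt (by simp))
      (hmO s hs1) (hs (hmb (hmO s hs1))).1]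
    rfl
  have e2 : ∀ s ∈ Icc (0 : ℝ) 1, pullOne lam' a' l s 1 =
      pullOne lam' a' c.symm (m s) (fderiv ℝ m s 1) := fun s hs1 => by
    rw [pullOne_congr (hev s hs1), pullOne_comp hO hu ((hmd s hs1).differentiableAt (by simp))
      (hmO s hs1) (hs' (hmb (hmO s hs1))).1]
    rfl
  have hmc : ContinuousOn m (Icc 0 1) := fun s hs =>
    (hmd s hs).continuousAt.continuousWithinAt
  have hmdc : ContinuousOn (fun s => fderiv ℝ m s 1) (Icc 0 1) := fun s hs =>
    ((((hmd s hs).fderiv_right (m := ∞) (by simp)).continuousAt).clm_apply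
      continuousAt_const).continuousWithinAt
  have c1 : ContinuousOn (fun s => pullOne lam a c.symm (m s) (fderiv ℝ m s 1)) (Icc 0 1) :=
    (hd.continuousOn.comp hmc hmO).clm_apply hmdc
  have c2 : ContinuousOn (fun s => pullOne lam' a' c.symm (m s) (fderiv ℝ m s 1)) (Icc 0 1) :=
    (hd'.continuousOn.comp hmc hmO).clm_apply hmdc
  have i1 := ContinuousOn.intervalIntegrable_of_Icc (μ := volume) zero_le_one c1
  have i2 := ContinuousOn.intervalIntegrable_of_Icc (μ := volume) zero_le_one c2
  unfold chartPathIntegral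
  rw [intervalIntegral.integral_congr (g := fun s => pullOne lam a c.symm (m s) (fderiv ℝ m s 1))
    (fun s hs => e1 s (by rwa [uIcc_of_le zero_le_one] at hs)),
    intervalIntegral.integral_congr
      (g := fun s => pullOne lam' a' c.symm (m s) (fderiv ℝ m s 1))
      (f := fun s => pullOne lam' a' l s 1)
    (fun s hs => e2 s (by rwa [uIcc_of_le zero_le_one] at hs)), ← sub_eq_zero,
    ← intervalIntegral.integral_sub i1 i2]
  have hF : ∀ s ∈ uIcc (0 : ℝ) 1, HasDerivAt (fun s => φ (m s))
      (pullOne lam a c.symm (m s) (fderiv ℝ m s 1) -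
        pullOne lam' a' c.symm (m s) (fderiv ℝ m s 1)) s := by
    intro s hs
    rw [uIcc_of_le zero_le_one] at hs
    have e3 : HasDerivAt m (fderiv ℝ m s 1) s :=
      ((hmd s hs).differentiableAt (by simp)).hasFDerivAt.hasDerivAt
    exact (hφ (m s) (hmO s hs)).comp_hasDerivAt s e3
  rw [intervalIntegral.integral_eq_sub_of_hasDerivAt hF (i1.sub i2)]
  simp [hm, h01]

/-- The derivative of the integral of a primitive along the trajectories of a loop of
diffeomorphisms. -/
theorem hasFDerivAt_chartPathIntegral {p : ℝ → Equiv.Perm M} (hp : SmoothFamily E p)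
    (h01 : p 0 = p 1) {a : M} {r : ℝ} {lam : E → E →L[ℝ] ℝ}
    (h : IsChartPrimitive Ω a r lam) (x₀ : M) {O : Set E} (hO : IsOpen O)
    (hOt : O ⊆ (extChartAt 𝓘(ℝ, E) x₀).target)
    (hmaps : ∀ s ∈ Icc (0 : ℝ) 1, ∀ y ∈ O, p s ((extChartAt 𝓘(ℝ, E) x₀).symm y) ∈ chartBall E a r)
    {y : E} (hy : y ∈ O) :
    HasFDerivAt (fun z => chartPathIntegral lam a
      (fun s => p s ((extChartAt 𝓘(ℝ, E) x₀).symm z)))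
      (- ∫ s in (0 : ℝ)..1, chartFlux Ω p x₀ (s, y)) y := by
  set u := chartFamily E p x₀ with hu_def
  set D := (univ : Set ℝ) ×ˢ (extChartAt 𝓘(ℝ, E) x₀).target with hD_def
  have hD : IsOpen D := isOpen_univ_prod_chart_target x₀
  have huD : ContMDiffOn 𝓘(ℝ, ℝ × E) 𝓘(ℝ, E) ∞ u D := hp.contMDiffOn_chartFamily x₀
  set U := D ∩ u ⁻¹' chartBall E a r with hU_def
  have hU : IsOpen U := huD.continuousOn.isOpen_inter_preimage hD (isOpen_chartBall a r)
  have hu : ContMDiffOn 𝓘(ℝ, ℝ × E) 𝓘(ℝ, E) ∞ u U := huD.mono inter_subset_left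
  have hm : MapsTo u U (chartBall E a r) := fun q hq => hq.2
  have hOU : Icc (0 : ℝ) 1 ×ˢ O ⊆ U := by
    rintro ⟨s, z⟩ ⟨hs, hz⟩
    exact ⟨⟨mem_univ _, hOt hz⟩, hmaps s hs z hz⟩
  set η : ℝ × E → ℝ × E →L[ℝ] ℝ := pullOne lam a u with hη_def
  have hη : ContDiffOn ℝ ∞ η U := h.contDiffOn_pullOne hU hu hm
  set g : ℝ × E → ℝ := fun q => η q (1, 0) with hg_def
  have hg : ContDiffOn ℝ ∞ g U := hη.clm_apply contDiffOn_const
  have hA : ∀ z ∈ O, chartPathIntegral lam a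
      (fun s => p s ((extChartAt 𝓘(ℝ, E) x₀).symm z)) = ∫ s in (0 : ℝ)..1, g (s, z) := by
    intro z hz
    refine intervalIntegral.integral_congr fun s hs => ?_
    rw [uIcc_of_le zero_le_one] at hs
    have h1 : HasFDerivAt (fun r : ℝ => (r, z)) (ContinuousLinearMap.inl ℝ ℝ E) s :=
      hasFDerivAt_prodMk_left s z
    have h2 := pullOne_comp (lam := lam) (x₀ := a) hU hu h1.differentiableAt (hOU ⟨hs, hz⟩)
      (hm (hOU ⟨hs, hz⟩)).1
    rw [h1.fderiv] at h2
    exact congrArg (fun L : ℝ →L[ℝ] ℝ => L 1) h2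
  have hd := hasFDerivAt_parametric_integral hO hU hOU (hg.of_le ENat.LEInfty.out) hy
  have hηd : ∀ s ∈ Icc (0 : ℝ) 1, HasFDerivAt η (fderiv ℝ η (s, y)) (s, y) := fun s hs =>
    ((hη.contDiffAt (hU.mem_nhds (hOU ⟨hs, hy⟩))).differentiableAt (by simp)).hasFDerivAt
  -- The exterior derivative of the pulled-back primitive `η` on `∂_s` and `w` is the flux, so the
  -- space derivative of `η(∂_s)` is the time derivative of `η(w)` minus the flux.
  have hgd : ∀ s ∈ Icc (0 : ℝ) 1, ∀ w, fderiv ℝ g (s, y) (0, w) =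
      fderiv ℝ η (s, y) (1, 0) (0, w) - chartFlux Ω p x₀ (s, y) w := by
    intro s hs w
    have e1 := ((hηd s hs).clm_apply (hasFDerivAt_const ((1 : ℝ), (0 : E)) (s, y))).fderiv
    have e2 := congrArg (fun L : ℝ × E →L[ℝ] ℝ => L (0, w)) e1
    have e3 := h.fderiv_pullOne hU hu hm (p := (s, y)) (hOU ⟨hs, hy⟩) (1, 0) (0, w)
    have e4 : fderiv ℝ g (s, y) (0, w) = fderiv ℝ η (s, y) (0, w) (1, 0) := by
      simpa [hg_def] using e2
    have e5 : chartFlux Ω p x₀ (s, y) w = Ω.pull u (s, y) (1, 0) (0, w) := rfl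
    rw [e4, e5, ← e3]
    ring
  have hηt : ∀ w, ContinuousOn (fun s => fderiv ℝ η (s, y) (1, 0) (0, w)) (Icc 0 1) := fun w =>
    (((hη.continuousOn_fderiv_of_isOpen hU (by simp)).comp
      (f := fun s : ℝ => (s, y)) (s := Icc 0 1) (by fun_prop)
        (fun s h => hOU (show (s, y) ∈ Icc (0 : ℝ) 1 ×ˢ O from ⟨h, hy⟩))).clm_apply (g := fun _ => ((1 : ℝ), (0 : E)))
          continuousOn_const).clm_apply (g := fun _ => ((0 : ℝ), w)) continuousOn_const
  have hθ : Continuous (fun s => chartFlux Ω p x₀ (s, y)) :=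
    continuous_iff_continuousAt.2 fun s => ContinuousAt.comp (f := fun s : ℝ => (s, y)) (x := s)
      ((contDiffOn_chartFlux Ω hp x₀).continuousOn.continuousAt
        (hD.mem_nhds ⟨mem_univ s, hOt hy⟩)) (by fun_prop)
  -- The time derivative integrates to a boundary term, which vanishes because `p 0 = p 1`.
  have hends : ∀ w, η (1, y) (0, w) = η (0, y) (0, w) := by
    intro w
    have e1 : ∀ s ∈ Icc (0 : ℝ) 1, η (s, y) (0, w) =
        pullOne lam a (fun z => p s ((extChartAt 𝓘(ℝ, E) x₀).symm z)) y w := by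
      intro s hs
      have h1 : HasFDerivAt (fun z : E => (s, z)) (ContinuousLinearMap.inr ℝ ℝ E) y :=
        hasFDerivAt_prodMk_right s y
      have h2 := pullOne_comp (lam := lam) (x₀ := a) hU hu h1.differentiableAt (hOU ⟨hs, hy⟩)
        (hm (hOU ⟨hs, hy⟩)).1
      rw [h1.fderiv] at h2
      exact (congrArg (fun L : E →L[ℝ] ℝ => L w) h2).symm
    rw [e1 1 (by simp), e1 0 (by simp), h01]
  have hFTC : ∀ w, ∫ s in (0 : ℝ)..1, fderiv ℝ η (s, y) (1, 0) (0, w) = 0 := by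
    intro w
    have hF : ∀ s ∈ uIcc (0 : ℝ) 1, HasDerivAt (fun s => η (s, y) (0, w))
        (fderiv ℝ η (s, y) (1, 0) (0, w)) s := by
      intro s hs
      rw [uIcc_of_le zero_le_one] at hs
      have e1 := HasFDerivAt.comp (g := fun q => η q (0, w)) (f := fun r : ℝ => (r, y)) s
        ((hηd s hs).clm_apply (hasFDerivAt_const ((0 : ℝ), w) (s, y)))
        (hasFDerivAt_prodMk_left s y)
      refine e1.hasDerivAt.congr_deriv ?_
      simp
    rw [intervalIntegral.integral_eq_sub_of_hasDerivAt hF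
      (ContinuousOn.intervalIntegrable_of_Icc zero_le_one (hηt w)), hends, sub_self]
  have hfin : (∫ s in (0 : ℝ)..1, (fderiv ℝ g (s, y)).comp (ContinuousLinearMap.inr ℝ ℝ E)) =
      - ∫ s in (0 : ℝ)..1, chartFlux Ω p x₀ (s, y) := by
    ext w
    rw [← hd.fderiv, fderiv_parametric_integral_apply hO hU hOU (hg.of_le ENat.LEInfty.out) hy,
      neg_apply, ContinuousLinearMap.intervalIntegral_apply (hθ.intervalIntegrable _ _),
      intervalIntegral.integral_congr (g := fun s => fderiv ℝ η (s, y) (1, 0) (0, w) -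
        chartFlux Ω p x₀ (s, y) w) (fun s hs => hgd s (by rwa [uIcc_of_le zero_le_one] at hs) w),
      intervalIntegral.integral_sub
        (ContinuousOn.intervalIntegrable_of_Icc zero_le_one (hηt w))
        ((hθ.clm_apply continuous_const).intervalIntegrable _ _), hFTC, zero_sub]
  rw [hfin] at hd
  exact hd.congr_of_eventuallyEq (by
    filter_upwards [hO.mem_nhds hy] with z hz
    exact hA z hz)

end ChartPrimitive

/-! ### Exactness of the flux of loops close to the identity -/

section SmallLoops

variable {E : Type} [NormedAddCommGroup E] [NormedSpace ℝ E]
  {M : Type*} [TopologicalSpace M] [ChartedSpace E M] [IsManifold 𝓘(ℝ, E) ∞ M]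
  {Ω : SymplecticForm E M} {p : ℝ → Equiv.Perm M}

/-- The flux form as a linear form on the model space. -/
def fluxModel (Ω : SymplecticForm E M) (p : ℝ → Equiv.Perm M) (s : ℝ) (x : M) : E →L[ℝ] ℝ :=
  fluxForm Ω p s x

/-- The function `A` is a potential of the 1-form `θ`. -/
def IsPotential (A : M → ℝ) (θ : M → E →L[ℝ] ℝ) : Prop :=
  ∀ x, HasMFDerivAt 𝓘(ℝ, E) 𝓘(ℝ, ℝ) A x (θ x)

theorem chartFlux_eq_fluxModel (hp : SmoothFamily E p) (x₀ : M) (s : ℝ)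
    (hd : IsDiffeo E (p s)) {y : E} (hy : y ∈ (extChartAt 𝓘(ℝ, E) x₀).target) :
    chartFlux Ω p x₀ (s, y) =
      (fluxModel Ω p s ((extChartAt 𝓘(ℝ, E) x₀).symm y)).comp (chartInvDeriv E x₀ y) :=
  chartFlux_eq Ω hp x₀ s hd hy

theorem fluxModel_eq_chartFlux (hp : SmoothFamily E p) (hd : ∀ s, IsDiffeo E (p s)) (x₀ : M) {x : M}
    (hx : x ∈ (extChartAt 𝓘(ℝ, E) x₀).source) (s : ℝ) :
    fluxModel Ω p s x =
      (chartFlux Ω p x₀ (s, extChartAt 𝓘(ℝ, E) x₀ x)).comp (chartDeriv E x₀ x) := by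
  rw [chartFlux_eq_fluxModel hp x₀ s (hd s) ((extChartAt 𝓘(ℝ, E) x₀).map_source hx),
    ContinuousLinearMap.comp_assoc, chartInvDeriv_comp_chartDeriv x₀ hx,
    (extChartAt 𝓘(ℝ, E) x₀).left_inv hx, ContinuousLinearMap.comp_id]

theorem continuous_chartFlux (hp : SmoothFamily E p) (x₀ : M) {y : E}
    (hy : y ∈ (extChartAt 𝓘(ℝ, E) x₀).target) :
    Continuous (fun s => chartFlux Ω p x₀ (s, y)) :=
  continuous_iff_continuousAt.2 fun s => ContinuousAt.comp (f := fun s : ℝ => (s, y)) (x := s)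
    ((contDiffOn_chartFlux Ω hp x₀).continuousOn.continuousAt
      ((isOpen_univ_prod_chart_target x₀).mem_nhds ⟨mem_univ s, hy⟩)) (by fun_prop)

theorem continuous_fluxModel (hp : SmoothFamily E p) (hd : ∀ s, IsDiffeo E (p s)) (x : M) :
    Continuous (fun s => fluxModel Ω p s x) := by
  rw [funext fun s => fluxModel_eq_chartFlux (Ω := Ω) hp hd x (mem_extChartAt_source x) s]
  exact (continuous_chartFlux hp x (mem_extChartAt_target x)).clm_comp continuous_const

theorem integral_chartFlux (hp : SmoothFamily E p) (hd : ∀ s, IsDiffeo E (p s)) (x₀ : M) {y : E}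
    (hy : y ∈ (extChartAt 𝓘(ℝ, E) x₀).target) :
    ∫ s in (0 : ℝ)..1, chartFlux Ω p x₀ (s, y) =
      (∫ s in (0 : ℝ)..1, fluxModel Ω p s ((extChartAt 𝓘(ℝ, E) x₀).symm y)).comp
        (chartInvDeriv E x₀ y) := by
  ext w
  rw [ContinuousLinearMap.intervalIntegral_apply
    ((continuous_chartFlux hp x₀ hy).intervalIntegrable _ _), ContinuousLinearMap.comp_apply,
    ContinuousLinearMap.intervalIntegral_apply
    ((continuous_fluxModel hp hd _).intervalIntegrable _ _)]
  refine intervalIntegral.integral_congr fun s _ => ?_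
  exact congrArg (fun L : E →L[ℝ] ℝ => L w) (chartFlux_eq_fluxModel hp x₀ s (hd s) hy)

/-- The total flux of a loop of diffeomorphisms that stays close to the identity is exact. -/
theorem exists_nhds_diagonal_flux_exact [CompactSpace M] [T2Space M] (Ω : SymplecticForm E M) :
    ∃ V : Set (M × M), IsOpen V ∧ (∀ x, (x, x) ∈ V) ∧ ∀ p : ℝ → Equiv.Perm M, SmoothFamily E p →
      (∀ s, IsDiffeo E (p s)) → p 0 = 1 → p 1 = 1 →
      (∀ s ∈ Icc (0 : ℝ) 1, ∀ x, (x, p s x) ∈ V) →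
      ∃ A : M → ℝ, IsPotential A (fun x => ∫ s in (0 : ℝ)..1, fluxModel Ω p s x) := by
  let _ : UniformSpace M := uniformSpaceOfCompactR1
  choose r hr hball _ using fun x₀ : M => exists_chartBall_subset (E := E) x₀ (O := univ) univ_mem
  choose lam hlam using fun x₀ => exists_isChartPrimitive Ω x₀ (hball x₀)
  obtain ⟨V₁, hV₁, hc₁⟩ := lebesgue_number_lemma (K := (univ : Set M)) isCompact_univ
    (fun x₀ : M => isOpen_chartBall (E := E) x₀ (r x₀))
    (fun x _ => mem_iUnion.2 ⟨x, mem_chartBall_self x (hr x)⟩)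
  choose a ha using fun x => hc₁ x (mem_univ x)
  obtain ⟨V₃, hV₃, hsymm, hV₃₁⟩ := comp_symm_mem_uniformity_sets hV₁
  obtain ⟨V₄, hV₄, hsymm₄, hV₄₃⟩ := comp_symm_mem_uniformity_sets hV₃
  have hsmall : ∀ z : M, {y | (z, y) ∈ V₄} ∈ 𝓝 z := fun z => UniformSpace.ball_mem_nhds z hV₄
  choose δ hδ hbδ hδV using fun z : M => exists_chartBall_subset (E := E) z (hsmall z)
  obtain ⟨V₂, hV₂, hc₂⟩ := lebesgue_number_lemma (K := (univ : Set M)) isCompact_univ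
    (fun z : M => isOpen_chartBall (E := E) z (δ z))
    (fun x _ => mem_iUnion.2 ⟨x, mem_chartBall_self x (hδ x)⟩)
  choose b hb using fun x => hc₂ x (mem_univ x)
  -- Small balls are so small that the one containing `x` lies in the large ball of every point
  -- `V₃`-close to `x`.
  have hb3 : ∀ x, ∀ y ∈ chartBall E (b x) (δ (b x)), (x, y) ∈ V₃ := by
    intro x y hy
    have h1 : x ∈ chartBall E (b x) (δ (b x)) := hb x (UniformSpace.mem_ball_self x hV₂)
    have h2 : (b x, x) ∈ V₄ := hδV (b x) h1
    have h3 : (b x, y) ∈ V₄ := hδV (b x) hy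
    exact hV₄₃ ⟨b x, hsymm₄.symm _ _ h2, h3⟩
  obtain ⟨V, hVV, hVo, hVd⟩ : ∃ V ⊆ V₂, IsOpen V ∧ ∀ x, (x, x) ∈ V := by
    refine ⟨interior V₂, interior_subset, isOpen_interior, fun x => ?_⟩
    exact refl_mem_uniformity (interior_mem_uniformity hV₂)
  refine ⟨V, hVo, hVd, fun p hp hd h0 h1 hpV => ?_⟩
  have hpb : ∀ s ∈ Icc (0 : ℝ) 1, ∀ x, p s x ∈ chartBall E (b x) (δ (b x)) := fun s hs x =>
    hb x (hVV (hpV s hs x))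
  have hsub : ∀ x₀ x, (x₀, x) ∈ V₃ →
      chartBall E (b x) (δ (b x)) ⊆ chartBall E (a x₀) (r (a x₀)) := fun x₀ x hx y hy =>
    ha x₀ (hV₃₁ ⟨x, hx, hb3 x y hy⟩)
  have hpath : ∀ x, ContMDiff 𝓘(ℝ, ℝ) 𝓘(ℝ, E) ∞ (fun s => p s x) := fun x =>
    ContMDiff.comp (I' := 𝓘(ℝ, ℝ).prod 𝓘(ℝ, E)) hp (contMDiff_id.prodMk contMDiff_const)
  -- The index `a x` need not depend continuously on `x`; by `hloc` it may be frozen near each `x₀`,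
  -- which makes `A` differentiable there.
  set A : M → ℝ := fun x => chartPathIntegral (lam (a x)) (a x) (fun s => p s x) with hA
  have hloc : ∀ x₀ x, (x₀, x) ∈ V₃ →
      A x = chartPathIntegral (lam (a x₀)) (a x₀) (fun s => p s x) := by
    intro x₀ x hx
    exact chartPathIntegral_eq (hlam (a x)) (hlam (a x₀)) (hbδ (b x))
      (hsub x x (refl_mem_uniformity hV₃)) (hsub x₀ x hx) (hpath x) (by simp [h0, h1])
      (fun s hs => hpb s hs x)
  refine ⟨fun x => - A x, fun x₀ => ?_⟩
  set c := extChartAt 𝓘(ℝ, E) x₀ with hc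
  obtain ⟨ε, hε, hεt, hεV⟩ := exists_chartBall_subset (E := E) x₀
    (UniformSpace.ball_mem_nhds x₀ hV₃)
  have hin : ∀ y ∈ Metric.ball (c x₀) ε, (x₀, c.symm y) ∈ V₃ := fun y hy =>
    hεV ⟨c.map_target (hεt hy), by
      change c (c.symm y) ∈ Metric.ball (c x₀) ε
      rw [c.right_inv (hεt hy)]
      exact hy⟩
  have hy₀ : c x₀ ∈ Metric.ball (c x₀) ε := Metric.mem_ball_self hε
  have h2 := hasFDerivAt_chartPathIntegral hp (h0.trans h1.symm) (hlam (a x₀)) x₀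
    Metric.isOpen_ball hεt (fun s hs y hy => hsub x₀ (c.symm y) (hin y hy) (hpb s hs _)) hy₀
  have h3 : HasFDerivAt (fun z => A (c.symm z)) (- ∫ s in (0 : ℝ)..1, chartFlux Ω p x₀ (s, c x₀))
      (c x₀) := by
    refine h2.congr_of_eventuallyEq ?_
    filter_upwards [Metric.isOpen_ball.mem_nhds hy₀] with z hz
    exact hloc x₀ (c.symm z) (hin z hz)
  have h4 := h3.neg
  rw [neg_neg, integral_chartFlux hp hd x₀ (mem_extChartAt_target x₀)] at h4
  rw [extChartAt_to_inv x₀] at h4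
  exact hasMFDerivAt_of_hasFDerivAt_chart x₀ (mem_extChartAt_source x₀) h4

end SmallLoops

/-! ### Exact averages of the flux form, by an uncountability argument -/

section Averages

/-- Among uncountably many points of a second countable space, some are arbitrarily close to each
other. -/
theorem exists_accumulation_of_secondCountable {Y : Type*} [TopologicalSpace Y]
    [SecondCountableTopology Y] (g : ℝ → Y) {l u : ℝ} (hlu : l < u) :
    ∃ a ∈ Ioo l u, ∀ N ∈ 𝓝 (a, g a), ∃ b ∈ Ioo l u, b ≠ a ∧ (b, g b) ∈ N := by
  by_contra! hcon
  let i : Ioo l u → ℝ × Y := fun t => (t, g t)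
  -- Topologise the interval by its graph under `g`. If all its points were isolated, it would be
  -- discrete and second countable, hence countable, against its positive length.
  let τ : TopologicalSpace (Ioo l u) := TopologicalSpace.induced i inferInstance
  have h2 : @SecondCountableTopology (Ioo l u) τ := TopologicalSpace.secondCountableTopology_induced _ _ i
  have h3 : @DiscreteTopology (Ioo l u) τ := by
    refine @discreteTopology_iff_nhds_ne _ τ |>.2 fun a => ?_
    obtain ⟨N, hN, hN'⟩ := hcon a a.2
    have h4 : i ⁻¹' N ∈ @nhds _ τ a := by
      rw [@nhds_induced _ _ _ i a]
      exact preimage_mem_comap hN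
    rw [← Filter.empty_mem_iff_bot]
    refine mem_inf_iff.2 ⟨i ⁻¹' N, h4, {a}ᶜ, mem_principal_self _, ?_⟩
    refine (eq_empty_iff_forall_notMem.2 ?_).symm
    rintro b ⟨hb1, hb2⟩
    exact hN' b b.2 (fun h => hb2 (Subtype.ext h)) hb1
  have h4 : Countable (Ioo l u) := @countable_of_Lindelof_of_discrete _ τ _ _
  have h5 : volume (Ioo l u) = 0 := (Set.countable_coe_iff.1 h4).measure_zero volume
  rw [Real.volume_Ioo, ENNReal.ofReal_eq_zero] at h5
  linarith

variable {E : Type} [NormedAddCommGroup E] [NormedSpace ℝ E]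
  {M : Type*} [TopologicalSpace M] [ChartedSpace E M] [IsManifold 𝓘(ℝ, E) ∞ M]
  {Ω : SymplecticForm E M}

theorem IsPotential.integral {D : ℝ → M → ℝ} {θ : ℝ → M → E →L[ℝ] ℝ}
    (hD : ContMDiff (𝓘(ℝ, ℝ).prod 𝓘(ℝ, E)) 𝓘(ℝ, ℝ) ∞ (fun q : ℝ × M => D q.1 q.2))
    (hθ : ∀ s, IsPotential (D s) (θ s)) (hc : ∀ x, Continuous (fun s => θ s x)) :
    IsPotential (fun x => ∫ s in (0 : ℝ)..1, D s x) (fun x => ∫ s in (0 : ℝ)..1, θ s x) := by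
  intro x
  set c := extChartAt 𝓘(ℝ, E) x with hcdef
  have hx : c x ∈ c.target := mem_extChartAt_target x
  have hs := contDiffOn_chart_of_contMDiff hD x
  have hU := isOpen_univ_prod_chart_target (E := E) x
  have h1 := hasFDerivAt_parametric_integral (isOpen_extChartAt_target x) hU
    (prod_mono_left (subset_univ _)) (hs.of_le ENat.LEInfty.out) hx
  refine hasMFDerivAt_of_hasFDerivAt_chart x (mem_extChartAt_source x) ?_
  refine h1.congr_fderiv ?_
  have h2 : ∀ s, (fderiv ℝ (fun q : ℝ × E => D q.1 (c.symm q.2)) (s, c x)).comp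
      (ContinuousLinearMap.inr ℝ ℝ E) = (θ s x).comp (chartInvDeriv E x (c x)) := by
    intro s
    have e1 : HasFDerivAt (fun q : ℝ × E => D q.1 (c.symm q.2)) _ (s, c x) :=
      ((hs.contDiffAt (hU.mem_nhds ⟨mem_univ s, hx⟩)).differentiableAt (by simp)).hasFDerivAt
    have e2 := HasFDerivAt.comp (f := fun z : E => (s, z)) (c x) e1
      (hasFDerivAt_prodMk_right s (c x))
    have e3 := HasMFDerivAt.hasFDerivAt_chart x hx (hθ s (c.symm (c x)))
    have e4 := e2.unique e3
    rw [e4, hcdef, extChartAt_to_inv x]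
  rw [intervalIntegral.integral_congr (g := fun s => (θ s x).comp (chartInvDeriv E x (c x)))
    (fun s _ => h2 s)]
  ext w
  rw [ContinuousLinearMap.intervalIntegral_apply
    (((hc x).clm_comp continuous_const).intervalIntegrable _ _), ContinuousLinearMap.comp_apply,
    ContinuousLinearMap.intervalIntegral_apply ((hc x).intervalIntegrable _ _)]
  rfl

omit [IsManifold 𝓘(ℝ, E) ∞ M] in
theorem SmoothFamily.continuous {P : Type*} [NormedAddCommGroup P] [NormedSpace ℝ P]
    {f : P → Equiv.Perm M} (hf : SmoothFamily E f) : Continuous (fun q : P × M => f q.1 q.2) :=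
  ContMDiff.continuous hf

theorem IsHamDiffeo.isSymplectic [CompleteSpace E] {φ : Equiv.Perm M} (h : IsHamDiffeo Ω φ) :
    IsSymplectic Ω φ := by
  obtain ⟨f, F, hf, hd, h0, rfl, hF⟩ := h
  exact (hF.isFluxPotential hf hd).isSymplectic hf hd h0 1

omit [IsManifold 𝓘(ℝ, E) ∞ M] in
theorem IsPotential.sub {A B : M → ℝ} {θ η : M → E →L[ℝ] ℝ} (hA : IsPotential A θ)
    (hB : IsPotential B η) : IsPotential (fun x => A x - B x) (fun x => θ x - η x) :=
  fun x => (hA x).sub (hB x)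

omit [IsManifold 𝓘(ℝ, E) ∞ M] in
theorem IsPotential.const_mul {A : M → ℝ} {θ : M → E →L[ℝ] ℝ} (hA : IsPotential A θ) (k : ℝ) :
    IsPotential (fun x => k * A x) (fun x => k • θ x) :=
  fun x => (hA x).const_smul k

/-- The path starts at `φ` and not at the identity, so its symplecticity is obtained factor by
factor; the constant factor has zero flux. -/
theorem IsHamDiffeo.inv_mul_path [CompleteSpace E] {f g : ℝ → Equiv.Perm M} {F G : ℝ → M → ℝ}
    (hf : SmoothFamily E f) (hg : SmoothFamily E g) (hfd : ∀ t, IsDiffeo E (f t))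
    (hgd : ∀ t, IsDiffeo E (g t)) (hf0 : f 0 = 1) (hg0 : g 0 = 1) (hF : GeneratesPath Ω F f)
    (hG : GeneratesPath Ω G g) {φ : Equiv.Perm M} (hφ : IsHamDiffeo Ω φ) :
    ∃ C, IsFluxPotential Ω (f⁻¹ * g * fun _ : ℝ => φ) C ∧
      ∀ t, IsSymplectic Ω ((f t)⁻¹ * g t * φ) := by
  have hB := hF.isFluxPotential hf hfd
  have hC := hG.isFluxPotential hg hgd
  have hfs := hB.isSymplectic hf hfd hf0
  have hgs := hC.isSymplectic hg hgd hg0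
  have hi := hf.inv hfd
  have hBi := hB.inv hf hfd hfs
  have his := hBi.isSymplectic hi (fun t => (hfd t).inv) (by simp [hf0])
  have hid : ∀ t, IsDiffeo E (f⁻¹ t) := fun t => (hfd t).inv
  have h1 := hBi.mul hC hi hg hid hgd his
  have h2 := h1.mul (IsFluxPotential.const φ) (hi.mul hg) (SmoothFamily.const hφ.isDiffeo)
    (fun t => (hid t).mul (hgd t)) (fun _ => hφ.isDiffeo)
    (fun t => (his t).mul (hgs t) (hid t) (hgd t))
  exact ⟨_, h2,
    fun t => ((his t).mul (hgs t) (hid t) (hgd t)).mul hφ.isSymplectic ((hid t).mul (hgd t))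
      hφ.isDiffeo⟩

/-- Over any time interval, some average of the flux forms of a smooth path of Hamiltonian
diffeomorphisms is exact. -/
theorem exists_isPotential_average [CompleteSpace E] [CompactSpace M] [T2Space M]
    [SecondCountableTopology M] {h : ℝ → Equiv.Perm M} (hh : SmoothFamily E h)
    (hham : ∀ t, IsHamDiffeo Ω (h t)) {l u : ℝ} (hlu : l < u) :
    ∃ a ∈ Ioo l u, ∃ b ∈ Ioo l u, ∃ C : M → ℝ,
      IsPotential C (fun x => ∫ s in (0 : ℝ)..1, fluxModel Ω h (b + s * (a - b)) x) := by
  obtain ⟨V, hVo, hVd, hV⟩ := exists_nhds_diagonal_flux_exact Ω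
  choose f F hf hfd hf0 hf1 hF using hham
  have hfc := fun t => (hf t).continuous
  -- The whole Hamiltonian path ending at `h t`, as one point of a mapping space. The choice of
  -- paths has no continuity in `t`.
  let g : ℝ → C(unitInterval × M, M) := fun t =>
    ⟨fun q => f t q.1 q.2, (hfc t).comp ((continuous_subtype_val.comp continuous_fst).prodMk
      continuous_snd)⟩
  obtain ⟨a, ha, hacc⟩ := exists_accumulation_of_secondCountable g hlu
  have hhd : ∀ t, IsDiffeo E (h t) := fun t => by
    rw [← hf1 t]
    exact hfd t 1
  -- For `z = (a, g a)` the second component is `q.2` itself, so the pair is on the diagonal;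
  -- compactness of `[0, 1] × M` gives a uniform neighbourhood.
  have hev : ∀ᶠ z : ℝ × C(unitInterval × M, M) in 𝓝 (a, g a), ∀ q ∈ (univ : Set (unitInterval × M)),
      (q.2, (f a q.1)⁻¹ (z.2 (q.1, (h z.1)⁻¹ (h (z.1 + q.1 * (a - z.1)) q.2)))) ∈ V := by
    refine isCompact_univ.eventually_forall_of_forall_eventually fun q _ => ?_
    have hc : Continuous (fun w : (ℝ × C(unitInterval × M, M)) × (unitInterval × M) =>
        (w.2.2, (f a w.2.1)⁻¹ (w.1.2 (w.2.1, (h w.1.1)⁻¹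
          (h (w.1.1 + w.2.1 * (a - w.1.1)) w.2.2))))) := by
      have c1 : Continuous (fun w : (ℝ × C(unitInterval × M, M)) × (unitInterval × M) =>
          h (w.1.1 + w.2.1 * (a - w.1.1)) w.2.2) :=
        hh.continuous.comp (f := fun w : (ℝ × C(unitInterval × M, M)) × (unitInterval × M) =>
          (w.1.1 + w.2.1 * (a - w.1.1), w.2.2)) (by fun_prop)
      have c2 : Continuous (fun w : (ℝ × C(unitInterval × M, M)) × (unitInterval × M) =>
          (h w.1.1)⁻¹ (h (w.1.1 + w.2.1 * (a - w.1.1)) w.2.2)) :=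
        (hh.inv hhd).continuous.comp ((continuous_fst.comp continuous_fst).prodMk c1)
      have c3 : Continuous (fun w : (ℝ × C(unitInterval × M, M)) × (unitInterval × M) =>
          w.1.2 (w.2.1, (h w.1.1)⁻¹ (h (w.1.1 + w.2.1 * (a - w.1.1)) w.2.2))) :=
        (continuous_snd.comp continuous_fst).eval ((continuous_fst.comp continuous_snd).prodMk c2)
      have c4 := ((hf a).inv (hfd a)).continuous.comp
        ((continuous_subtype_val.comp (continuous_fst.comp continuous_snd)).prodMk c3)
      exact (continuous_snd.comp continuous_snd).prodMk c4
    refine hc.continuousAt.eventually (hVo.mem_nhds ?_)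
    have e1 : (f a q.1)⁻¹ (g a (q.1, (h a)⁻¹ (h (a + q.1 * (a - a)) q.2))) = q.2 := by
      simp [g]
    simp only [e1]
    exact hVd q.2
  obtain ⟨b, hb, hba, hbN⟩ := hacc _ hev
  refine ⟨a, ha, b, hb, ?_⟩
  set β : ℝ → ℝ := fun s => b + s * (a - b) with hβ
  have hβs : ContDiff ℝ ∞ β := by fun_prop
  have hβd : ∀ s, HasDerivAt β (a - b) s := fun s => by
    simpa [hβ] using ((hasDerivAt_id s).mul_const (a - b)).const_add b
  have hbi : IsHamDiffeo Ω (h b)⁻¹ := IsHamDiffeo.inv ⟨f b, F b, hf b, hfd b, hf0 b, hf1 b, hF b⟩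
  obtain ⟨C, hC, hks⟩ := IsHamDiffeo.inv_mul_path (hf a) (hf b) (hfd a) (hfd b) (hf0 a) (hf0 b)
    (hF a) (hF b) hbi
  -- The path `k * hβh` closes up at the identity: at time `0` it is `h(b)⁻¹ h(b)`, at time `1` it
  -- is `h(a)⁻¹ h(b) h(b)⁻¹ h(a)`.
  set k : ℝ → Equiv.Perm M := (f a)⁻¹ * f b * fun _ => (h b)⁻¹ with hk_def
  set hβh : ℝ → Equiv.Perm M := fun s => h (β s) with hβh_def
  have hkS : SmoothFamily E k := (((hf a).inv (hfd a)).mul (hf b)).mul (.const hbi.isDiffeo)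
  have hkd : ∀ s, IsDiffeo E (k s) := fun s => (((hfd a s).inv).mul (hfd b s)).mul hbi.isDiffeo
  have hβS : SmoothFamily E hβh := hh.reparam hβs
  have hβD : ∀ s, IsDiffeo E (hβh s) := fun s => hhd _
  have hpS : SmoothFamily E (k * hβh) := hkS.mul hβS
  have hpd : ∀ s, IsDiffeo E ((k * hβh) s) := fun s => (hkd s).mul (hβD s)
  obtain ⟨A, hA⟩ := hV (k * hβh) hpS hpd
    (by simp [hk_def, hβh_def, hβ, hf0])
    (by simp [hk_def, hβh_def, hβ, hf1])
    (fun s hs x => hbN (⟨s, hs⟩, x) (mem_univ _))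
  -- the exact part of the flux of the loop
  set θ : ℝ → M → E →L[ℝ] ℝ := fun s x =>
    fluxModel Ω (k * hβh) s x - fluxModel Ω hβh s x with hθ
  have hpot : ∀ s, IsPotential (fun x => C s (hβh s x)) (θ s) := by
    intro s x
    have e1 := HasMFDerivAt.comp x (hC.2 s (hβh s x)) ((hβD s).mdifferentiableAt x).hasMFDerivAt
    have e2 := fluxForm_mul (Ω := Ω) hkS hβS (hkd s) (hβD s) (hks s) x
    have e3 : θ s x = (fluxForm Ω k s (hβh s x)).comp (mfderiv 𝓘(ℝ, E) 𝓘(ℝ, E) (hβh s) x) :=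
      sub_eq_of_eq_add e2
    rw [e3]
    exact e1
  have hθc : ∀ x, Continuous (fun s => θ s x) := fun x =>
    (continuous_fluxModel hpS hpd x).sub (continuous_fluxModel hβS hβD x)
  have hint := IsPotential.integral (contMDiff_comp_family hC.1 hβS) hpot hθc
  have hfin := (hA.sub hint).const_mul (a - b)⁻¹
  refine ⟨fun x => (a - b)⁻¹ * (A x - ∫ s in (0 : ℝ)..1, C s (hβh s x)), fun x => ?_⟩
  have e1 := hfin x
  -- What remains after removing the exact part is the flux of `hβh`, which is `a - b` times the
  -- flux form of `h` at time `b + s (a - b)`; here `a ≠ b` is needed.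
  have e2 : (a - b)⁻¹ • ((∫ s in (0 : ℝ)..1, fluxModel Ω (k * hβh) s x) -
      ∫ s in (0 : ℝ)..1, θ s x) = ∫ s in (0 : ℝ)..1, fluxModel Ω h (b + s * (a - b)) x := by
    rw [← intervalIntegral.integral_sub ((continuous_fluxModel hpS hpd x).intervalIntegrable _ _)
      ((hθc x).intervalIntegrable _ _), ← intervalIntegral.integral_smul]
    refine intervalIntegral.integral_congr fun s _ => ?_
    have e3 : fluxModel Ω hβh s x = (a - b) • fluxModel Ω h (b + s * (a - b)) x := by
      have := fluxForm_reparam (Ω := Ω) hh (hβd s).differentiableAt x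
      rw [(hβd s).deriv] at this
      exact this
    simp only [hθ, sub_sub_cancel]
    rw [e3, inv_smul_smul₀ (sub_ne_zero.2 hba.symm)]
  exact HasMFDerivAt.congr_mfderiv e1 e2

end Averages

/-! ### Limits of exact forms, and exactness at every time -/

section Limits

/-- The condition makes `S` clopen. It is used to propagate from one point properties that pass
between any two points of a chart ball. -/
theorem eq_univ_of_locally_invariant {X : Type*} [TopologicalSpace X] [PreconnectedSpace X]
    {S : Set X} (hS : S.Nonempty)
    (h : ∀ x₀, ∃ U ∈ 𝓝 x₀, ∀ x ∈ U, ∀ y ∈ U, x ∈ S → y ∈ S) : S = univ := by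
  refine IsClopen.eq_univ ⟨isClosed_iff_frequently.2 fun x hx => ?_, isOpen_iff_mem_nhds.2 fun x hx => ?_⟩ hS
  · obtain ⟨U, hU, hUS⟩ := h x
    obtain ⟨y, hy, hyU⟩ := (hx.and_eventually hU).exists
    exact hUS y hyU x (mem_of_mem_nhds hU) hy
  · obtain ⟨U, hU, hUS⟩ := h x
    exact mem_of_superset hU fun y hy => hUS x (mem_of_mem_nhds hU) y hy hx

variable {E : Type} [NormedAddCommGroup E] [NormedSpace ℝ E]
  {M : Type*} [TopologicalSpace M] [ChartedSpace E M] [IsManifold 𝓘(ℝ, E) ∞ M]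
  {Ω : SymplecticForm E M}

/-- A limit of exact 1-forms, locally uniform in charts, is exact. -/
theorem IsPotential.exists_of_tendsto [ConnectedSpace M] {C : ℕ → M → ℝ}
    {θ : ℕ → M → E →L[ℝ] ℝ} {η : M → E →L[ℝ] ℝ} (hC : ∀ n, IsPotential (C n) (θ n))
    (hlim : ∀ x₀ : M, ∃ r > 0,
      Metric.ball (extChartAt 𝓘(ℝ, E) x₀ x₀) r ⊆ (extChartAt 𝓘(ℝ, E) x₀).target ∧
      TendstoUniformlyOn
        (fun n y => (θ n ((extChartAt 𝓘(ℝ, E) x₀).symm y)).comp (chartInvDeriv E x₀ y))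
        (fun y => (η ((extChartAt 𝓘(ℝ, E) x₀).symm y)).comp (chartInvDeriv E x₀ y)) atTop
        (Metric.ball (extChartAt 𝓘(ℝ, E) x₀ x₀) r)) : ∃ B, IsPotential B η := by
  obtain ⟨x₁⟩ := (inferInstance : Nonempty M)
  -- Potentials are only defined up to constants; fixing the value at `x₁` makes the sequence
  -- converge there, and uniform convergence of the derivatives carries this from chart ball to
  -- chart ball.
  set D : ℕ → M → ℝ := fun n x => C n x - C n x₁ with hD
  have hDd : ∀ n (x₀ : M), ∀ y ∈ (extChartAt 𝓘(ℝ, E) x₀).target,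
      HasFDerivAt (fun z => D n ((extChartAt 𝓘(ℝ, E) x₀).symm z))
        ((θ n ((extChartAt 𝓘(ℝ, E) x₀).symm y)).comp (chartInvDeriv E x₀ y)) y :=
    fun n x₀ y hy => (HasMFDerivAt.hasFDerivAt_chart x₀ hy (hC n _)).sub_const _
  choose r hr hrt hru using hlim
  have hS : {x | Cauchy (map (fun n => D n x) atTop)} = univ := by
    refine eq_univ_of_locally_invariant ⟨x₁, ?_⟩ fun x₀ =>
      ⟨chartBall E x₀ (r x₀), (isOpen_chartBall x₀ _).mem_nhds (mem_chartBall_self x₀ (hr x₀)),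
        fun x hx y hy hxS => ?_⟩
    · have : (fun n => D n x₁) = fun _ => 0 := by simp [hD]
      rw [mem_ofPred_eq, this]
      exact (tendsto_const_nhds (x := (0 : ℝ))).cauchy_map
    · have h1 := cauchy_map_of_uniformCauchySeqOn_fderiv (l := atTop) Metric.isOpen_ball
        (convex_ball _ _).isPreconnected (hru x₀).uniformCauchySeqOn
        (fun n y hy => hDd n x₀ y (hrt x₀ hy)) hx.2 hy.2
        (by
          simp only [(extChartAt 𝓘(ℝ, E) x₀).left_inv hx.1]
          exact hxS)
      simp only [(extChartAt 𝓘(ℝ, E) x₀).left_inv hy.1] at h1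
      exact h1
  have hlim : ∀ x, ∃ l, Tendsto (fun n => D n x) atTop (𝓝 l) := fun x =>
    cauchy_map_iff_exists_tendsto.1 (hS.symm ▸ mem_univ x : x ∈ {x | Cauchy (map (fun n => D n x) atTop)})
  choose B hB using hlim
  refine ⟨B, fun x => hasMFDerivAt_of_hasFDerivAt_chart x (mem_extChartAt_source x) ?_⟩
  have h2 := hasFDerivAt_of_tendstoUniformlyOn Metric.isOpen_ball (hru x)
    (fun n y hy => hDd n x y (hrt x hy)) (fun y _ => hB ((extChartAt 𝓘(ℝ, E) x).symm y))
    (Metric.mem_ball_self (hr x))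
  rwa [extChartAt_to_inv x] at h2

theorem integral_chartFlux_comp {p : ℝ → Equiv.Perm M} (hp : SmoothFamily E p)
    (hd : ∀ s, IsDiffeo E (p s)) {b : ℝ → ℝ} (hb : Continuous b) (x₀ : M) {y : E}
    (hy : y ∈ (extChartAt 𝓘(ℝ, E) x₀).target) :
    (∫ s in (0 : ℝ)..1, fluxModel Ω p (b s) ((extChartAt 𝓘(ℝ, E) x₀).symm y)).comp
      (chartInvDeriv E x₀ y) = ∫ s in (0 : ℝ)..1, chartFlux Ω p x₀ (b s, y) := by
  have h1 : Continuous (fun s => chartFlux Ω p x₀ (b s, y)) := (continuous_chartFlux hp x₀ hy).comp hb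
  have h2 : Continuous (fun s => fluxModel Ω p (b s) ((extChartAt 𝓘(ℝ, E) x₀).symm y)) :=
    (continuous_fluxModel hp hd _).comp hb
  ext w
  rw [ContinuousLinearMap.intervalIntegral_apply (h1.intervalIntegrable _ _),
    ContinuousLinearMap.comp_apply,
    ContinuousLinearMap.intervalIntegral_apply (h2.intervalIntegrable _ _)]
  refine intervalIntegral.integral_congr fun s _ => ?_
  exact congrArg (fun L : E →L[ℝ] ℝ => L w) (chartFlux_eq_fluxModel hp x₀ (b s) (hd _) hy).symm

/-- The flux forms of a smooth path of Hamiltonian diffeomorphisms are exact. -/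
theorem exists_isPotential_fluxModel [FiniteDimensional ℝ E] [CompactSpace M] [T2Space M]
    [ConnectedSpace M] {h : ℝ → Equiv.Perm M} (hh : SmoothFamily E h)
    (hham : ∀ t, IsHamDiffeo Ω (h t)) (t₀ : ℝ) : ∃ B, IsPotential B (fluxModel Ω h t₀) := by
  have : SecondCountableTopology M := ChartedSpace.secondCountable_of_sigmaCompact E M
  have : CompleteSpace E := FiniteDimensional.complete ℝ E
  have : ProperSpace E := FiniteDimensional.proper ℝ E
  have hhd : ∀ t, IsDiffeo E (h t) := fun t => (hham t).isDiffeo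
  have hpos : ∀ n : ℕ, (0 : ℝ) < 1 / (n + 1) := fun n => Nat.one_div_pos_of_nat
  choose a ha b hb C hC using fun n : ℕ =>
    exists_isPotential_average (Ω := Ω) hh hham (l := t₀ - 1 / (n + 1)) (u := t₀ + 1 / (n + 1))
      (by linarith [hpos n])
  have htend : ∀ a : ℕ → ℝ, (∀ n : ℕ, a n ∈ Ioo (t₀ - 1 / (n + 1)) (t₀ + 1 / (n + 1))) →
      Tendsto a atTop (𝓝 t₀) := by
    intro a ha
    have h0 := tendsto_one_div_add_atTop_nhds_zero_nat (𝕜 := ℝ)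
    refine tendsto_of_tendsto_of_tendsto_of_le_of_le (g := fun n : ℕ => t₀ - 1 / ((n : ℝ) + 1))
      (h := fun n : ℕ => t₀ + 1 / ((n : ℝ) + 1)) ?_ ?_ (fun n => (ha n).1.le) (fun n => (ha n).2.le)
    · simpa using h0.const_sub t₀
    · simpa using h0.const_add t₀
  refine IsPotential.exists_of_tendsto hC fun x₀ => ?_
  obtain ⟨r, hr, hrt, -⟩ := exists_chartBall_subset (E := E) x₀ (O := univ) univ_mem
  have hcl : Metric.closedBall (extChartAt 𝓘(ℝ, E) x₀ x₀) (r / 2) ⊆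
      (extChartAt 𝓘(ℝ, E) x₀).target := (Metric.closedBall_subset_ball (by linarith)).trans hrt
  refine ⟨r / 2, by positivity, Metric.ball_subset_closedBall.trans hcl, ?_⟩
  rw [Metric.tendstoUniformlyOn_iff]
  intro ε hε
  -- Uniformity in the base point comes from compactness of the closed ball of half the radius. The
  -- bound `ε / 2` leaves room for a strict inequality after integration.
  have hev : ∀ᶠ z : ℝ × ℝ in 𝓝 (t₀, t₀), ∀ q ∈ Icc (0 : ℝ) 1 ×ˢ
      Metric.closedBall (extChartAt 𝓘(ℝ, E) x₀ x₀) (r / 2),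
      dist (chartFlux Ω h x₀ (z.2 + q.1 * (z.1 - z.2), q.2)) (chartFlux Ω h x₀ (t₀, q.2)) <
        ε / 2 := by
    refine (isCompact_Icc.prod (isCompact_closedBall _ _)).eventually_forall_of_forall_eventually
      fun q hq => ?_
    have hcont : ∀ s, ContinuousAt (chartFlux Ω h x₀) (s, q.2) := fun s =>
      (contDiffOn_chartFlux Ω hh x₀).continuousOn.continuousAt
        ((isOpen_univ_prod_chart_target x₀).mem_nhds ⟨mem_univ s, hcl hq.2⟩)
    have e1 : t₀ + q.1 * (t₀ - t₀) = t₀ := by ring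
    have c1 : ContinuousAt (fun w : (ℝ × ℝ) × ℝ × E =>
        chartFlux Ω h x₀ (w.1.2 + w.2.1 * (w.1.1 - w.1.2), w.2.2)) ((t₀, t₀), q) :=
      ContinuousAt.comp (g := chartFlux Ω h x₀) (f := fun w : (ℝ × ℝ) × ℝ × E =>
        (w.1.2 + w.2.1 * (w.1.1 - w.1.2), w.2.2)) (by simpa [e1] using hcont t₀) (by fun_prop)
    have c2 : ContinuousAt (fun w : (ℝ × ℝ) × ℝ × E => chartFlux Ω h x₀ (t₀, w.2.2))
        ((t₀, t₀), q) :=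
      ContinuousAt.comp (g := chartFlux Ω h x₀) (f := fun w : (ℝ × ℝ) × ℝ × E =>
        (t₀, w.2.2)) (hcont t₀) (by fun_prop)
    have c3 := c1.dist c2
    refine c3.eventually_lt continuousAt_const ?_
    simp only [sub_self, mul_zero, add_zero, dist_self]
    positivity
  filter_upwards [((htend a ha).prodMk_nhds (htend b hb)).eventually hev] with n hn y hy
  have hyt := hcl (Metric.ball_subset_closedBall hy)
  rw [integral_chartFlux_comp hh hhd (by fun_prop) x₀ hyt,
    ← chartFlux_eq_fluxModel hh x₀ t₀ (hhd t₀) hyt, dist_comm, dist_eq_norm]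
  have e2 : (∫ s in (0 : ℝ)..1, chartFlux Ω h x₀ (b n + s * (a n - b n), y)) -
      chartFlux Ω h x₀ (t₀, y) = ∫ s in (0 : ℝ)..1,
        (chartFlux Ω h x₀ (b n + s * (a n - b n), y) - chartFlux Ω h x₀ (t₀, y)) := by
    have h1 : Continuous (fun s => chartFlux Ω h x₀ (b n + s * (a n - b n), y)) :=
      (continuous_chartFlux hh x₀ hyt).comp (by fun_prop : Continuous fun s : ℝ => b n + s * (a n - b n))
    rw [intervalIntegral.integral_sub (h1.intervalIntegrable _ _) intervalIntegrable_const]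
    simp
  rw [e2]
  refine (intervalIntegral.norm_integral_le_of_norm_le_const (C := ε / 2) fun s hs => ?_).trans_lt
    (by simpa using hε)
  rw [uIoc_of_le zero_le_one] at hs
  rw [← dist_eq_norm]
  exact (hn (s, y) ⟨⟨hs.1.le, hs.2⟩, Metric.ball_subset_closedBall hy⟩).le

end Limits

/-! ### Smooth periodic potentials for loops in `Ham` -/

section Generation

variable {E : Type} [NormedAddCommGroup E] [NormedSpace ℝ E]
  {M : Type*} [TopologicalSpace M] [ChartedSpace E M] [IsManifold 𝓘(ℝ, E) ∞ M]
  {Ω : SymplecticForm E M}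

/-- In a chart, a family of potentials is determined up to a smooth function by its values at one
point. -/
theorem contDiffOn_potential_sub {h : ℝ → Equiv.Perm M} (hh : SmoothFamily E h)
    (hd : ∀ t, IsDiffeo E (h t)) {B : ℝ → M → ℝ} (hB : ∀ t, IsPotential (B t) (fluxModel Ω h t))
    (x₀ : M) {r : ℝ}
    (hr : Metric.ball (extChartAt 𝓘(ℝ, E) x₀ x₀) r ⊆ (extChartAt 𝓘(ℝ, E) x₀).target) {y₁ : E}
    (hy₁ : y₁ ∈ Metric.ball (extChartAt 𝓘(ℝ, E) x₀ x₀) r) :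
    ContDiffOn ℝ ∞ (fun q : ℝ × E => B q.1 ((extChartAt 𝓘(ℝ, E) x₀).symm q.2) -
      B q.1 ((extChartAt 𝓘(ℝ, E) x₀).symm y₁))
      (univ ×ˢ Metric.ball (extChartAt 𝓘(ℝ, E) x₀ x₀) r) := by
  set c := extChartAt 𝓘(ℝ, E) x₀ with hc
  set O : Set (ℝ × E) := univ ×ˢ Metric.ball (c x₀) r with hO_def
  have hO : IsOpen O := isOpen_univ.prod Metric.isOpen_ball
  set j : ℝ × (ℝ × E) → ℝ × E := fun w => (w.2.1, y₁ + w.1 • (w.2.2 - y₁)) with hj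
  have hjs : ContDiff ℝ ∞ j := by fun_prop
  set U : Set (ℝ × (ℝ × E)) := j ⁻¹' (univ ×ˢ c.target) with hU_def
  have hU : IsOpen U := (isOpen_univ_prod_chart_target x₀).preimage hjs.continuous
  have hOU : Icc (0 : ℝ) 1 ×ˢ O ⊆ U := fun w hw => ⟨mem_univ _, hr <|
    (convex_ball _ _).add_smul_sub_mem hy₁ hw.2.2 hw.1⟩
  set g : ℝ × (ℝ × E) → ℝ := fun w => chartFlux Ω h x₀ (j w) (w.2.2 - y₁) with hg
  have hgs : ContDiffOn ℝ ∞ g U :=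
    ((contDiffOn_chartFlux Ω hh x₀).comp hjs.contDiffOn fun w hw => hw).clm_apply
      (by fun_prop : ContDiff ℝ ∞ fun w : ℝ × (ℝ × E) => w.2.2 - y₁).contDiffOn
  -- The difference of two values of a potential is the integral of the flux form along the
  -- coordinate segment from `y₁`, a parametric integral with smooth integrand.
  refine (contDiffOn_parametric_integral hO hU hOU hgs).congr fun q hq => ?_
  have hcont : ContinuousOn (fun s => g (s, q)) (Icc 0 1) :=
    hgs.continuousOn.comp (by fun_prop) fun s hs => hOU ⟨hs, hq⟩
  have hder : ∀ s ∈ uIcc (0 : ℝ) 1,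
      HasDerivAt (fun s => B q.1 (c.symm (y₁ + s • (q.2 - y₁)))) (g (s, q)) s := by
    intro s hs
    rw [uIcc_of_le zero_le_one] at hs
    have hm : y₁ + s • (q.2 - y₁) ∈ c.target := (hOU (a := (s, q)) ⟨hs, hq⟩).2
    have e1 := HasMFDerivAt.hasFDerivAt_chart x₀ hm (hB q.1 (c.symm (y₁ + s • (q.2 - y₁))))
    rw [← chartFlux_eq_fluxModel hh x₀ q.1 (hd _) hm] at e1
    have e2 : HasDerivAt (fun s : ℝ => y₁ + s • (q.2 - y₁)) (q.2 - y₁) s := by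
      simpa using ((hasDerivAt_id s).smul_const (q.2 - y₁)).const_add y₁
    exact e1.comp_hasDerivAt s e2
  have := intervalIntegral.integral_eq_sub_of_hasDerivAt hder
    (ContinuousOn.intervalIntegrable (by rwa [uIcc_of_le zero_le_one]))
  rw [this]
  simp

/-- The only freedom is an additive function of time. Smoothness in time at one point therefore
spreads to all points by connectedness, and joint smoothness follows in each chart. -/
theorem contMDiff_of_isPotential [ConnectedSpace M] {h : ℝ → Equiv.Perm M} (hh : SmoothFamily E h)
    (hd : ∀ t, IsDiffeo E (h t)) {B : ℝ → M → ℝ} (hB : ∀ t, IsPotential (B t) (fluxModel Ω h t))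
    {x₁ : M} (hx₁ : ContDiff ℝ ∞ fun t => B t x₁) :
    ContMDiff (𝓘(ℝ, ℝ).prod 𝓘(ℝ, E)) 𝓘(ℝ, ℝ) ∞ (fun q : ℝ × M => B q.1 q.2) := by
  have hS : {x | ContDiff ℝ ∞ fun t => B t x} = univ := by
    refine eq_univ_of_locally_invariant ⟨x₁, hx₁⟩ fun x₀ => ?_
    obtain ⟨r, hr, hrt, -⟩ := exists_chartBall_subset (E := E) x₀ (O := univ) univ_mem
    refine ⟨chartBall E x₀ r, (isOpen_chartBall x₀ _).mem_nhds (mem_chartBall_self x₀ hr),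
      fun x hx y hy hxS => ?_⟩
    have e1 := contDiffOn_potential_sub hh hd hB x₀ hrt hx.2
    have e2 : ContDiff ℝ ∞ fun t : ℝ => (t, extChartAt 𝓘(ℝ, E) x₀ y) := by fun_prop
    have e3 := e1.comp_contDiff e2 fun t => ⟨mem_univ t, hy.2⟩
    have e4 := e3.add (show ContDiff ℝ ∞ fun t => B t x from hxS)
    refine (show ContDiff ℝ ∞ fun t => B t y from ?_)
    convert e4 using 2 with t
    simp only [Function.comp_apply, (extChartAt 𝓘(ℝ, E) x₀).left_inv hx.1,
      (extChartAt 𝓘(ℝ, E) x₀).left_inv hy.1, sub_add_cancel]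
  rintro ⟨t₀, x⟩
  set c := extChartAt 𝓘(ℝ, E) x with hc
  have hxS : ContDiff ℝ ∞ fun t => B t x :=
    (hS.symm ▸ mem_univ x : x ∈ {x | ContDiff ℝ ∞ fun t => B t x})
  obtain ⟨r, hr, hrt, -⟩ := exists_chartBall_subset (E := E) x (O := univ) univ_mem
  have e1 := contDiffOn_potential_sub hh hd hB x hrt (Metric.mem_ball_self hr)
  have e2 : ContDiffAt ℝ ∞ (fun q : ℝ × E => (B q.1 (c.symm q.2) - B q.1 (c.symm (c x))) + B q.1 x)
      (t₀, c x) := (e1.contDiffAt ((isOpen_univ.prod Metric.isOpen_ball).mem_nhds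
        ⟨mem_univ _, Metric.mem_ball_self hr⟩)).add (hxS.comp contDiff_fst).contDiffAt
  have e3 : ContMDiffAt (𝓘(ℝ, ℝ).prod 𝓘(ℝ, E)) 𝓘(ℝ, ℝ × E) ∞ (fun q : ℝ × M => (q.1, c q.2))
      (t₀, x) := contMDiffAt_fst.prodMk_space
    (ContMDiffAt.comp (I' := 𝓘(ℝ, E)) (t₀, x) contMDiffAt_extChartAt contMDiffAt_snd)
  have e4 := ContMDiffAt.comp (I' := 𝓘(ℝ, ℝ × E)) (t₀, x)
    (f := fun q : ℝ × M => (q.1, c q.2)) e2.contMDiffAt e3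
  refine e4.congr_of_eventuallyEq ?_
  filter_upwards [continuousAt_snd.eventually (extChartAt_source_mem_nhds (I := 𝓘(ℝ, E)) x)]
    with q hq
  simp only [Function.comp_apply, hc, (extChartAt 𝓘(ℝ, E) x).left_inv hq, extChartAt_to_inv x,
    sub_add_cancel]

/-- A smooth loop of Hamiltonian diffeomorphisms has a smooth periodic flux potential. -/
theorem exists_isFluxPotential [FiniteDimensional ℝ E] [CompactSpace M] [T2Space M]
    [ConnectedSpace M] {h : ℝ → Equiv.Perm M} (hh : SmoothFamily E h) (hper : Function.Periodic h 1)
    (hham : ∀ t, IsHamDiffeo Ω (h t)) :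
    ∃ B, IsFluxPotential Ω h B ∧ ∀ t x, B (t + 1) x = B t x := by
  classical
  obtain ⟨x₁⟩ := (inferInstance : Nonempty M)
  have hd : ∀ t, IsDiffeo E (h t) := fun t => (hham t).isDiffeo
  have hex := exists_isPotential_fluxModel (Ω := Ω) hh hham
  -- The potential is chosen as a function of the 1-form and not of the time, so that periodicity of
  -- the flux form passes to `B` at once. The value `0` for inexact forms is never met.
  let A : (M → E →L[ℝ] ℝ) → M → ℝ := fun θ =>
    if hθ : ∃ B, IsPotential B θ then hθ.choose else 0
  have hA : ∀ t, IsPotential (A (fluxModel Ω h t)) (fluxModel Ω h t) := fun t => by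
    simp only [A, dif_pos (hex t)]
    exact (hex t).choose_spec
  set B : ℝ → M → ℝ := fun t x => A (fluxModel Ω h t) x - A (fluxModel Ω h t) x₁ with hB_def
  have hB : ∀ t, IsPotential (B t) (fluxModel Ω h t) := fun t x => by
    have := (hA t x).sub (hasMFDerivAt_const (I := 𝓘(ℝ, E)) (A (fluxModel Ω h t) x₁) x)
    exact HasMFDerivAt.congr_mfderiv this (sub_zero _)
  have hθ : ∀ t, fluxModel Ω h (t + 1) = fluxModel Ω h t := fun t => by
    funext x
    have e1 := fluxForm_reparam (Ω := Ω) hh (b := fun s => s + 1) (t := t) (by fun_prop) x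
    have e2 : (fun s => h (s + 1)) = h := funext hper
    rw [e2] at e1
    have e3 : deriv (fun s : ℝ => s + 1) t = 1 := by simp
    rw [e3] at e1
    exact (e1.trans (one_smul ℝ _)).symm
  refine ⟨B, ⟨contMDiff_of_isPotential hh hd hB (x₁ := x₁) ?_, hB⟩, fun t x => ?_⟩
  · simpa [hB_def] using contDiff_const
  · simp only [hB_def, hθ]

end Generation

/-! ### Uniform convergence of Birkhoff averages -/

section UniqueErgodicity

open scoped BoundedContinuousFunction

variable {X : Type*} [TopologicalSpace X]

/-- The empirical measure of an orbit segment of length `k`. -/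
def empiricalMeasure [MeasurableSpace X] (T : X → X) (k : ℕ) (x : X) : Measure X :=
  (k : ENNReal)⁻¹ • ∑ j ∈ Finset.range k, Measure.dirac (T^[j] x)

omit [TopologicalSpace X] in
theorem isProbabilityMeasure_empiricalMeasure [MeasurableSpace X] (T : X → X) {k : ℕ} (hk : k ≠ 0)
    (x : X) : IsProbabilityMeasure (empiricalMeasure T k x) := by
  constructor
  simp only [empiricalMeasure, Measure.smul_apply, Measure.finsetSum_apply, measure_univ,
    Finset.sum_const, Finset.card_range, nsmul_eq_mul, mul_one, smul_eq_mul]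
  exact ENNReal.inv_mul_cancel (by simpa using hk) (ENNReal.natCast_ne_top k)

theorem integral_empiricalMeasure [MeasurableSpace X] [BorelSpace X] (T : X → X) (k : ℕ) (x : X)
    (f : X →ᵇ ℝ) : ∫ z, f z ∂(empiricalMeasure T k x) = birkhoffAverage ℝ T f k x := by
  rw [empiricalMeasure, integral_smul_measure, integral_finsetSum_measure fun j _ => f.integrable _]
  simp only [integral_dirac' _ _ f.continuous.stronglyMeasurable, birkhoffAverage, birkhoffSum]
  simp

/-- For a strictly ergodic map, the Birkhoff averages of a continuous function converge uniformly
to a constant. -/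
theorem StrictlyErgodic.exists_eventually_birkhoffAverage [CompactSpace X]
    [TopologicalSpace.MetrizableSpace X] {T : X → X} (hT : Continuous T) (h : StrictlyErgodic T)
    (f : X →ᵇ ℝ) :
    ∃ c, ∀ ε > 0, ∀ᶠ k in atTop, ∀ x, |birkhoffAverage ℝ T f k x - c| ≤ ε := by
  let _ : MeasurableSpace X := borel X
  have : BorelSpace X := ⟨rfl⟩
  obtain ⟨m, ⟨hmp, -⟩, -, huniq⟩ := h
  refine ⟨∫ z, f z ∂m, fun ε hε => ?_⟩
  by_contra hcon
  have hfreq : ∃ᶠ k in atTop, k ≠ 0 ∧ ∃ x, ε < |birkhoffAverage ℝ T f k x - ∫ z, f z ∂m| := by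
    rw [not_eventually] at hcon
    refine (hcon.and_eventually (eventually_ne_atTop 0)).mono fun k hk => ⟨hk.2, ?_⟩
    simpa using hk.1
  have : Nonempty X := nonempty_of_isProbabilityMeasure m
  set S : Set ℕ := {k | k ≠ 0 ∧ ∃ x, ε < |birkhoffAverage ℝ T f k x - ∫ z, f z ∂m|} with hS
  -- Krylov–Bogolyubov: if uniform convergence fails, take orbits `x k` with bad averages and a
  -- limit of their empirical measures along an ultrafilter of bad indices.
  choose! x hx using fun k (hk : k ∈ S) => hk.2
  have hne : NeBot (atTop ⊓ 𝓟 S) := frequently_mem_iff_neBot.1 hfreq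
  set u := Ultrafilter.of (atTop ⊓ 𝓟 S) with hu
  have hle : (u : Filter ℕ) ≤ atTop ⊓ 𝓟 S := Ultrafilter.of_le _
  have huS : ∀ᶠ k in (u : Filter ℕ), k ∈ S := hle (mem_inf_of_right (mem_principal_self S))
  have htop : (u : Filter ℕ) ≤ atTop := hle.trans inf_le_left
  -- For `k = 0` the empirical measure is zero, so `m` is put in its place; the ultrafilter does not
  -- see this index.
  let p : ℕ → ProbabilityMeasure X := fun k => if hk : k = 0 then ⟨m, hmp⟩ else
    ⟨empiricalMeasure T k (x k), isProbabilityMeasure_empiricalMeasure T hk (x k)⟩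
  obtain ⟨q, -, hq⟩ := isCompact_univ.ultrafilter_le_nhds (u.map p) (by simp)
  have hq' : Tendsto p u (𝓝 q) := hq
  rw [ProbabilityMeasure.tendsto_iff_forall_integral_tendsto] at hq'
  have hlim : ∀ g : X →ᵇ ℝ, Tendsto (fun k => birkhoffAverage ℝ T g k (x k)) u
      (𝓝 (∫ z, g z ∂(q : Measure X))) := by
    intro g
    refine (hq' g).congr' ?_
    filter_upwards [huS] with k hk
    have h0 : p k = ⟨empiricalMeasure T k (x k),
      isProbabilityMeasure_empiricalMeasure T hk.1 (x k)⟩ := dif_neg hk.1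
    rw [h0]
    exact integral_empiricalMeasure T k (x k) g
  -- The averages of `g ∘ T` and of `g` along an orbit differ only by two end terms, hence by at
  -- most `2 ‖g‖ / k`.
  have hinv : ∀ g : X →ᵇ ℝ, ∫ z, g (T z) ∂(q : Measure X) = ∫ z, g z ∂(q : Measure X) := by
    intro g
    let gT : X →ᵇ ℝ := g.compContinuous ⟨T, hT⟩
    have h1 := (hlim gT).sub (hlim g)
    have h2 : Tendsto (fun k => birkhoffAverage ℝ T gT k (x k) - birkhoffAverage ℝ T g k (x k)) u
        (𝓝 0) := by
      have h3 : Tendsto (fun k : ℕ => 2 * ‖g‖ / (k : ℝ)) u (𝓝 0) :=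
        (tendsto_const_div_atTop_nhds_zero_nat _).mono_left htop
      refine squeeze_zero_norm (fun k => ?_) h3
      have h4 : birkhoffAverage ℝ T gT k (x k) = birkhoffAverage ℝ T g k (T (x k)) := by
        simp only [birkhoffAverage, birkhoffSum, gT, BoundedContinuousFunction.compContinuous_apply,
          ContinuousMap.coe_mk]
        simp only [← Function.iterate_succ_apply', Function.iterate_succ_apply]
      rw [h4, ← dist_eq_norm, dist_birkhoffAverage_apply_birkhoffAverage]
      gcongr
      rw [dist_eq_norm]
      exact (norm_sub_le _ _).trans (by linarith [g.norm_coe_le_norm (T^[k] (x k)), g.norm_coe_le_norm (x k)])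
    exact sub_eq_zero.1 (tendsto_nhds_unique h1 h2)
  have hqm : (q : Measure X) = m := by
    refine huniq q inferInstance ⟨hT.measurable, ?_⟩
    have : IsProbabilityMeasure ((q : Measure X).map T) :=
      Measure.isProbabilityMeasure_map hT.measurable.aemeasurable
    refine ext_of_forall_integral_eq_of_IsFiniteMeasure fun g => ?_
    rw [integral_map hT.measurable.aemeasurable g.continuous.aestronglyMeasurable]
    exact hinv g
  have hfin := hlim f
  rw [hqm] at hfin
  have h5 : ∀ᶠ k in (u : Filter ℕ), |birkhoffAverage ℝ T f k (x k) - ∫ z, f z ∂m| < ε := by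
    simpa [Real.dist_eq] using (Metric.tendsto_nhds.1 hfin) ε hε
  obtain ⟨k, hk1, hk2⟩ := (h5.and huS).exists
  exact lt_asymm hk1 (hx k hk2)

end UniqueErgodicity

/-! ### Rotated iterates: homotopy class and flux potential -/

section Iterates

/-- The product `a (k - 1) * ⋯ * a 1 * a 0`. -/
def descProd {G : Type*} [Monoid G] (a : ℕ → G) : ℕ → G
  | 0 => 1
  | k + 1 => a k * descProd a k

theorem descProd_apply {P G : Type*} [Monoid G] (a : ℕ → P → G) (k : ℕ) (p : P) :
    descProd a k p = descProd (fun j => a j p) k := by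
  induction k with
  | zero => rfl
  | succ k ih => simp [descProd, ih]

theorem descProd_const {G : Type*} [Monoid G] (g : G) (k : ℕ) : descProd (fun _ => g) k = g ^ k := by
  induction k with
  | zero => simp [descProd]
  | succ k ih => simp [descProd, ih, pow_succ']

theorem descProd_mem {G : Type*} [Group G] (H : Subgroup G) {a : ℕ → G} (ha : ∀ j, a j ∈ H) (k : ℕ) :
    descProd a k ∈ H := by
  induction k with
  | zero => exact H.one_mem
  | succ k ih => exact H.mul_mem (ha k) ih

variable {E : Type} [NormedAddCommGroup E] [NormedSpace ℝ E]
  {M : Type*} [TopologicalSpace M] [ChartedSpace E M]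

theorem SmoothFamily.descProd {P : Type*} [NormedAddCommGroup P] [NormedSpace ℝ P]
    {a : ℕ → P → Equiv.Perm M} (ha : ∀ j, SmoothFamily E (a j)) (k : ℕ) :
    SmoothFamily E (descProd a k) := by
  induction k with
  | zero => exact SmoothFamily.const IsDiffeo.one
  | succ k ih => exact (ha k).mul ih

/-- The composition `h (t + (k - 1) α) ∘ ⋯ ∘ h (t + α) ∘ h t`. -/
def rotatedProd (h : ℝ → Equiv.Perm M) (α : ℝ) (k : ℕ) : ℝ → Equiv.Perm M :=
  descProd (fun j t => h (t + j * α)) k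

variable [CompleteSpace E] [IsManifold 𝓘(ℝ, E) ∞ M] {Ω : SymplecticForm E M}

theorem smoothFamily_rotatedProd (h : HamLoop Ω) (α : ℝ) (k : ℕ) :
    SmoothFamily E (rotatedProd (h : ℝ → Equiv.Perm M) α k) :=
  SmoothFamily.descProd (fun _ => h.2.1.reparam (contDiff_id.add contDiff_const)) k

theorem rotatedProd_mem_ham (h : HamLoop Ω) (α : ℝ) (k : ℕ) (t : ℝ) :
    rotatedProd (h : ℝ → Equiv.Perm M) α k t ∈ Ham Ω := by
  rw [rotatedProd, descProd_apply]
  exact descProd_mem _ (fun j => h.2.2.2 _) k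

theorem periodic_rotatedProd (h : HamLoop Ω) (α : ℝ) (k : ℕ) :
    Function.Periodic (rotatedProd (h : ℝ → Equiv.Perm M) α k) 1 := by
  intro t
  simp only [rotatedProd, descProd_apply]
  congr 1
  funext j
  rw [add_right_comm]
  exact h.2.2.1 _

/-- The loop `rotatedProd h α k`, moved to the identity. -/
def basedRotatedProd (h : HamLoop Ω) (α : ℝ) (k : ℕ) : BasedHamLoop Ω :=
  ⟨rotatedProd h α k * fun _ => (rotatedProd (h : ℝ → Equiv.Perm M) α k 0)⁻¹,
    ⟨(smoothFamily_rotatedProd h α k).mul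
        (.const (rotatedProd_mem_ham h α k 0 : IsHamDiffeo Ω _).isDiffeo.inv),
      fun t => by simp [periodic_rotatedProd h α k t],
      fun t => (Ham Ω).mul_mem (rotatedProd_mem_ham h α k t)
        ((Ham Ω).inv_mem (rotatedProd_mem_ham h α k 0))⟩, by simp⟩

theorem mk_basedRotatedProd (h : HamLoop Ω) {γ : PiOneHam Ω} (hγ : Represents h γ) (α : ℝ) (k : ℕ) :
    PiOneHam.mk (basedRotatedProd h α k) = γ ^ k := by
  obtain ⟨g, rfl, K, hK⟩ := hγ
  have h1 : PiOneHam.mk g ^ k = PiOneHam.mk (g ^ k) := rfl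
  rw [h1]
  refine (Con.eq (basedHomotopyCon Ω)).2 ?_
  -- As the homotopy parameter goes from `0` to `1`, the loop moves from `h` to `g` and the rotation
  -- angle from `α` to `0`.
  set a : ℕ → ℝ × ℝ → Equiv.Perm M := fun j p => K (p.1, p.2 + j * ((1 - p.1) * α)) with ha
  have haS : SmoothFamily E (descProd a k) := SmoothFamily.descProd (fun j =>
    hK.smooth.reparam (b := fun p : ℝ × ℝ => (p.1, p.2 + j * ((1 - p.1) * α))) (by fun_prop)) k
  have ham : ∀ p, descProd a k p ∈ Ham Ω := fun p => by
    rw [descProd_apply]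
    exact descProd_mem _ (fun j => hK.mem_ham _) k
  have had : ∀ p, IsDiffeo E (descProd a k p) := fun p =>
    (ham p : IsHamDiffeo Ω _).isDiffeo
  have h0 : ∀ t, descProd a k (0, t) = rotatedProd (h : ℝ → Equiv.Perm M) α k t := fun t => by
    simp only [rotatedProd, descProd_apply, ha, hK.left, sub_zero, one_mul]
  have h1 : ∀ t, descProd a k (1, t) = (g : ℝ → Equiv.Perm M) t ^ k := fun t => by
    simp only [descProd_apply, ha, hK.right, sub_self, zero_mul, mul_zero, add_zero,
      descProd_const]
  -- Correction by the inverse at time `0` keeps all loops based; at the end it is trivial since `g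
  -- 0 = 1`.
  refine ⟨descProd a k * fun p => (descProd a k (p.1, 0))⁻¹, ⟨?_, ?_, ?_, ?_, ?_⟩, ?_⟩
  · exact haS.mul ((haS.inv had).reparam (b := fun p : ℝ × ℝ => (p.1, (0 : ℝ))) (by fun_prop))
  · exact fun p => (Ham Ω).mul_mem (ham p) ((Ham Ω).inv_mem (ham _))
  · intro s t
    have : descProd a k (s, t + 1) = descProd a k (s, t) := by
      simp only [descProd_apply, ha]
      congr 1
      funext j
      rw [add_right_comm, hK.periodic]
    simp [this]
  · intro t
    simp [h0, basedRotatedProd]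
  · intro t
    simp [h1, g.2.2]
  · intro s
    simp

omit [CompleteSpace E] [IsManifold 𝓘(ℝ, E) ∞ M] in
theorem IsFluxPotential.shift {f : ℝ → Equiv.Perm M} (hf : SmoothFamily E f) {B : ℝ → M → ℝ}
    (hB : IsFluxPotential Ω f B) (c : ℝ) :
    IsFluxPotential Ω (fun t => f (t + c)) (fun t => B (t + c)) := by
  refine ⟨ContMDiff.comp (I' := 𝓘(ℝ, ℝ).prod 𝓘(ℝ, E)) (g := fun q : ℝ × M => B q.1 q.2) hB.1
    (((contDiff_id.add contDiff_const).contMDiff.comp contMDiff_fst).prodMk contMDiff_snd),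
    fun t x => ?_⟩
  have e1 := fluxForm_reparam (Ω := Ω) hf (b := fun s => s + c) (t := t) (by fun_prop) x
  have e2 : deriv (fun s : ℝ => s + c) t = 1 := by simp
  rw [e2] at e1
  exact HasMFDerivAt.congr_mfderiv (hB.2 (t + c) x) (e1.trans (one_smul ℝ _)).symm

/-- By the cocycle rule each further factor on the left adds one term, evaluated at the point
reached so far. The result is a Birkhoff sum of the skew product. -/
theorem isFluxPotential_rotatedProd (h : HamLoop Ω) {B : ℝ → M → ℝ}
    (hB : IsFluxPotential Ω (h : ℝ → Equiv.Perm M) B) (α : ℝ) (k : ℕ) :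
    IsFluxPotential Ω (rotatedProd (h : ℝ → Equiv.Perm M) α k)
      (fun t x => ∑ j ∈ Finset.range k,
        B (t + j * α) (rotatedProd (h : ℝ → Equiv.Perm M) α j t x)) := by
  induction k with
  | zero =>
    simp only [Finset.range_zero, Finset.sum_empty]
    exact IsFluxPotential.const 1
  | succ k ih =>
    have hham : ∀ t, IsHamDiffeo Ω ((h : ℝ → Equiv.Perm M) t) := h.2.2.2
    have := (hB.shift h.2.1 (k * α)).mul ih (h.2.1.reparam (contDiff_id.add contDiff_const))
      (smoothFamily_rotatedProd h α k) (fun t => (hham _).isDiffeo)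
      (fun t => (rotatedProd_mem_ham h α k t : IsHamDiffeo Ω _).isDiffeo) (fun t => (hham _).isSymplectic)
    simp only [Finset.sum_range_succ_comm]
    exact this

end Iterates

/-! ### Hofer length estimates and conclusion -/

section Norm

open scoped BoundedContinuousFunction

variable {E : Type} [NormedAddCommGroup E] [NormedSpace ℝ E]
  {M : Type*} [TopologicalSpace M] [ChartedSpace E M]

omit [ChartedSpace E M] in
-- Continuity of maps on `M × S¹` obtained from periodic families can be checked on `M × ℝ`.
theorem isQuotientMap_prod_circle :
    IsQuotientMap (fun q : M × ℝ => (q.1, (q.2 : UnitAddCircle))) :=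
  (IsOpenQuotientMap.id.prodMap QuotientAddGroup.isOpenQuotientMap_mk).isQuotientMap

theorem GeneratesPath.bddRange [CompactSpace M] {Ω : SymplecticForm E M} {F : ℝ → M → ℝ}
    {f : ℝ → Equiv.Perm M} (h : GeneratesPath Ω F f) (t : ℝ) :
    BddAbove (range (F t)) ∧ BddBelow (range (F t)) := by
  have hc : IsCompact (range (F t)) := isCompact_range (contMDiff_slice h.1 t).continuous
  exact ⟨hc.bddAbove, hc.bddBelow⟩

theorem hoferLength_nonneg [CompactSpace M] [Nonempty M] {Ω : SymplecticForm E M}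
    {F : ℝ → M → ℝ} {f : ℝ → Equiv.Perm M} (h : GeneratesPath Ω F f) : 0 ≤ hoferLength F :=
  intervalIntegral.integral_nonneg zero_le_one fun t _ =>
    sub_nonneg.2 (ciInf_le_ciSup (h.bddRange t).2 (h.bddRange t).1)

omit [TopologicalSpace M] [ChartedSpace E M] in
theorem hoferLength_le [Nonempty M] {F : ℝ → M → ℝ} {c ε : ℝ} (h : ∀ t x, |F t x - c| ≤ ε) :
    hoferLength F ≤ 2 * ε := by
  -- Bounding the norm of the integral by a constant requires no measurability of the oscillation in
  -- `t`.
  suffices hI : ‖hoferLength F‖ ≤ 2 * ε * |(1 : ℝ) - 0| from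
    (le_abs_self _).trans (hI.trans_eq (by norm_num))
  refine intervalIntegral.norm_integral_le_of_norm_le_const fun t _ => ?_
  have hu : ∀ x, F t x ≤ c + ε := fun x => by linarith [(abs_le.1 (h t x)).2]
  have hl : ∀ x, c - ε ≤ F t x := fun x => by linarith [(abs_le.1 (h t x)).1]
  have h1 : ⨆ x, F t x ≤ c + ε := ciSup_le hu
  have h2 : c - ε ≤ ⨅ x, F t x := le_ciInf hl
  have h3 : ⨅ x, F t x ≤ ⨆ x, F t x :=
    ciInf_le_ciSup ⟨_, forall_mem_range.2 hl⟩ ⟨_, forall_mem_range.2 hu⟩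
  rw [Real.norm_of_nonneg (sub_nonneg.2 h3)]
  linarith

variable [IsManifold 𝓘(ℝ, E) ∞ M] {Ω : SymplecticForm E M}

theorem hoferNorm_nonneg [CompleteSpace E] [CompactSpace M] [Nonempty M] (γ : PiOneHam Ω) :
    0 ≤ hoferNorm γ := by
  refine Real.sInf_nonneg ?_
  rintro l ⟨g, F, -, hF, rfl⟩
  exact hoferLength_nonneg hF

theorem hoferNorm_le [CompleteSpace E] [CompactSpace M] [Nonempty M] {γ : PiOneHam Ω}
    {g : BasedHamLoop Ω} {F : ℝ → M → ℝ} (hg : PiOneHam.mk g = γ) (hF : GeneratesPath Ω F g) :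
    hoferNorm γ ≤ hoferLength F := by
  refine csInf_le ⟨0, ?_⟩ ⟨g, F, hg, hF, rfl⟩
  rintro l ⟨g, F, -, hF, rfl⟩
  exact hoferLength_nonneg hF

theorem skewProduct_coe [CompleteSpace E] (h : HamLoop Ω) (α : ℝ) (x : M) (t : ℝ) :
    skewProduct h α (x, (t : UnitAddCircle)) =
      ((h : ℝ → Equiv.Perm M) t x, ((t + α : ℝ) : UnitAddCircle)) := rfl

theorem continuous_skewProduct [CompleteSpace E] (h : HamLoop Ω) (α : ℝ) :
    Continuous (skewProduct h α) := by
  rw [isQuotientMap_prod_circle.continuous_iff]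
  have h1 : Continuous fun q : M × ℝ => (h : ℝ → Equiv.Perm M) q.2 q.1 :=
    h.2.1.continuous.comp continuous_swap
  have h2 : Continuous fun q : M × ℝ => ((q.2 + α : ℝ) : UnitAddCircle) :=
    (AddCircle.continuous_mk' 1).comp (continuous_snd.add continuous_const)
  exact h1.prodMk h2

theorem iterate_skewProduct [CompleteSpace E] (h : HamLoop Ω) (α : ℝ) (k : ℕ) (x : M) (t : ℝ) :
    (skewProduct h α)^[k] (x, (t : UnitAddCircle)) =
      (rotatedProd (h : ℝ → Equiv.Perm M) α k t x, ((t + k * α : ℝ) : UnitAddCircle)) := by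
  induction k with
  | zero => simp [rotatedProd, descProd]
  | succ k ih =>
    rw [Function.iterate_succ_apply', ih, skewProduct_coe]
    refine Prod.ext rfl (congrArg (fun r : ℝ => (r : UnitAddCircle)) ?_)
    push_cast
    ring

/-- Once the Birkhoff averages are `ε`-close to `c`, the Hamiltonian of the `k`-th rotated product
is within `k ε` of `-(k c)` everywhere, so its oscillation is at most `2 k ε` at each time. -/
theorem eventually_hoferNorm_le [FiniteDimensional ℝ E] [CompleteSpace E] [T2Space M]
    [CompactSpace M] [ConnectedSpace M] {γ : PiOneHam Ω} {h : HamLoop Ω} (hγ : Represents h γ)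
    (hh : IsStrictlyErgodicLoop h) {ε : ℝ} (hε : 0 < ε) :
    ∀ᶠ k : ℕ in atTop, hoferNorm (γ ^ k) ≤ 2 * (k * ε) := by
  have : SecondCountableTopology M := ChartedSpace.secondCountable_of_sigmaCompact E M
  obtain ⟨α, -, hα⟩ := hh
  obtain ⟨B, hB, hper⟩ := exists_isFluxPotential h.2.1 h.2.2.1 h.2.2.2
  have hBp : Function.Periodic B 1 := fun t => funext (hper t)
  let φ : M × UnitAddCircle → ℝ := fun q => hBp.lift q.2 q.1
  have hφ : Continuous φ := by
    rw [isQuotientMap_prod_circle.continuous_iff]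
    exact hB.1.continuous.comp continuous_swap
  obtain ⟨c, hc⟩ := hα.exists_eventually_birkhoffAverage (continuous_skewProduct h α)
    (BoundedContinuousFunction.mkOfCompact ⟨φ, hφ⟩)
  filter_upwards [hc ε hε, eventually_gt_atTop 0] with k hk hk0
  have hk0' : (0 : ℝ) < k := by exact_mod_cast hk0
  -- Moving the loop to the identity by a constant factor on the right does not change its
  -- Hamiltonian.
  have hgen := ((isFluxPotential_rotatedProd h hB α k).generatesPath (smoothFamily_rotatedProd h α k)
    fun t => (rotatedProd_mem_ham h α k t : IsHamDiffeo Ω _).isDiffeo).mul_right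
      (rotatedProd (h : ℝ → Equiv.Perm M) α k 0)⁻¹
  refine (hoferNorm_le (mk_basedRotatedProd h hγ α k) hgen).trans
    (hoferLength_le (c := - (k * c)) fun t x => ?_)
  -- The Hamiltonian at `x` is minus the potential at the source point `y`; the skew product orbit
  -- therefore starts at `(y, t)`.
  set y := (rotatedProd (h : ℝ → Equiv.Perm M) α k t)⁻¹ x
  have h1 := hk (y, (t : UnitAddCircle))
  have h2 : birkhoffAverage ℝ (skewProduct h α) φ k (y, (t : UnitAddCircle)) =
      (k : ℝ)⁻¹ * ∑ j ∈ Finset.range k,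
        B (t + j * α) (rotatedProd (h : ℝ → Equiv.Perm M) α j t y) := by
    simp only [birkhoffAverage, birkhoffSum, iterate_skewProduct, smul_eq_mul]
    rfl
  have h3 := h2 ▸ h1
  set s := ∑ j ∈ Finset.range k, B (t + j * α) (rotatedProd (h : ℝ → Equiv.Perm M) α j t y)
  have h4 : |-s - -(k * c)| = k * |(k : ℝ)⁻¹ * s - c| := by
    rw [← abs_of_pos hk0', ← abs_mul, abs_of_pos hk0', mul_sub, mul_inv_cancel_left₀ hk0'.ne',
      ← abs_neg]
    congr 1
    ring
  rw [h4]
  exact mul_le_mul_of_nonneg_left h3 hk0'.le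

theorem tendsto_hoferNorm_pow_div [FiniteDimensional ℝ E] [CompleteSpace E] [T2Space M]
    [CompactSpace M] [ConnectedSpace M] {γ : PiOneHam Ω} {h : HamLoop Ω} (hγ : Represents h γ)
    (hh : IsStrictlyErgodicLoop h) :
    Tendsto (fun k : ℕ => hoferNorm (γ ^ k) / (k : ℝ)) atTop (𝓝 0) := by
  rw [Metric.tendsto_nhds]
  intro ε hε
  filter_upwards [eventually_hoferNorm_le hγ hh (show 0 < ε / 3 by positivity),
    eventually_gt_atTop 0] with k hk hk0
  have hk0' : (0 : ℝ) < k := by exact_mod_cast hk0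
  rw [Real.dist_eq, sub_zero, abs_of_nonneg (div_nonneg (hoferNorm_nonneg _) hk0'.le),
    div_lt_iff₀ hk0']
  nlinarith

end Norm

end

theorem mainTheorem11 (n : ℕ) {M : Type*} [TopologicalSpace M]
    [ChartedSpace (EuclideanSpace ℝ (Fin (2 * n))) M] [IsManifold (𝓡 (2 * n)) ∞ M]
    [T2Space M] [CompactSpace M] [ConnectedSpace M]
    (Ω : SymplecticForm (EuclideanSpace ℝ (Fin (2 * n))) M)
    (γ : PiOneHam Ω) (h : HamLoop Ω) (hγ : Represents h γ) (hh : IsStrictlyErgodicLoop h) :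
    Tendsto (fun k : ℕ => hoferNorm (γ ^ k) / (k : ℝ)) atTop (𝓝 0) :=
  tendsto_hoferNorm_pow_div hγ hh
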